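/- **Setting.** Let $m\ge 1$, $n,\ell\ge 0$, $r=2\ell$, $J=\begin{bmatrix}0&I_\ell\\-I_\ell&0\end{bmatrix}$. Let $P(\lambda)=\sum_{i=0}^m\lambda^iA_i$ with $A_i\in\mathbb C^{n\times n}$, $A_m\ne 0$. A matrix polynomial or rational matrix $X(\lambda)$ is called $T$-even if $X(-\lambda)^T=X(\lambda)$; a $T$-even rational matrix is also called Hamiltonian. Let $G(\lambda)\in\mathbb C(\lambda)^{n\times n}$ be Hamiltonian, and let $G(\lambda)=P(\lambda)+C(\lambda I_r-A)^{-1}B$ be a Hamiltonian realization, that is, $P$ is $T$-even, $(JA)^T=JA$ and $JB=C^T$. Assume that it is minimal: $r$ is the smallest size of $\lambda E'-A'$ among all realizations $G=P'+C'(\lambda E'-A')^{-1}B'$ with $P'$ a matrix polynomial and $E'$ nonsingular. Put $\mathcal S(\lambda)=\begin{bmatrix}P(\lambda)&C\\B&A-\lambda I_r\end{bmatrix}$. **Index tuples.** For $0\le p\le k$ with $k-p$ even, the admissible tuple of $\{0,\dots,k\}$ of index $p$ is $(k-1:k,\;k-3:k-2,\;\dots,\;p+1:p+2,\;0:p)$,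 and its symmetric complement is $(k-1,k-3,\dots,p+1,\;0:p-1,\;0:p-2,\dots,0:1,\;0)$, the part after $p+1$ being absent if $p=0$; here $a:b$ stands for $a,a+1,\dots,b$. Let $0\le h\le m-1$ be even. Let $\mathbf w$ be the admissible tuple of $\{0,\dots,h\}$ of index $0$, with symmetric complement $\mathbf c_w$. Let $\mathbf z+m$ be an admissible tuple of $\{0,\dots,m-h-1\}$, with index $\mathrm{Ind}(\mathbf z+m)$ and symmetric complement $\mathbf c_z+m$. Assume that $\mathrm{Ind}(\mathbf z+m)=0$ if $A_m$ is singular. Let $i_0(\mathbf w)$ be the largest $s$ such that $(s,\dots,1,0)$ is a subtuple (obtained by deleting entries) of $\mathbf w$. **The pencil.** For $X\in\mathbb C^{n\times n}$ let $M_0(X)=\mathrm{diag}(I_{(m-1)n},X)$, $M_{-m}(X)=\mathrm{diag}(X,I_{(m-1)n})$ and, for $1\le i\le m-1$, $M_i(X)=\mathrm{diag}\left(I_{(m-i-1)n},\begin{bmatrix}X&I_n\\I_n&0\end{bmatrix},I_{(i-1)n}\right)$, $M_{-i}(X)=\mathrm{diag}\left(I_{(m-i-1)n},\begin{bmatrix}0&I_n\\I_n&X\end{bmatrix},I_{(i-1)n}\right)$.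 Let $M_i^P=M_i(-A_i)$ for $0\le i\le m-1$, $M_{-i}^P=M_{-i}(A_i)$ for $1\le i\le m$, and $M^P_{(t_1,\dots,t_k)}=M^P_{t_1}\cdots M^P_{t_k}$. Put $$L(\lambda)=(\lambda M^P_{\mathbf z}-M^P_{\mathbf w})\,M^P_{\mathbf c_w}M^P_{\mathbf c_z}.$$ A quasi-identity matrix is a matrix $Q=\epsilon_1I_n\oplus\cdots\oplus\epsilon_mI_n$ with $\epsilon_i\in\{1,-1\}$; $\epsilon_j$ is its $j$-th parameter. **Rosenbrock strong linearization.** Consider a pencil $\mathbb L(\lambda)=\begin{bmatrix}\mathcal X-\lambda\mathcal Y&\mathcal C\\\mathcal B&H-\lambda K\end{bmatrix}$ of size $mn+r$ with $K\in\mathbb C^{r\times r}$ nonsingular, with transfer function $\mathbb G(\lambda)=\mathcal X-\lambda\mathcal Y+\mathcal C(\lambda K-H)^{-1}\mathcal B$. It is a Rosenbrock strong linearization of $G(\lambda)$ if it is irreducible (this realization of $\mathbb G$ is minimal) and: (a) there are unimodular matrix polynomials $U(\lambda),V(\lambda)$ of size $mn$ and nonsingular $U_0,V_0\in\mathbb C^{r\times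 r}$ with $\mathrm{diag}(U,U_0)\,\mathbb L\,\mathrm{diag}(V,V_0)=\mathrm{diag}(I_{(m-1)n},\mathcal S)$; (b) there are biproper rational matrices $\mathcal O_\ell,\mathcal O_r$ of size $mn$ (they converge to nonsingular matrices as $\lambda\to\infty$) with $\mathcal O_\ell\,\lambda^{-1}\mathbb G\,\mathcal O_r=\mathrm{diag}(I_{(m-1)n},\lambda^{-m}G)$. **Theorem.** There is a choice of signs $\epsilon_1,\dots,\epsilon_m\in\{1,-1\}$, depending only on $m$, $h$ and $\mathbf z$, such that for every size $n$ and every $T$-even $P$ of degree $m$ as above, the quasi-identity matrix $Q$ with parameters $\epsilon_1,\dots,\epsilon_m$ makes $QL(\lambda)$ $T$-even. For the given $P$, the quasi-identity matrix $Q$ for which $QL(\lambda)$ is $T$-even is unique up to multiplication by $-1$. For this $Q$, let $\mathbf s$ be its $(m-i_0(\mathbf w))$-th parameter. Then $$\mathbb T(\lambda)=\begin{bmatrix}\mathbf s\,QL(\lambda)&e_{m-i_0(\mathbf w)}\otimes B^TJ^T\\ e_{m-i_0(\mathbf w)}^T\otimes B&A-\lambda I_r\end{bmatrix}$$ (where $e_j$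 is the $j$-th column of $I_m$) is Hamiltonian, i.e. $\mathrm{diag}(I_{mn},J)\,\mathbb T(\lambda)$ is $T$-even, and $\mathbb T(\lambda)$ is a Rosenbrock strong linearization of $G(\lambda)$. Its transfer function $\mathbb G(\lambda)=\mathbf s\,QL(\lambda)+(e_{m-i_0(\mathbf w)}\otimes B^TJ^T)(\lambda I_r-A)^{-1}(e_{m-i_0(\mathbf w)}^T\otimes B)$ is Hamiltonian. -/

import Mathlib

open Filter Topology
open scoped Polynomial Matrix

noncomputable section

namespace HamLin

/-! ### Polynomial and rational matrices -/

variable {ι κ σ : Type}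

/-- A constant matrix, regarded as a matrix polynomial. -/
def toPoly (M : Matrix ι κ ℂ) : Matrix ι κ ℂ[X] := M.map Polynomial.C

/-- A matrix polynomial, regarded as a rational matrix. -/
def toRat (M : Matrix ι κ ℂ[X]) : Matrix ι κ (RatFunc ℂ) := M.map (algebraMap ℂ[X] (RatFunc ℂ))

/-- The coefficient matrix of `λ ^ k` in the matrix polynomial `P(λ)`. -/
def coeffMat (P : Matrix ι κ ℂ[X]) (k : ℕ) : Matrix ι κ ℂ := P.map (fun p => p.coeff k)

/-- `P(λ) = ∑_{i ≤ m} λ ^ i A_i` with `A_m ≠ 0`. -/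
def HasDegree (P : Matrix ι κ ℂ[X]) (m : ℕ) : Prop :=
  coeffMat P m ≠ 0 ∧ ∀ k, m < k → coeffMat P k = 0

/-- `P(λ)` is a matrix pencil `X - λ Y`. -/
def IsPencil (P : Matrix ι κ ℂ[X]) : Prop :=
  ∃ M N : Matrix ι κ ℂ, P = toPoly M - (Polynomial.X : ℂ[X]) • toPoly N

/-- `T`-even matrix polynomials: `P(-λ)ᵀ = P(λ)`. -/
def IsTEven (P : Matrix ι ι ℂ[X]) : Prop := (P.map (fun p => p.comp (-Polynomial.X)))ᵀ = P

/-- The substitution `λ ↦ -λ` in the field of rational functions. -/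
def negSubst : RatFunc ℂ →+* RatFunc ℂ :=
  RatFunc.mapRingHom (Polynomial.algEquivAevalNegX : ℂ[X] ≃ₐ[ℂ] ℂ[X])
    (nonZeroDivisors_le_comap_nonZeroDivisors_of_injective _
      (Polynomial.algEquivAevalNegX : ℂ[X] ≃ₐ[ℂ] ℂ[X]).injective)

/-- Hamiltonian rational matrices: `G(-λ)ᵀ = G(λ)`. -/
def IsHamiltonianRat (G : Matrix ι ι (RatFunc ℂ)) : Prop := (G.map negSubst)ᵀ = G

/-- Unimodular matrix polynomials: the determinant is a nonzero constant. -/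
def IsUnimodular [Fintype ι] [DecidableEq ι] (U : Matrix ι ι ℂ[X]) : Prop :=
  ∃ c : ℂ, c ≠ 0 ∧ U.det = Polynomial.C c

/-- Biproper rational matrices: `F(z)` converges to a nonsingular matrix as `z → ∞`. -/
def IsBiproper [Fintype ι] [DecidableEq ι] (F : Matrix ι ι (RatFunc ℂ)) : Prop :=
  ∃ D : Matrix ι ι ℂ, IsUnit D.det ∧
    ∀ i j, Tendsto (fun z : ℂ => (F i j).eval (RingHom.id ℂ) z) (Bornology.cobounded ℂ)
      (𝓝 (D i j))

/-! ### Realizations and system matrices -/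

/-- The data of a realization `G(λ) = P(λ) + C (λ E - A)⁻¹ B` with `E` nonsingular, equivalently
of a system matrix `[P(λ), C; B, A - λ E]`. -/
structure SystemData (ι σ : Type) [Fintype σ] [DecidableEq σ] where
  P : Matrix ι ι ℂ[X]
  C : Matrix ι σ ℂ
  B : Matrix σ ι ℂ
  A : Matrix σ σ ℂ
  E : Matrix σ σ ℂ
  isUnit_det_E : IsUnit E.det

namespace SystemData

variable [Fintype σ] [DecidableEq σ]

/-- The system matrix `[P(λ), C; B, A - λ E]`. -/
def toMatrix (S : SystemData ι σ) : Matrix (ι ⊕ σ) (ι ⊕ σ) ℂ[X] :=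
  Matrix.fromBlocks S.P (toPoly S.C) (toPoly S.B)
    (toPoly S.A - (Polynomial.X : ℂ[X]) • toPoly S.E)

/-- The transfer function `P(λ) + C (λ E - A)⁻¹ B`. -/
def transfer (S : SystemData ι σ) : Matrix ι ι (RatFunc ℂ) :=
  toRat S.P + toRat (toPoly S.C) *
    (toRat ((Polynomial.X : ℂ[X]) • toPoly S.E - toPoly S.A))⁻¹ * toRat (toPoly S.B)

/-- The realization is minimal (the system matrix is irreducible): the size of the pencil
`λ E - A` is the smallest among all realizations of the same rational matrix. -/
def IsMinimal (S : SystemData ι σ) : Prop :=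
  ∀ (r : ℕ) (S' : SystemData ι (Fin r)), S'.transfer = S.transfer → Fintype.card σ ≤ r

end SystemData

/-! ### Block matrices with `m × m` blocks of size `n × n` -/

/-- `diag(I_{(m-1)n}, X)`. -/
def idDiag {R : Type} [Zero R] [One R] (m : ℕ) {n : ℕ} (X : Matrix (Fin n) (Fin n) R) :
    Matrix (Fin m × Fin n) (Fin m × Fin n) R :=
  Matrix.comp _ _ _ _ _ (Matrix.of fun a b : Fin m =>
    if a = b then (if (a : ℕ) + 1 = m then X else 1) else 0)

/-- `e_k ⊗ X`, where `e_k` is the `k`-th column of `I_m` (with `k` counted from `1`). -/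
def colBlock {R : Type} [Zero R] (m : ℕ) {n : ℕ} (k : ℕ) (X : Matrix (Fin n) σ R) :
    Matrix (Fin m × Fin n) σ R :=
  Matrix.of fun a j => if (a.1 : ℕ) + 1 = k then X a.2 j else 0

/-- `e_kᵀ ⊗ X`, where `e_k` is the `k`-th column of `I_m` (with `k` counted from `1`). -/
def rowBlock {R : Type} [Zero R] (m : ℕ) {n : ℕ} (k : ℕ) (X : Matrix σ (Fin n) R) :
    Matrix σ (Fin m × Fin n) R :=
  Matrix.of fun i b => if (b.1 : ℕ) + 1 = k then X i b.2 else 0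

/-! ### Rosenbrock strong linearizations -/

/-- `diag(I_{(m-1)n}, S(λ))`, for the system matrix `S(λ) = [P(λ), C; B, A - λ E]`: the last of
the `m` blocks of size `n`, together with the trailing block, carries `S(λ)`. -/
def paddedSystem [Fintype σ] [DecidableEq σ] (m : ℕ) {n : ℕ} (S : SystemData (Fin n) σ) :
    Matrix ((Fin m × Fin n) ⊕ σ) ((Fin m × Fin n) ⊕ σ) ℂ[X] :=
  Matrix.fromBlocks (idDiag m S.P) (colBlock m m (toPoly S.C)) (rowBlock m m (toPoly S.B))
    (toPoly S.A - (Polynomial.X : ℂ[X]) • toPoly S.E)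

/-- `T` is (the system matrix of) a Rosenbrock strong linearization of the rational matrix
`G(λ)`, the transfer function of `S`, where the polynomial part of `S` has degree `m`. -/
structure IsRosenbrockStrongLinearization [Fintype σ] [DecidableEq σ] {m n : ℕ}
    (S : SystemData (Fin n) σ) (T : SystemData (Fin m × Fin n) σ) : Prop where
  /-- the leading block of `T` is a pencil -/
  isPencil : IsPencil T.P
  /-- `T` is irreducible -/
  isMinimal : T.IsMinimal
  /-- `diag(U(λ), U₀) T(λ) diag(V(λ), V₀) = diag(I, S(λ))` -/
  exists_unimodular : ∃ (U V : Matrix (Fin m × Fin n) (Fin m × Fin n) ℂ[X])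
    (U₀ V₀ : Matrix σ σ ℂ), IsUnimodular U ∧ IsUnimodular V ∧ IsUnit U₀.det ∧ IsUnit V₀.det ∧
      Matrix.fromBlocks U 0 0 (toPoly U₀) * T.toMatrix * Matrix.fromBlocks V 0 0 (toPoly V₀)
        = paddedSystem m S
  /-- `O_l(λ) λ⁻¹ 𝔾(λ) O_r(λ) = diag(I, λ⁻ᵐ G(λ))`, with `𝔾` the transfer function of `T` -/
  exists_biproper : ∃ Ol Or : Matrix (Fin m × Fin n) (Fin m × Fin n) (RatFunc ℂ),
    IsBiproper Ol ∧ IsBiproper Or ∧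
      Ol * ((RatFunc.X : RatFunc ℂ)⁻¹ • T.transfer) * Or
        = idDiag m (((RatFunc.X : RatFunc ℂ) ^ m)⁻¹ • S.transfer)

/-! ### Hamiltonian structure -/

/-- `J = [0, I; -I, 0]`, of size `2ℓ`. -/
def J (ℓ : ℕ) : Matrix (Fin ℓ ⊕ Fin ℓ) (Fin ℓ ⊕ Fin ℓ) ℂ := Matrix.fromBlocks 0 1 (-1) 0

/-- `S` is a Hamiltonian realization of `G(λ)`, of the form `G(λ) = P(λ) + C (λ I - A)⁻¹ B` of
state dimension `r = 2ℓ`: `P(λ)` is `T`-even, `A` is Hamiltonian and `J B = Cᵀ`. -/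
structure IsHamiltonianRealization {ℓ : ℕ} (G : Matrix ι ι (RatFunc ℂ))
    (S : SystemData ι (Fin ℓ ⊕ Fin ℓ)) : Prop where
  transfer_eq : S.transfer = G
  E_eq_one : S.E = 1
  isTEven_P : IsTEven S.P
  hamiltonian_A : (J ℓ * S.A)ᵀ = J ℓ * S.A
  J_mul_B : J ℓ * S.B = S.Cᵀ

/-- `S` is a Hamiltonian system matrix: `E = I` and `diag(I, J) S(λ)` is `T`-even. -/
def IsHamiltonianSystem [Fintype ι] [DecidableEq ι] {ℓ : ℕ}
    (S : SystemData ι (Fin ℓ ⊕ Fin ℓ)) : Prop :=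
  S.E = 1 ∧ IsTEven (Matrix.fromBlocks 1 0 0 (toPoly (J ℓ)) * S.toMatrix)

/-! ### Fiedler matrices -/

/-- The elementary matrices `M_i(X)`, `-m ≤ i ≤ m - 1`, with `m × m` blocks of size `n × n`:
`M_0(X) = diag(I, X)`, `M_{-m}(X) = diag(X, I)` and, for `1 ≤ i ≤ m - 1`, the matrices `M_i(X)`
and `M_{-i}(X)` have the diagonal blocks `[X, I; I, 0]` and `[0, I; I, X]`, respectively, in the
block rows and columns `m - i`, `m - i + 1` (counted from `1`), and agree with the identity
elsewhere. -/
def elemMat (m : ℕ) {n : ℕ} (i : ℤ) (X : Matrix (Fin n) (Fin n) ℂ) :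
    Matrix (Fin m × Fin n) (Fin m × Fin n) ℂ :=
  if i = 0 then idDiag m X
  else Matrix.comp _ _ _ _ _ (Matrix.of fun a b : Fin m =>
    if i = -(m : ℤ) then
      if a = b then (if (a : ℕ) = 0 then X else 1) else 0
    else
      if (a : ℕ) + 1 = m - i.natAbs ∧ (b : ℕ) + 1 = m - i.natAbs then
        (if 0 < i then X else 0)
      else if (a : ℕ) + 1 = m - i.natAbs ∧ (b : ℕ) = m - i.natAbs then 1
      else if (a : ℕ) = m - i.natAbs ∧ (b : ℕ) + 1 = m - i.natAbs then 1
      else if (a : ℕ) = m - i.natAbs ∧ (b : ℕ) = m - i.natAbs then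
        (if 0 < i then 0 else X)
      else if a = b then 1 else 0)

/-- The Fiedler matrices of `P(λ) = ∑ λ ^ i A_i`: `M_i^P = M_i(-A_i)` for `i ≥ 0` and
`M_i^P = M_i(A_{-i})` for `i < 0`. -/
def fiedlerMat (m : ℕ) {n : ℕ} (P : Matrix (Fin n) (Fin n) ℂ[X]) (i : ℤ) :
    Matrix (Fin m × Fin n) (Fin m × Fin n) ℂ :=
  if 0 ≤ i then elemMat m i (-coeffMat P i.natAbs) else elemMat m i (coeffMat P i.natAbs)

/-- `M_t^P = M_{t_1}^P ⋯ M_{t_k}^P` for an index tuple `t = (t_1, …, t_k)`. -/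
def fiedlerProd (m : ℕ) {n : ℕ} (P : Matrix (Fin n) (Fin n) ℂ[X]) (t : List ℤ) :
    Matrix (Fin m × Fin n) (Fin m × Fin n) ℂ :=
  (t.map (fiedlerMat m P)).prod

/-! ### Index tuples -/

/-- The number of consecutive inversions of the index tuple `t` at `i`: the largest `s` for which
`(i + s, …, i + 1, i)` is a subtuple of `t`, and `-1` if `i` does not occur in `t`. -/
def consecInv (i : ℤ) (t : List ℤ) : ℤ :=
  if i ∈ t then
    (Nat.findGreatest (fun s : ℕ =>
      ((List.range (s + 1)).reverse.map (fun k : ℕ => i + (k : ℤ))).Sublist t) t.length : ℕ)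
  else -1

/-- The admissible tuple `(h-1:h, h-3:h-2, …, p+1:p+2, 0:p)` of `{0:h}` of index `p`, where
`p ≤ h` and `h - p` is even. -/
def admissibleTuple (h p : ℕ) : List ℤ :=
  (List.range ((h - p) / 2)).reverse.flatMap
      (fun j : ℕ => [(p : ℤ) + 2 * j + 1, (p : ℤ) + 2 * j + 2])
    ++ (List.range (p + 1)).map (fun k : ℕ => (k : ℤ))

/-- The symmetric complement `(h-1, h-3, …, p+1, 0:p-1, 0:p-2, …, 0:1, 0)` of the admissible tuple
of `{0:h}` of index `p`. -/
def symmComplement (h p : ℕ) : List ℤ :=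
  (List.range ((h - p) / 2)).reverse.map (fun j : ℕ => (p : ℤ) + 2 * j + 1)
    ++ (List.range p).reverse.flatMap
      (fun q : ℕ => (List.range (q + 1)).map (fun k : ℕ => (k : ℤ)))

/-- The simple admissible tuple `w` of `{0:h}`: its index is `0` if `h` is even and `1` if `h` is
odd. -/
def tupleW (h : ℕ) : List ℤ := admissibleTuple h (h % 2)

/-- The symmetric complement `c_w` of the simple admissible tuple `w` of `{0:h}`. -/
def tupleCW (h : ℕ) : List ℤ := symmComplement h (h % 2)

/-- The tuple `z` such that `z + m` is the admissible tuple of `{0:m-h-1}` of index `p`. -/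
def tupleZ (m h p : ℕ) : List ℤ := (admissibleTuple (m - h - 1) p).map (fun i => i - (m : ℤ))

/-- The tuple `c_z` such that `c_z + m` is the symmetric complement of `z + m`. -/
def tupleCZ (m h p : ℕ) : List ℤ := (symmComplement (m - h - 1) p).map (fun i => i - (m : ℤ))

/-! ### The pencils -/

/-- `L(λ) = (λ M_z^P - M_w^P) M_{c_w}^P M_{c_z}^P`. -/
def pencilL (m h p : ℕ) {n : ℕ} (P : Matrix (Fin n) (Fin n) ℂ[X]) :
    Matrix (Fin m × Fin n) (Fin m × Fin n) ℂ[X] :=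
  ((Polynomial.X : ℂ[X]) • toPoly (fiedlerProd m P (tupleZ m h p))
      - toPoly (fiedlerProd m P (tupleW h)))
    * toPoly (fiedlerProd m P (tupleCW h)) * toPoly (fiedlerProd m P (tupleCZ m h p))

/-- The quasi-identity matrix `ε_1 I_n ⊕ ⋯ ⊕ ε_m I_n`, `ε_i = ± 1`. -/
def quasiIdentity {m : ℕ} (n : ℕ) (ε : Fin m → ℤˣ) :
    Matrix (Fin m × Fin n) (Fin m × Fin n) ℂ :=
  Matrix.diagonal fun a => (((ε a.1 : ℤˣ) : ℤ) : ℂ)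

/-- The `k`-th parameter of a quasi-identity matrix, `1 ≤ k ≤ m` (with `k` counted from `1`;
the value outside of this range is immaterial). -/
def parameter {m : ℕ} (ε : Fin m → ℤˣ) (k : ℕ) : ℂ :=
  if hk : k - 1 < m then (((ε ⟨k - 1, hk⟩ : ℤˣ) : ℤ) : ℂ) else 1

/-- The position `m - i_0(w)`, counted from `1`. -/
def position (m h : ℕ) : ℕ := ((m : ℤ) - consecInv 0 (tupleW h)).toNat

/-- `s Q L(λ)`, where `s` is the `(m - i_0(w))`-th parameter of `Q`. -/
def signedPencil (m h p : ℕ) {n : ℕ} (ε : Fin m → ℤˣ) (P : Matrix (Fin n) (Fin n) ℂ[X]) :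
    Matrix (Fin m × Fin n) (Fin m × Fin n) ℂ[X] :=
  toPoly (parameter ε (position m h) • quasiIdentity n ε) * pencilL m h p P

/-- The bordered pencil
`𝕋(λ) = [s Q L(λ), e_{m - i_0(w)} ⊗ Bᵀ Jᵀ; e_{m - i_0(w)}ᵀ ⊗ B, A - λ I]`. -/
def borderedPencil (m h p : ℕ) {n ℓ : ℕ} (ε : Fin m → ℤˣ)
    (S : SystemData (Fin n) (Fin ℓ ⊕ Fin ℓ)) :
    SystemData (Fin m × Fin n) (Fin ℓ ⊕ Fin ℓ) where
  P := signedPencil m h p ε S.P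
  C := colBlock m (position m h) (S.Bᵀ * (J ℓ)ᵀ)
  B := rowBlock m (position m h) S.B
  A := S.A
  E := 1
  isUnit_det_E := by simp

end HamLin

end

noncomputable section

namespace HamLin

/-! The key computation is carried out for pencils of block matrices over an arbitrary ring of
blocks. As `M_i(X)` and `M_{-i}(-X)` are inverse to each other for `0 < i < m`, all factors of
`L(λ)` but `M_0` can be moved to the leading coefficient, up to equivalence, where each of
`M_{-1}, …, M_{-m}` then occurs once. The factor `M_{-m}` commutes with all of them but
`M_{-(m-1)}`, next to which it can be moved; eliminating a corner block then drops `A_m` and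
replaces `A_{m-1}` by `A_{m-1} + λ A_m`. Iterating this Horner step reduces `L(λ)` to
`diag(I, P(λ))`. The equivalence maps the basis vector that carries the border of `𝕋(λ)` to the last
one, so it reduces `𝕋(λ)` to `diag(I, S(λ))` as well.

At infinity, the same computation applies over the ring of proper rational functions, with `λ⁻¹` in
place of `λ`, because reversing the order of the blocks exchanges the roles of `M_i` and `M_{i-m}`.
The transfer function of `𝕋(λ)` is `s Q L(λ)` with the strictly proper part of `G(λ)` added to the
coefficient `A_0`, so the outcome is a biproper equivalence with `diag(I, λ⁻ᵐ G(λ))`.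

The tuples `(w, c_w)` and `(z, c_z)` are palindromic up to commuting factors. Hence `Q L(λ)` is
`T`-even as soon as the signs of `Q` intertwine the Fiedler products of the coefficients `A_i` with
those of `(-1)^i A_i`. Each factor imposes a condition on at most two consecutive signs, and these
conditions can be solved one after the other. Conversely, the ratio of two solutions is constant on
the connected components of the graph of the nonzero blocks of `L(λ)`, and this graph is
connected. -/

/-! ### Equivalence of block matrices -/

section Equivalence

variable {S : Type*} [Ring S] {m : ℕ}

/-- Equivalence `U M V = N` of matrices, by invertible transformations `U` and `V`. -/
def IsEquivalent (M N : Matrix (Fin m) (Fin m) S) : Prop :=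
  ∃ U V : Matrix (Fin m) (Fin m) S, IsUnit U ∧ IsUnit V ∧ U * M * V = N

/-- The `a`-th vector of the standard basis, counted from `0`; it is indexed by a natural number
because the positions that occur below are arithmetic expressions, and it vanishes for `m ≤ a`. -/
def basisVec (m : ℕ) (S : Type*) [Ring S] (a : ℕ) : Fin m → S :=
  fun i => if (i : ℕ) = a then 1 else 0

/-- Equivalence `U M V = N` of matrices, by invertible transformations with `U e_a = e_b` and
`e_aᵀ V = e_bᵀ`. Such an equivalence extends to the system matrix obtained by bordering `M` in the
`a`-th block row and column, which it turns into one bordered in position `b`. -/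
def IsPointedEquivalent (a b : ℕ) (M N : Matrix (Fin m) (Fin m) S) : Prop :=
  ∃ U V : Matrix (Fin m) (Fin m) S, IsUnit U ∧ IsUnit V ∧
    U *ᵥ basisVec m S a = basisVec m S b ∧ basisVec m S a ᵥ* V = basisVec m S b ∧ U * M * V = N

theorem isEquivalent_of_mul_mul {U V M : Matrix (Fin m) (Fin m) S} (hU : IsUnit U)
    (hV : IsUnit V) : IsEquivalent (U * M * V) M := by
  lift U to (Matrix (Fin m) (Fin m) S)ˣ using hU
  lift V to (Matrix (Fin m) (Fin m) S)ˣ using hV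
  exact ⟨↑U⁻¹, ↑V⁻¹, U⁻¹.isUnit, V⁻¹.isUnit, by simp [mul_assoc]⟩

theorem IsEquivalent.trans {M N K : Matrix (Fin m) (Fin m) S} (h : IsEquivalent M N)
    (h' : IsEquivalent N K) : IsEquivalent M K := by
  obtain ⟨U, V, hU, hV, rfl⟩ := h
  obtain ⟨U', V', hU', hV', rfl⟩ := h'
  exact ⟨U' * U, V * V', hU'.mul hU, hV.mul hV', by simp only [mul_assoc]⟩

theorem isPointedEquivalent_of_mul_mul {U V M : Matrix (Fin m) (Fin m) S} {a b : ℕ}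
    (hU : IsUnit U) (hV : IsUnit V) (hUb : U *ᵥ basisVec m S b = basisVec m S a)
    (hVb : basisVec m S b ᵥ* V = basisVec m S a) : IsPointedEquivalent a b (U * M * V) M := by
  lift U to (Matrix (Fin m) (Fin m) S)ˣ using hU
  lift V to (Matrix (Fin m) (Fin m) S)ˣ using hV
  exact ⟨↑U⁻¹, ↑V⁻¹, U⁻¹.isUnit, V⁻¹.isUnit, by rw [← hUb]; simp, by rw [← hVb]; simp,
    by simp [mul_assoc]⟩

theorem IsPointedEquivalent.refl (a : ℕ) (M : Matrix (Fin m) (Fin m) S) :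
    IsPointedEquivalent a a M M :=
  ⟨1, 1, isUnit_one, isUnit_one, Matrix.one_mulVec _, Matrix.vecMul_one _, by simp⟩

theorem IsPointedEquivalent.trans {a b c : ℕ} {M N K : Matrix (Fin m) (Fin m) S}
    (h : IsPointedEquivalent a b M N) (h' : IsPointedEquivalent b c N K) :
    IsPointedEquivalent a c M K := by
  obtain ⟨U, V, hU, hV, hUa, hVa, rfl⟩ := h
  obtain ⟨U', V', hU', hV', hUb, hVb, rfl⟩ := h'
  exact ⟨U' * U, V * V', hU'.mul hU, hV.mul hV', by rw [← Matrix.mulVec_mulVec, hUa, hUb],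
    by rw [← Matrix.vecMul_vecMul, hVa, hVb], by simp only [mul_assoc]⟩

theorem IsPointedEquivalent.isEquivalent {a b : ℕ} {M N : Matrix (Fin m) (Fin m) S}
    (h : IsPointedEquivalent a b M N) : IsEquivalent M N := by
  obtain ⟨U, V, hU, hV, -, -, h⟩ := h
  exact ⟨U, V, hU, hV, h⟩

theorem basisVec_vecMul {M : Matrix (Fin m) (Fin m) S} {a : ℕ} (ha : a < m) :
    basisVec m S a ᵥ* M = M ⟨a, ha⟩ := by
  have h : basisVec m S a = Pi.single ⟨a, ha⟩ 1 := by
    ext i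
    simp [basisVec, Pi.single_apply, Fin.ext_iff]
  rw [h, Matrix.single_one_vecMul]
  rfl

theorem mulVec_basisVec {M : Matrix (Fin m) (Fin m) S} {a : ℕ} (ha : a < m) :
    M *ᵥ basisVec m S a = fun i => M i ⟨a, ha⟩ := by
  have h : basisVec m S a = Pi.single ⟨a, ha⟩ 1 := by
    ext i
    simp [basisVec, Pi.single_apply, Fin.ext_iff]
  rw [h, Matrix.mulVec_single_one]
  rfl

end Equivalence

/-! ### Elementary block matrices over an arbitrary ring -/

section BlockElem

/-- The block pattern of `elemMat`, over an arbitrary ring of blocks. -/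
def blockElem {S : Type*} [Zero S] [One S] (m : ℕ) (i : ℤ) (X : S) : Matrix (Fin m) (Fin m) S :=
  if i = 0 then Matrix.of fun a b : Fin m =>
    if a = b then (if (a : ℕ) + 1 = m then X else 1) else 0
  else Matrix.of fun a b : Fin m =>
    if i = -(m : ℤ) then
      if a = b then (if (a : ℕ) = 0 then X else 1) else 0
    else
      if (a : ℕ) + 1 = m - i.natAbs ∧ (b : ℕ) + 1 = m - i.natAbs then
        (if 0 < i then X else 0)
      else if (a : ℕ) + 1 = m - i.natAbs ∧ (b : ℕ) = m - i.natAbs then 1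
      else if (a : ℕ) = m - i.natAbs ∧ (b : ℕ) + 1 = m - i.natAbs then 1
      else if (a : ℕ) = m - i.natAbs ∧ (b : ℕ) = m - i.natAbs then
        (if 0 < i then 0 else X)
      else if a = b then 1 else 0

theorem elemMat_eq_comp (m : ℕ) {n : ℕ} (i : ℤ) (X : Matrix (Fin n) (Fin n) ℂ) :
    elemMat m i X = Matrix.comp _ _ _ _ _ (blockElem m i X) := by
  unfold elemMat blockElem idDiag
  split_ifs <;> rfl

theorem blockElem_map {S S' : Type*} [Semiring S] [Semiring S'] (f : S →+* S') (m : ℕ) (i : ℤ)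
    (X : S) : (blockElem m i X).map f = blockElem m i (f X) := by
  unfold blockElem
  ext a b
  split_ifs <;> simp only [Matrix.map_apply, Matrix.of_apply] <;> split_ifs <;> simp

variable {S : Type*} [Zero S] [One S] {m : ℕ}

theorem blockElem_zero_apply (X : S) (a b : Fin m) :
    blockElem m 0 X a b = if a = b then (if (a : ℕ) + 1 = m then X else 1) else 0 := by
  simp [blockElem]

theorem blockElem_top_apply (hm : 0 < m) (X : S) (a b : Fin m) :
    blockElem m (-(m : ℤ)) X a b = if a = b then (if (a : ℕ) = 0 then X else 1) else 0 := by
  rw [blockElem, if_neg (by omega)]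
  simp

theorem blockElem_neg_apply {i : ℕ} (hi : 0 < i) (him : i < m) (X : S) (a b : Fin m) :
    blockElem m (-(i : ℤ)) X a b =
      if (a : ℕ) + 1 = m - i ∧ (b : ℕ) + 1 = m - i then 0
      else if (a : ℕ) + 1 = m - i ∧ (b : ℕ) = m - i then 1
      else if (a : ℕ) = m - i ∧ (b : ℕ) + 1 = m - i then 1
      else if (a : ℕ) = m - i ∧ (b : ℕ) = m - i then X
      else if a = b then 1 else 0 := by
  have hne : -(i : ℤ) ≠ -(m : ℤ) := by omega
  have hneg : ¬ 0 < -(i : ℤ) := by omega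
  rw [blockElem, if_neg (by omega), Matrix.of_apply, if_neg hne, if_neg hneg, if_neg hneg,
    Int.natAbs_neg, Int.natAbs_natCast]

theorem blockElem_pos_apply {i : ℕ} (hi : 0 < i) (X : S) (a b : Fin m) :
    blockElem m (i : ℤ) X a b =
      if (a : ℕ) + 1 = m - i ∧ (b : ℕ) + 1 = m - i then X
      else if (a : ℕ) + 1 = m - i ∧ (b : ℕ) = m - i then 1
      else if (a : ℕ) = m - i ∧ (b : ℕ) + 1 = m - i then 1
      else if (a : ℕ) = m - i ∧ (b : ℕ) = m - i then 0
      else if a = b then 1 else 0 := by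
  have hne : (i : ℤ) ≠ -(m : ℤ) := by omega
  have hpos : 0 < (i : ℤ) := by omega
  rw [blockElem, if_neg (by omega), Matrix.of_apply, if_neg hne, if_pos hpos, if_pos hpos,
    Int.natAbs_natCast]

theorem blockElem_one_zero (X : S) : blockElem 1 0 X = Matrix.of fun _ _ => X := by
  ext a b
  simp [blockElem, Subsingleton.elim a b]

theorem blockElem_one_top (X : S) : blockElem 1 (-1) X = Matrix.of fun _ _ => X := by
  ext a b
  simp [blockElem, Subsingleton.elim a b]

end BlockElem

section Border

variable {S : Type*} {m : ℕ}

/-- The bordered matrix `[a, r; c, D]`. -/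
def border (a : S) (r c : Fin m → S) (D : Matrix (Fin m) (Fin m) S) :
    Matrix (Fin (m + 1)) (Fin (m + 1)) S :=
  Matrix.of (Fin.cons (Fin.cons a r) fun i => Fin.cons (c i) (D i))

section Entries

variable (a : S) (r c : Fin m → S) (D : Matrix (Fin m) (Fin m) S) (i j : Fin m)

@[simp] theorem border_zero_zero : border a r c D 0 0 = a := rfl

@[simp] theorem border_zero_succ : border a r c D 0 j.succ = r j := rfl

@[simp] theorem border_succ_zero : border a r c D i.succ 0 = c i := rfl

@[simp] theorem border_succ_succ : border a r c D i.succ j.succ = D i j := rfl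

end Entries

theorem border_ext {M N : Matrix (Fin (m + 1)) (Fin (m + 1)) S} (h₀ : M 0 0 = N 0 0)
    (hrow : ∀ j : Fin m, M 0 j.succ = N 0 j.succ) (hcol : ∀ i : Fin m, M i.succ 0 = N i.succ 0)
    (h : ∀ i j : Fin m, M i.succ j.succ = N i.succ j.succ) : M = N := by
  ext i j
  exact Fin.cases (Fin.cases h₀ hrow j) (fun i => Fin.cases (hcol i) (h i) j) i

variable [Ring S]

theorem border_mul (a a' : S) (r c r' c' : Fin m → S) (D D' : Matrix (Fin m) (Fin m) S) :
    border a r c D * border a' r' c' D'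
      = border (a * a' + r ⬝ᵥ c') (fun j => a * r' j + (r ᵥ* D') j)
          (fun i => c i * a' + (D *ᵥ c') i) (Matrix.vecMulVec c r' + D * D') := by
  refine border_ext ?_ ?_ ?_ ?_ <;> intros <;>
    simp [Matrix.mul_apply, Fin.sum_univ_succ, dotProduct, Matrix.vecMul, Matrix.mulVec,
      Matrix.vecMulVec_apply]

theorem border_one : border (1 : S) 0 0 (1 : Matrix (Fin m) (Fin m) S) = 1 := by
  refine border_ext ?_ ?_ ?_ ?_ <;> intros <;> simp [Matrix.one_apply, Fin.ext_iff]

/-- The embedding `D ↦ diag(1, D)`. -/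
def borderHom : Matrix (Fin m) (Fin m) S →* Matrix (Fin (m + 1)) (Fin (m + 1)) S where
  toFun D := border 1 0 0 D
  map_one' := border_one
  map_mul' D D' := by
    rw [border_mul]
    refine border_ext ?_ ?_ ?_ ?_ <;> intros <;> simp

theorem borderHom_apply (D : Matrix (Fin m) (Fin m) S) : borderHom D = border 1 0 0 D := rfl

theorem border_mulVec_basisVec_succ (a b : ℕ) (x : S) (c : Fin m → S)
    {D : Matrix (Fin m) (Fin m) S} (h : D *ᵥ basisVec m S a = basisVec m S b) :
    border x 0 c D *ᵥ basisVec (m + 1) S (a + 1) = basisVec (m + 1) S (b + 1) := by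
  ext i
  refine Fin.cases ?_ (fun i => ?_) i
  · simp [Matrix.mulVec, dotProduct, Fin.sum_univ_succ, basisVec]
  · simpa [Matrix.mulVec, dotProduct, Fin.sum_univ_succ, basisVec] using congrFun h i

theorem basisVec_succ_vecMul_border (a b : ℕ) (x : S) (r : Fin m → S)
    {D : Matrix (Fin m) (Fin m) S} (h : basisVec m S a ᵥ* D = basisVec m S b) :
    basisVec (m + 1) S (a + 1) ᵥ* border x r 0 D = basisVec (m + 1) S (b + 1) := by
  ext j
  refine Fin.cases ?_ (fun j => ?_) j
  · simp [Matrix.vecMul, dotProduct, Fin.sum_univ_succ, basisVec]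
  · simpa [Matrix.vecMul, dotProduct, Fin.sum_univ_succ, basisVec] using congrFun h j

theorem IsPointedEquivalent.map_borderHom {a b : ℕ} {M N : Matrix (Fin m) (Fin m) S}
    (h : IsPointedEquivalent a b M N) :
    IsPointedEquivalent (a + 1) (b + 1) (borderHom M) (borderHom N) := by
  obtain ⟨U, V, hU, hV, hUa, hVa, rfl⟩ := h
  exact ⟨borderHom U, borderHom V, hU.map _, hV.map _,
    border_mulVec_basisVec_succ a b _ _ hUa, basisVec_succ_vecMul_border a b _ _ hVa,
    by rw [map_mul, map_mul]⟩

theorem isUnit_border_lower (c : Fin m → S) : IsUnit (border (-1) 0 c 1) := by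
  have h : border (-1) 0 c 1 * border (-1) 0 c 1 = 1 := by
    rw [border_mul, ← border_one]
    refine border_ext ?_ ?_ ?_ ?_ <;> intros <;> simp
  exact ⟨⟨_, _, h, h⟩, rfl⟩

theorem isUnit_border_upper (r : Fin m → S) : IsUnit (border 1 r 0 1) := by
  have h : ∀ r : Fin m → S, border 1 r 0 1 * border 1 (-r) 0 1 = 1 := fun r => by
    rw [border_mul, ← border_one]
    refine border_ext ?_ ?_ ?_ ?_ <;> intros <;> simp
  exact ⟨⟨_, _, h r, by simpa using h (-r)⟩, rfl⟩

theorem border_isPointedEquivalent_schurComplement (a : ℕ) (r c : Fin m → S)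
    (D : Matrix (Fin m) (Fin m) S) :
    IsPointedEquivalent (a + 1) (a + 1) (border (-1) r c D)
      (borderHom (D + Matrix.vecMulVec c r)) := by
  refine ⟨border (-1) 0 c 1, border 1 r 0 1, isUnit_border_lower c, isUnit_border_upper r,
    border_mulVec_basisVec_succ a a _ _ (Matrix.one_mulVec _),
    basisVec_succ_vecMul_border a a _ _ (Matrix.vecMul_one _), ?_⟩
  rw [border_mul, border_mul, borderHom_apply]
  refine border_ext ?_ ?_ ?_ ?_ <;> intros <;> simp [Matrix.vecMulVec_apply, add_comm]

theorem blockElem_top_eq_border (X : S) :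
    blockElem (m + 1) (-((m + 1 : ℕ) : ℤ)) X = border X 0 0 1 := by
  refine border_ext ?_ ?_ ?_ ?_ <;> intros <;> rw [blockElem_top_apply (by omega)] <;>
    simp [Matrix.one_apply, eq_comm]

theorem blockElem_top_add (X Y : S) :
    blockElem (m + 1) (-((m + 1 : ℕ) : ℤ)) (X + Y)
      = blockElem (m + 1) (-((m + 1 : ℕ) : ℤ)) X + Matrix.single 0 0 Y := by
  rw [blockElem_top_eq_border, blockElem_top_eq_border]
  refine border_ext ?_ ?_ ?_ ?_ <;> intros <;> simp [(Fin.succ_ne_zero _).symm]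

theorem blockElem_second_eq_border (m : ℕ) (X : S) :
    blockElem (m + 2) (-((m + 1 : ℕ) : ℤ)) X
      = border 0 (Pi.single 0 1) (Pi.single 0 1) (blockElem (m + 1) (-((m + 1 : ℕ) : ℤ)) X) := by
  refine border_ext ?_ ?_ ?_ fun i j => ?_ <;> intros <;>
    rw [blockElem_neg_apply (by omega) (by omega)]
  · simp
  · simp [Pi.single_apply, -Fin.val_eq_zero_iff, Fin.ext_iff]
  · simp [Pi.single_apply, -Fin.val_eq_zero_iff, Fin.ext_iff]
  · have h : m + 2 - (m + 1) = 1 := by omega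
    rw [border_succ_succ, blockElem_top_apply (by omega)]
    simp only [h, Fin.val_succ, Fin.ext_iff]
    split_ifs <;> first | rfl | omega

theorem blockElem_eq_borderHom {m i : ℕ} (hi : i ≤ m) (X : S) :
    blockElem (m + 2) (-(i : ℤ)) X = borderHom (blockElem (m + 1) (-(i : ℤ)) X) := by
  rw [borderHom_apply]
  rcases Nat.eq_zero_or_pos i with rfl | hi0
  · simp only [Nat.cast_zero, neg_zero]
    refine border_ext ?_ ?_ ?_ ?_ <;> intros <;> rw [blockElem_zero_apply] <;>
      simp [blockElem_zero_apply, eq_comm]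
  · have hsub : m + 2 - i = m - i + 2 := by omega
    have hsub' : m + 1 - i = m - i + 1 := by omega
    refine border_ext ?_ ?_ ?_ ?_ <;> intros <;> rw [blockElem_neg_apply (by omega) (by omega)]
    · simp [hsub]
    · simp [hsub, eq_comm]
    · simp [hsub, eq_comm]
    · rw [border_succ_succ, blockElem_neg_apply (by omega) (by omega)]
      simp [hsub, hsub']

theorem commute_blockElem_top {i : ℕ} (hi : i ≤ m) (X Y : S) :
    Commute (blockElem (m + 2) (-((m + 2 : ℕ) : ℤ)) X) (blockElem (m + 2) (-(i : ℤ)) Y) := by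
  rw [blockElem_top_eq_border, blockElem_eq_borderHom hi, borderHom_apply, Commute, SemiconjBy,
    border_mul, border_mul]
  refine border_ext ?_ ?_ ?_ ?_ <;> intros <;> simp

theorem prod_map_blockElem_eq_borderHom (A : ℕ → S) {t : List ℕ} (ht : ∀ i ∈ t, i ≤ m) :
    (t.map fun i : ℕ => blockElem (m + 2) (-(i : ℤ)) (A i)).prod
      = borderHom (t.map fun i : ℕ => blockElem (m + 1) (-(i : ℤ)) (A i)).prod := by
  rw [map_list_prod, List.map_map]
  exact congrArg List.prod (List.map_congr_left fun i hi => blockElem_eq_borderHom (ht i hi) (A i))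

end Border

/-! ### Reduction of Fiedler pencils -/

section ListProducts

variable {M ι : Type*} [Monoid M] (g : ι → M)

theorem commute_prod_map {x : M} {t : List ι} (h : ∀ i ∈ t, Commute x (g i)) :
    Commute x (t.map g).prod :=
  Commute.list_prod_right _ _ (by simpa using h)

theorem prod_map_append_cons_of_commute_left {c : ι} (a b : List ι)
    (h : ∀ i ∈ a, Commute (g c) (g i)) :
    ((a ++ c :: b).map g).prod = g c * ((a ++ b).map g).prod := by
  simp only [List.map_append, List.map_cons, List.prod_append, List.prod_cons, ← mul_assoc,
    (commute_prod_map g h).eq]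

theorem prod_map_append_cons_of_commute_right {c : ι} (a b : List ι)
    (h : ∀ i ∈ b, Commute (g c) (g i)) :
    ((a ++ c :: b).map g).prod = ((a ++ b).map g).prod * g c := by
  simp only [List.map_append, List.map_cons, List.prod_append, List.prod_cons, mul_assoc,
    (commute_prod_map g h).eq]

theorem exists_prod_map_eq_of_forall_commute [DecidableEq ι] {c d : ι} {t : List ι}
    (ht : t.Nodup) (hc : c ∈ t) (hd : d ∈ t) (hcd : c ≠ d)
    (h : ∀ i ∈ t, i ≠ d → Commute (g c) (g i)) :
    ∃ a b : List ι, (a ++ d :: b).Perm (t.erase c) ∧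
      ((t.map g).prod = (a.map g).prod * (g c * g d) * (b.map g).prod ∨
        (t.map g).prod = (a.map g).prod * (g d * g c) * (b.map g).prod) := by
  obtain ⟨u, v, rfl⟩ := List.append_of_mem hd
  obtain ⟨hdu, hdv⟩ : d ∉ u ∧ d ∉ v := by
    simpa using (List.nodup_cons.1 (List.nodup_middle.1 ht)).1
  have hcuv : c ∈ u ∨ c ∈ v := by simpa [hcd] using hc
  rcases hcuv with hc | hc <;> obtain ⟨a, b, rfl⟩ := List.append_of_mem hc
  · have hperm : (a ++ c :: b ++ d :: v).Perm (c :: (a ++ b ++ d :: v)) := by simp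
    refine ⟨a ++ b, v, by simpa using (hperm.erase c).symm, Or.inl ?_⟩
    rw [List.map_append, List.prod_append, List.map_cons, List.prod_cons,
      prod_map_append_cons_of_commute_right g a b fun i hi =>
        h i (by simp [hi]) fun hid => hdu (by simp [← hid, hi])]
    simp only [mul_assoc]
  · have hperm : (u ++ d :: (a ++ c :: b)).Perm (c :: (u ++ d :: (a ++ b))) := by
      rw [List.perm_iff_count]
      intro i
      simp only [List.count_append, List.count_cons]
      omega
    refine ⟨u, a ++ b, by simpa using (hperm.erase c).symm, Or.inr ?_⟩
    rw [List.map_append, List.prod_append, List.map_cons, List.prod_cons,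
      prod_map_append_cons_of_commute_left g a b fun i hi =>
        h i (by simp [hi]) fun hid => hdv (by simp [← hid, hi])]
    simp only [mul_assoc]

end ListProducts

section Reduction

variable {S R : Type*} [Ring S] [CommRing R] [Algebra R S] {m : ℕ} (x : R)

theorem isPointedEquivalent_borderHom_of_corner (a : ℕ) (u v : S)
    (T Z₁ Z₂ W : Matrix (Fin (m + 1)) (Fin (m + 1)) S) :
    IsPointedEquivalent (a + 1) (a + 1)
      (x • (borderHom Z₁ * border 0 (Pi.single 0 u) (Pi.single 0 v) T * borderHom Z₂)
        - borderHom W)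
      (borderHom (x • (Z₁ * (T + Matrix.single 0 0 (x • (v * u))) * Z₂) - W)) := by
  have hpencil :
      x • (borderHom Z₁ * border 0 (Pi.single 0 u) (Pi.single 0 v) T * borderHom Z₂) - borderHom W
        = border (-1) (fun j => x • (u * Z₂ 0 j)) (fun i => x • (Z₁ i 0 * v))
            (x • (Z₁ * T * Z₂) - W) := by
    simp only [borderHom_apply, border_mul]
    refine border_ext ?_ ?_ ?_ ?_ <;> intros <;>
      simp [Matrix.vecMul, Matrix.mulVec, dotProduct, Pi.single_apply]
  have hschur : Matrix.vecMulVec (fun i => x • (Z₁ i 0 * v)) (fun j => x • (u * Z₂ 0 j))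
      = x • (Z₁ * Matrix.single 0 0 (x • (v * u)) * Z₂) := by
    ext i j
    simp [Matrix.vecMulVec_apply, Matrix.mul_apply, Matrix.single_apply, ite_and, mul_assoc]
  have hsum : x • (Z₁ * (T + Matrix.single 0 0 (x • (v * u))) * Z₂) - W
      = x • (Z₁ * T * Z₂) - W + x • (Z₁ * Matrix.single 0 0 (x • (v * u)) * Z₂) := by
    rw [mul_add, add_mul, smul_add]
    abel
  rw [hpencil, hsum, ← hschur]
  exact border_isPointedEquivalent_schurComplement a _ _ _

/-- One step of Horner's scheme: the coefficients `A_0, …, A_m, A_{m+1} + x A_{m+2}`. -/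
def hornerStep (m : ℕ) (A : ℕ → S) : ℕ → S :=
  Function.update A (m + 1) (A (m + 1) + x • A (m + 2))

theorem hornerStep_self (A : ℕ → S) : hornerStep x m A (m + 1) = A (m + 1) + x • A (m + 2) :=
  Function.update_self ..

theorem hornerStep_of_le {i : ℕ} (hi : i ≤ m) (A : ℕ → S) : hornerStep x m A i = A i :=
  Function.update_of_ne (by omega) ..

theorem sum_hornerStep (A : ℕ → S) :
    ∑ i ∈ Finset.range (m + 2), x ^ i • hornerStep x m A i
      = ∑ i ∈ Finset.range (m + 3), x ^ i • A i := by
  rw [Finset.sum_range_succ (n := m + 2), Finset.sum_range_succ (n := m + 1),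
    Finset.sum_range_succ (n := m + 1), hornerStep_self, smul_add, smul_smul, ← pow_succ,
    ← add_assoc]
  congr 2
  exact Finset.sum_congr rfl fun i hi => by
    rw [hornerStep_of_le x (Nat.lt_succ_iff.1 (Finset.mem_range.1 hi))]

theorem isPointedEquivalent_fiedler_hornerStep {A : ℕ → S} {a b t : List ℕ}
    (W : Matrix (Fin (m + 1)) (Fin (m + 1)) S) (ha : ∀ i ∈ a, i ≤ m) (hb : ∀ i ∈ b, i ≤ m)
    (hprod : let g := fun i : ℕ => blockElem (m + 2) (-(i : ℤ)) (A i)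
      (t.map g).prod = (a.map g).prod * (g (m + 2) * g (m + 1)) * (b.map g).prod ∨
        (t.map g).prod = (a.map g).prod * (g (m + 1) * g (m + 2)) * (b.map g).prod) :
    IsPointedEquivalent (m + 1) (m + 1)
      (x • (t.map fun i : ℕ => blockElem (m + 2) (-(i : ℤ)) (A i)).prod - borderHom W)
      (borderHom (x • ((a ++ (m + 1) :: b).map fun i : ℕ => blockElem (m + 1) (-(i : ℤ))
          (hornerStep x m A i)).prod - W)) := by
  have hlow : ∀ l : List ℕ, (∀ i ∈ l, i ≤ m) →
      l.map (fun i : ℕ => blockElem (m + 1) (-(i : ℤ)) (hornerStep x m A i))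
        = l.map fun i : ℕ => blockElem (m + 1) (-(i : ℤ)) (A i) := fun l hl =>
    List.map_congr_left fun i hi => by rw [hornerStep_of_le x (hl i hi)]
  rw [List.map_append, List.map_cons, hlow a ha, hlow b hb, hornerStep_self, blockElem_top_add,
    List.prod_append, List.prod_cons, ← mul_assoc]
  dsimp only at hprod
  rw [prod_map_blockElem_eq_borderHom A ha, prod_map_blockElem_eq_borderHom A hb,
    blockElem_top_eq_border, blockElem_second_eq_border] at hprod
  set T := blockElem (m + 1) (-((m + 1 : ℕ) : ℤ)) (A (m + 1))
  have htop_mul : border (A (m + 2)) 0 0 (1 : Matrix (Fin (m + 1)) (Fin (m + 1)) S) *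
      border 0 (Pi.single 0 1) (Pi.single 0 1) T
        = border 0 (Pi.single 0 (A (m + 2))) (Pi.single 0 1) T := by
    rw [border_mul]
    refine border_ext ?_ ?_ ?_ ?_ <;> intros <;> simp [Pi.single_apply, Matrix.one_apply]
  have hmul_top : border 0 (Pi.single 0 1) (Pi.single 0 1) T *
      border (A (m + 2)) 0 0 (1 : Matrix (Fin (m + 1)) (Fin (m + 1)) S)
        = border 0 (Pi.single 0 1) (Pi.single 0 (A (m + 2))) T := by
    rw [border_mul]
    refine border_ext ?_ ?_ ?_ ?_ <;> intros <;> simp [Pi.single_apply]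
  rw [htop_mul, hmul_top] at hprod
  rcases hprod with hprod | hprod <;> rw [hprod]
  · simpa using isPointedEquivalent_borderHom_of_corner x m (A (m + 2)) 1 T _ _ W
  · simpa using isPointedEquivalent_borderHom_of_corner x m 1 (A (m + 2)) T _ _ W

theorem smul_blockElem_one_top_sub (A : ℕ → S) :
    x • blockElem 1 (-1) (A 1) - blockElem 1 0 (-A 0)
      = blockElem 1 0 (∑ i ∈ Finset.range 2, x ^ i • A i) := by
  rw [blockElem_one_top, blockElem_one_zero, blockElem_one_zero]
  ext a b
  simp [Finset.sum_range_succ, add_comm]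

/-- The factor `M_{-(m+2)}` commutes with all factors but `M_{-(m+1)}`, next to which it can
therefore be moved; a block elimination then reduces the size by one, and the coefficients undergo
one step of Horner's scheme. -/
theorem isPointedEquivalent_fiedler {A : ℕ → S} {t : List ℕ} (ht : t.Nodup)
    (hmem : ∀ i, i ∈ t ↔ 1 ≤ i ∧ i ≤ m + 1) :
    IsPointedEquivalent m m
      (x • (t.map fun i : ℕ => blockElem (m + 1) (-(i : ℤ)) (A i)).prod
        - blockElem (m + 1) 0 (-A 0))
      (blockElem (m + 1) 0 (∑ i ∈ Finset.range (m + 2), x ^ i • A i)) := by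
  induction m generalizing A t with
  | zero =>
    obtain rfl : t = [1] := List.perm_singleton.1 <|
      (List.perm_ext_iff_of_nodup ht (List.nodup_singleton 1)).2 fun i => by
        rw [hmem, List.mem_singleton]
        omega
    rw [List.map_singleton, List.prod_singleton, Nat.cast_one, smul_blockElem_one_top_sub]
    exact IsPointedEquivalent.refl _ _
  | succ m ih =>
    obtain ⟨a, b, hperm, hprod⟩ := exists_prod_map_eq_of_forall_commute
      (fun i : ℕ => blockElem (m + 2) (-(i : ℤ)) (A i)) ht
      ((hmem (m + 2)).2 (by omega)) ((hmem (m + 1)).2 (by omega)) (by omega) fun i hi hne => by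
        rcases eq_or_ne i (m + 2) with rfl | h
        · exact Commute.refl _
        · exact commute_blockElem_top (by have := (hmem i).1 hi; omega) _ _
    have hnodup : (a ++ (m + 1) :: b).Nodup := hperm.nodup_iff.2 (ht.erase _)
    have hmem' : ∀ i, i ∈ a ++ (m + 1) :: b ↔ 1 ≤ i ∧ i ≤ m + 1 := fun i => by
      rw [hperm.mem_iff, ht.mem_erase_iff, hmem]
      omega
    have hle : ∀ i ∈ a ++ b, i ≤ m := fun i hi => by
      have hi' := (hmem' i).1 (by simp only [List.mem_append, List.mem_cons] at hi ⊢; tauto)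
      have hne : i ≠ m + 1 := fun h =>
        (List.nodup_cons.1 (List.nodup_middle.1 hnodup)).1 (h ▸ hi)
      omega
    have hzero : ∀ X : S, blockElem (m + 2) 0 X = borderHom (blockElem (m + 1) 0 X) := fun X => by
      simpa using blockElem_eq_borderHom (Nat.zero_le m) X
    have hstep := isPointedEquivalent_fiedler_hornerStep x (blockElem (m + 1) 0 (-A 0))
      (fun i hi => hle i (by simp [hi])) (fun i hi => hle i (by simp [hi])) hprod
    have hrest := (ih (A := hornerStep x m A) hnodup hmem').map_borderHom
    rw [hornerStep_of_le x (Nat.zero_le m), sum_hornerStep] at hrest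
    rw [hzero, hzero]
    exact hstep.trans hrest

end Reduction

/-! ### Palindromic index tuples -/

/-- The tuple `(0:p-1, 0:p-2, …, 0:1, 0)`, the tail of the symmetric complement of an admissible
tuple of index `p`. -/
def hankelTuple : ℕ → List ℕ
  | 0 => []
  | p + 1 => List.range (p + 1) ++ hankelTuple p

/-- The admissible tuple of `{0:p+2s}` of index `p`, as a tuple of natural numbers, by recursion on
the number `s` of its pairs. -/
def admTuple (p : ℕ) : ℕ → List ℕ
  | 0 => List.range (p + 1)
  | s + 1 => (p + 2 * s + 1) :: (p + 2 * s + 2) :: admTuple p s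

/-- The symmetric complement of `admTuple p s`. -/
def admCompl (p : ℕ) : ℕ → List ℕ
  | 0 => hankelTuple p
  | s + 1 => (p + 2 * s + 1) :: admCompl p s

theorem admissibleTuple_eq (p s : ℕ) :
    admissibleTuple (p + 2 * s) p = (admTuple p s).map (fun i : ℕ => (i : ℤ)) := by
  have h : (p + 2 * s - p) / 2 = s := by omega
  unfold admissibleTuple
  rw [h]
  clear h
  induction s with
  | zero => simp [admTuple]
  | succ s ih =>
    rw [List.range_succ, List.reverse_append, List.reverse_singleton, List.singleton_append,
      List.flatMap_cons, List.append_assoc, ih, admTuple]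
    simp

theorem hankelTuple_eq (p : ℕ) :
    (List.range p).reverse.flatMap (fun q : ℕ => (List.range (q + 1)).map (fun k : ℕ => (k : ℤ)))
      = (hankelTuple p).map (fun i : ℕ => (i : ℤ)) := by
  induction p with
  | zero => simp [hankelTuple]
  | succ p ih =>
    rw [List.range_succ, List.reverse_append, List.reverse_singleton, List.singleton_append,
      List.flatMap_cons, ih, hankelTuple, List.map_append]

theorem symmComplement_eq (p s : ℕ) :
    symmComplement (p + 2 * s) p = (admCompl p s).map (fun i : ℕ => (i : ℤ)) := by
  have h : (p + 2 * s - p) / 2 = s := by omega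
  unfold symmComplement
  rw [h, hankelTuple_eq]
  clear h
  induction s with
  | zero => simp [admCompl]
  | succ s ih =>
    rw [List.range_succ, List.reverse_append, List.reverse_singleton, List.singleton_append,
      List.map_cons, List.cons_append, ih, admCompl]
    simp

theorem lt_of_mem_hankelTuple {p i : ℕ} (h : i ∈ hankelTuple p) : i < p := by
  induction p with
  | zero => simp [hankelTuple] at h
  | succ p ih =>
    rcases List.mem_append.1 h with h | h
    · exact List.mem_range.1 h
    · exact (ih h).trans (Nat.lt_succ_self p)

theorem mem_admTuple {p s i : ℕ} : i ∈ admTuple p s ↔ i ≤ p + 2 * s := by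
  induction s with
  | zero => simp [admTuple]
  | succ s ih =>
    simp only [admTuple, List.mem_cons, ih]
    omega

theorem nodup_admTuple (p s : ℕ) : (admTuple p s).Nodup := by
  induction s with
  | zero => exact List.nodup_range
  | succ s ih =>
    simp only [admTuple, List.nodup_cons, List.mem_cons, mem_admTuple, ih, and_true]
    omega

theorem lt_of_mem_admCompl {p s i : ℕ} (h : i ∈ admCompl p s) : i < p + 2 * s := by
  induction s with
  | zero => exact lt_of_mem_hankelTuple h
  | succ s ih =>
    rcases List.mem_cons.1 h with h | h
    · omega
    · have := ih h
      omega

theorem pos_of_mem_admCompl_zero {s i : ℕ} (h : i ∈ admCompl 0 s) : 0 < i := by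
  induction s with
  | zero => simp [admCompl, hankelTuple] at h
  | succ s ih =>
    rcases List.mem_cons.1 h with h | h
    · omega
    · exact ih h

/-- The tuple `(2s-1:2s, …, 3:4, 1:2)`, that is, `admTuple 0 s` without its last entry `0`. -/
def pairTuple : ℕ → List ℕ
  | 0 => []
  | s + 1 => (2 * s + 1) :: (2 * s + 2) :: pairTuple s

theorem admTuple_zero_eq (s : ℕ) : admTuple 0 s = pairTuple s ++ [0] := by
  induction s with
  | zero => rfl
  | succ s ih => simp [admTuple, pairTuple, ih]

theorem mem_pairTuple {s i : ℕ} : i ∈ pairTuple s ↔ 1 ≤ i ∧ i ≤ 2 * s := by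
  induction s with
  | zero => simp [pairTuple]; omega
  | succ s ih =>
    simp only [pairTuple, List.mem_cons, ih]
    omega

theorem nodup_pairTuple (s : ℕ) : (pairTuple s).Nodup := by
  have := nodup_admTuple 0 s
  rw [admTuple_zero_eq] at this
  exact (List.nodup_append.1 this).1

section PalindromicProducts

variable {M : Type*} [Monoid M] (g : ℕ → M)

theorem prod_range_mul_hankel {p : ℕ} (hg : ∀ i j, j ≤ p → i + 2 ≤ j → Commute (g i) (g j)) :
    ((List.range (p + 1)).map g).prod * ((hankelTuple p).map g).prod
      = ((hankelTuple p).map g).prod * ((List.range (p + 1)).reverse.map g).prod := by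
  induction p with
  | zero => simp [hankelTuple]
  | succ p ih =>
    have hc : Commute (g (p + 1)) ((hankelTuple p).map g).prod :=
      commute_prod_map g fun i hi =>
        (hg i (p + 1) le_rfl (by have := lt_of_mem_hankelTuple hi; omega)).symm
    have ih' := ih fun i j hj => hg i j (by omega)
    rw [List.range_succ (n := p + 1), hankelTuple]
    simp only [List.map_append, List.prod_append, List.reverse_append, List.reverse_singleton,
      List.map_cons, List.map_nil, List.prod_singleton]
    generalize ((List.range (p + 1)).map g).prod = r at *
    generalize ((List.range (p + 1)).reverse.map g).prod = r' at *
    generalize ((hankelTuple p).map g).prod = H at *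
    calc r * g (p + 1) * (r * H) = r * (g (p + 1) * H) * r' := by rw [ih']; simp only [mul_assoc]
      _ = r * H * (g (p + 1) * r') := by rw [hc.eq]; simp only [mul_assoc]

theorem prod_reverse_hankel {p : ℕ} (hg : ∀ i j, j < p → i + 2 ≤ j → Commute (g i) (g j)) :
    ((hankelTuple p).reverse.map g).prod = ((hankelTuple p).map g).prod := by
  induction p with
  | zero => simp [hankelTuple]
  | succ p ih =>
    rw [hankelTuple, List.reverse_append, List.map_append, List.prod_append,
      ih fun i j hj => hg i j (by omega), List.map_append, List.prod_append,
      prod_range_mul_hankel g fun i j hj => hg i j (by omega)]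

theorem prod_reverse_admCompl {p s : ℕ}
    (hg : ∀ i j, j ≤ p + 2 * s → i + 2 ≤ j → Commute (g i) (g j)) :
    ((admCompl p s).reverse.map g).prod = ((admCompl p s).map g).prod := by
  induction s with
  | zero => exact prod_reverse_hankel g fun i j hj => hg i j (by omega)
  | succ s ih =>
    have hc : Commute (g (p + 2 * s + 1)) ((admCompl p s).map g).prod :=
      commute_prod_map g fun i hi =>
        (hg i _ (by omega) (by have := lt_of_mem_admCompl hi; omega)).symm
    rw [admCompl, List.reverse_cons, List.map_append, List.prod_append,
      ih fun i j hj => hg i j (by omega)]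
    simp [hc.eq]

theorem prod_reverse_admTuple_append {p s : ℕ}
    (hg : ∀ i j, j ≤ p + 2 * s → i + 2 ≤ j → Commute (g i) (g j)) :
    ((admTuple p s ++ admCompl p s).reverse.map g).prod
      = ((admTuple p s ++ admCompl p s).map g).prod := by
  induction s with
  | zero =>
    have := prod_reverse_hankel g (p := p + 1) fun i j hj => hg i j (by omega)
    simpa [hankelTuple, admTuple, admCompl] using this
  | succ s ih =>
    have hc : Commute (g (p + 2 * s + 1)) ((admCompl p s).map g).prod :=
      commute_prod_map g fun i hi =>
        (hg i _ (by omega) (by have := lt_of_mem_admCompl hi; omega)).symm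
    have hb : Commute (g (p + 2 * s + 2)) ((admTuple p s ++ admCompl p s).map g).prod :=
      commute_prod_map g fun i hi => by
        have : i ≤ p + 2 * s := by
          rcases List.mem_append.1 hi with hi | hi
          · exact mem_admTuple.1 hi
          · exact (lt_of_mem_admCompl hi).le
        exact (hg i _ (by omega) (by omega)).symm
    have hC := prod_reverse_admCompl g (p := p) (s := s) fun i j hj => hg i j (by omega)
    have ih' := ih fun i j hj => hg i j (by omega)
    simp only [admTuple, admCompl, List.reverse_append, List.reverse_cons, List.map_append,
      List.map_cons, List.map_nil, List.prod_append, List.prod_cons, List.prod_nil, mul_one] at *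
    rw [hC] at ih' ⊢
    generalize ((admTuple p s).map g).prod = Y at *
    generalize ((admTuple p s).reverse.map g).prod = Y' at *
    generalize ((admCompl p s).map g).prod = C at *
    generalize g (p + 2 * s + 1) = a at *
    generalize g (p + 2 * s + 2) = b at *
    calc C * a * (Y' * b * a) = a * (C * Y') * b * a := by rw [← hc.eq]; simp only [mul_assoc]
      _ = a * (b * (Y * C)) * a := by rw [ih', hb.eq]; simp only [mul_assoc]
      _ = a * (b * Y) * (a * C) := by rw [hc.eq]; simp only [mul_assoc]

end PalindromicProducts

/-! ### Matrices that agree with the identity outside of an interval of blocks -/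

section Support

variable {S : Type*} [Ring S] {m : ℕ}

/-- `M` agrees with the identity matrix outside of the rows and columns `lo, …, hi`. -/
def SupportedOn (lo hi : ℕ) (M : Matrix (Fin m) (Fin m) S) : Prop :=
  ∀ a b : Fin m, ¬ ((lo ≤ a ∧ (a : ℕ) ≤ hi) ∧ (lo ≤ b ∧ (b : ℕ) ≤ hi)) →
    M a b = (1 : Matrix (Fin m) (Fin m) S) a b

theorem SupportedOn.mono {lo hi lo' hi' : ℕ} {M : Matrix (Fin m) (Fin m) S}
    (h : SupportedOn lo hi M) (hlo : lo' ≤ lo) (hhi : hi ≤ hi') : SupportedOn lo' hi' M :=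
  fun a b hab => h a b fun ⟨ha, hb⟩ =>
    hab ⟨⟨hlo.trans ha.1, ha.2.trans hhi⟩, hlo.trans hb.1, hb.2.trans hhi⟩

theorem supportedOn_one (lo hi : ℕ) : SupportedOn lo hi (1 : Matrix (Fin m) (Fin m) S) :=
  fun _ _ _ => rfl

theorem SupportedOn.sub_one_mul_sub_one {lo hi lo' hi' : ℕ} {M N : Matrix (Fin m) (Fin m) S}
    (hM : SupportedOn lo hi M) (hN : SupportedOn lo' hi' N) (h : hi < lo' ∨ hi' < lo) :
    (M - 1) * (N - 1) = 0 := by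
  ext a b
  rw [Matrix.mul_apply]
  refine Finset.sum_eq_zero fun c _ => ?_
  rw [Matrix.sub_apply, Matrix.sub_apply]
  by_cases hc : lo ≤ c ∧ (c : ℕ) ≤ hi
  · rw [hN c b (by omega), sub_self, mul_zero]
  · rw [hM a c (fun h => hc h.2), sub_self, zero_mul]

theorem SupportedOn.commute {lo hi lo' hi' : ℕ} {M N : Matrix (Fin m) (Fin m) S}
    (hM : SupportedOn lo hi M) (hN : SupportedOn lo' hi' N) (h : hi < lo' ∨ hi' < lo) :
    Commute M N := by
  have hMN : M * N = (M - 1) * (N - 1) + M + N - 1 := by noncomm_ring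
  have hNM : N * M = (N - 1) * (M - 1) + M + N - 1 := by noncomm_ring
  rw [Commute, SemiconjBy, hMN, hNM, hM.sub_one_mul_sub_one hN h,
    hN.sub_one_mul_sub_one hM h.symm]

theorem SupportedOn.mul {lo hi : ℕ} {M N : Matrix (Fin m) (Fin m) S}
    (hM : SupportedOn lo hi M) (hN : SupportedOn lo hi N) : SupportedOn lo hi (M * N) := by
  intro a b hab
  rw [Matrix.mul_apply]
  by_cases ha : lo ≤ a ∧ (a : ℕ) ≤ hi
  · rw [Finset.sum_eq_single b]
    · rw [hM a b hab, hN b b (fun h => hab ⟨ha, h.1⟩), Matrix.one_apply_eq, mul_one]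
    · intro c _ hc
      rw [hN c b (fun h => hab ⟨ha, h.2⟩), Matrix.one_apply_ne hc, mul_zero]
    · simp
  · rw [Finset.sum_eq_single a]
    · rw [hM a a (fun h => ha h.1), Matrix.one_apply_eq, one_mul, hN a b hab]
    · intro c _ hc
      rw [hM a c (fun h => ha h.1), Matrix.one_apply_ne hc.symm, zero_mul]
    · simp

theorem SupportedOn.list_prod {ι : Type*} {lo hi : ℕ} {g : ι → Matrix (Fin m) (Fin m) S}
    {t : List ι} (h : ∀ i ∈ t, SupportedOn lo hi (g i)) : SupportedOn lo hi (t.map g).prod :=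
  List.prod_induction _ (fun _ _ => .mul) (supportedOn_one lo hi) (List.forall_mem_map.2 h)

theorem SupportedOn.vecMul {lo hi a : ℕ} {M : Matrix (Fin m) (Fin m) S} (hM : SupportedOn lo hi M)
    (ha : a < m) (h : a < lo ∨ hi < a) : basisVec m S a ᵥ* M = basisVec m S a := by
  rw [basisVec_vecMul ha]
  ext j
  rw [hM ⟨a, ha⟩ j fun hsupp => by have := hsupp.1; dsimp only at this; omega]
  simp [basisVec, Matrix.one_apply, Fin.ext_iff, eq_comm]

theorem SupportedOn.mulVec {lo hi a : ℕ} {M : Matrix (Fin m) (Fin m) S} (hM : SupportedOn lo hi M)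
    (ha : a < m) (h : a < lo ∨ hi < a) : M *ᵥ basisVec m S a = basisVec m S a := by
  rw [mulVec_basisVec ha]
  ext j
  rw [hM j ⟨a, ha⟩ fun hsupp => by have := hsupp.2; dsimp only at this; omega]
  simp [basisVec, Matrix.one_apply, Fin.ext_iff]

theorem eq_one_of_basisVec_vecMul {M : Matrix (Fin m) (Fin m) S}
    (h : ∀ a < m, basisVec m S a ᵥ* M = basisVec m S a) : M = 1 := by
  ext a b
  have hrow := congrFun (h a a.2) b
  rw [basisVec_vecMul a.2] at hrow
  simpa [basisVec, Matrix.one_apply, Fin.ext_iff, eq_comm] using hrow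

end Support

/-! ### The Fiedler factors -/

section Factors

variable {S : Type*} [Ring S]

/-- The factor `M_i(-A_i)`, `0 ≤ i`, of the constant coefficient. -/
def lowFactor (m : ℕ) (A : ℕ → S) (i : ℕ) : Matrix (Fin m) (Fin m) S := blockElem m (i : ℤ) (-A i)

/-- The factor `M_{j-m}(A_{m-j})`, `j < m`, of the leading coefficient. It is indexed by its place
in the shifted tuple `z + m`. -/
def highFactor (m : ℕ) (A : ℕ → S) (j : ℕ) : Matrix (Fin m) (Fin m) S :=
  blockElem m (-((m - j : ℕ) : ℤ)) (A (m - j))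

section Map

variable {S' : Type*} [Ring S'] (f : S →+* S') (m : ℕ) (A : ℕ → S) (i : ℕ)

theorem lowFactor_map : (lowFactor m A i).map f = lowFactor m (fun i => f (A i)) i := by
  rw [lowFactor, blockElem_map, map_neg, lowFactor]

theorem highFactor_map : (highFactor m A i).map f = highFactor m (fun i => f (A i)) i := by
  rw [highFactor, blockElem_map, highFactor]

end Map

variable {m : ℕ} (A : ℕ → S)

theorem supportedOn_lowFactor {i : ℕ} (hi : i < m) :
    SupportedOn (m - i - 1) (m - i) (lowFactor m A i) := by
  intro a b hab
  rcases Nat.eq_zero_or_pos i with rfl | hi0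
  · rw [lowFactor, Nat.cast_zero, blockElem_zero_apply, Matrix.one_apply]
    grind
  · rw [lowFactor, blockElem_pos_apply hi0, Matrix.one_apply]
    grind

theorem supportedOn_highFactor {j : ℕ} (hj : j < m) :
    SupportedOn (j - 1) j (highFactor m A j) := by
  intro a b hab
  rcases Nat.eq_zero_or_pos j with rfl | hj0
  · rw [highFactor, Nat.sub_zero, blockElem_top_apply hj, Matrix.one_apply]
    grind
  · rw [highFactor, blockElem_neg_apply (by omega) (by omega), Matrix.one_apply]
    grind

theorem commute_lowFactor {i j : ℕ} (hj : j < m) (hij : i + 2 ≤ j) :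
    Commute (lowFactor m A i) (lowFactor m A j) :=
  (supportedOn_lowFactor A (by omega)).commute (supportedOn_lowFactor A hj) (by omega)

theorem commute_highFactor {i j : ℕ} (hj : j < m) (hij : i + 2 ≤ j) :
    Commute (highFactor m A i) (highFactor m A j) :=
  (supportedOn_highFactor A (by omega)).commute (supportedOn_highFactor A hj) (by omega)

theorem commute_lowFactor_highFactor {i j : ℕ} (hij : i + j + 2 ≤ m) :
    Commute (lowFactor m A i) (highFactor m A j) :=
  (supportedOn_lowFactor A (by omega)).commute (supportedOn_highFactor A (by omega)) (by omega)

section Rows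

variable {i j : ℕ}

theorem lowFactor_mulVec (hi : 0 < i) (h : i + j + 1 = m) :
    lowFactor m A i *ᵥ basisVec m S (j + 1) = basisVec m S j := by
  rw [mulVec_basisVec (by omega)]
  ext a
  rw [lowFactor, blockElem_pos_apply hi, basisVec]
  grind

theorem vecMul_lowFactor (hi : 0 < i) (h : i + j + 1 = m) :
    basisVec m S j ᵥ* lowFactor m A i = -A i • basisVec m S j + basisVec m S (j + 1) := by
  rw [basisVec_vecMul (by omega)]
  ext a
  rw [lowFactor, blockElem_pos_apply hi, Pi.add_apply, Pi.smul_apply, smul_eq_mul, basisVec,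
    basisVec]
  grind

theorem vecMul_lowFactor_succ (hi : 0 < i) (h : i + j + 1 = m) :
    basisVec m S (j + 1) ᵥ* lowFactor m A i = basisVec m S j := by
  rw [basisVec_vecMul (by omega)]
  ext a
  rw [lowFactor, blockElem_pos_apply hi, basisVec]
  grind

theorem vecMul_highFactor (hj : j + 1 < m) :
    basisVec m S j ᵥ* highFactor m A (j + 1) = basisVec m S (j + 1) := by
  rw [basisVec_vecMul (by omega)]
  ext a
  rw [highFactor, blockElem_neg_apply (by omega) (by omega), basisVec]
  grind

theorem vecMul_highFactor_succ (hi : 0 < i) (h : i + j + 1 = m) :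
    basisVec m S (j + 1) ᵥ* highFactor m A (j + 1)
      = basisVec m S j + A i • basisVec m S (j + 1) := by
  rw [basisVec_vecMul (by omega)]
  ext a
  rw [highFactor, blockElem_neg_apply (by omega) (by omega), Pi.add_apply, Pi.smul_apply,
    smul_eq_mul, basisVec, basisVec]
  grind

theorem vecMul_highFactor_zero (hm : 0 < m) :
    basisVec m S 0 ᵥ* highFactor m A 0 = A m • basisVec m S 0 := by
  rw [basisVec_vecMul hm]
  ext a
  rw [highFactor, Nat.sub_zero, blockElem_top_apply hm, Pi.smul_apply, smul_eq_mul, basisVec]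
  grind

end Rows

section Inverses

variable {i j : ℕ}

theorem lowFactor_mul_highFactor (hi : 0 < i) (h : i + j + 1 = m) :
    lowFactor m A i * highFactor m A (j + 1) = 1 := by
  refine eq_one_of_basisVec_vecMul fun a ha => ?_
  rw [← Matrix.vecMul_vecMul]
  rcases eq_or_ne a j with rfl | haj
  · rw [vecMul_lowFactor A hi h, Matrix.add_vecMul, Matrix.smul_vecMul,
      vecMul_highFactor A (by omega), vecMul_highFactor_succ A hi h]
    simp
  rcases eq_or_ne a (j + 1) with rfl | haj'
  · rw [vecMul_lowFactor_succ A hi h, vecMul_highFactor A (by omega)]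
  · rw [(supportedOn_lowFactor A (by omega)).vecMul ha (by omega),
      (supportedOn_highFactor A (by omega)).vecMul ha (by omega)]

theorem highFactor_mul_lowFactor (hi : 0 < i) (h : i + j + 1 = m) :
    highFactor m A (j + 1) * lowFactor m A i = 1 := by
  refine eq_one_of_basisVec_vecMul fun a ha => ?_
  rw [← Matrix.vecMul_vecMul]
  rcases eq_or_ne a j with rfl | haj
  · rw [vecMul_highFactor A (by omega), vecMul_lowFactor_succ A hi h]
  rcases eq_or_ne a (j + 1) with rfl | haj'
  · rw [vecMul_highFactor_succ A hi h, Matrix.add_vecMul, Matrix.smul_vecMul,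
      vecMul_lowFactor A hi h, vecMul_lowFactor_succ A hi h]
    simp
  · rw [(supportedOn_highFactor A (by omega)).vecMul ha (by omega),
      (supportedOn_lowFactor A (by omega)).vecMul ha (by omega)]

theorem isUnit_lowFactor (hi : 0 < i) (him : i < m) : IsUnit (lowFactor m A i) := by
  obtain ⟨j, h⟩ : ∃ j, i + j + 1 = m := ⟨m - i - 1, by omega⟩
  exact ⟨⟨_, _, lowFactor_mul_highFactor A hi h, highFactor_mul_lowFactor A hi h⟩, rfl⟩

theorem highFactor_zero (hm : 0 < m) :
    highFactor m A 0 = Matrix.diagonal fun a : Fin m => if (a : ℕ) = 0 then A m else 1 := by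
  ext a b
  rw [highFactor, Nat.sub_zero, blockElem_top_apply hm, Matrix.diagonal_apply]

theorem isUnit_diagonal {d : Fin m → S} (hd : ∀ a, IsUnit (d a)) : IsUnit (Matrix.diagonal d) := by
  choose u hu using hd
  refine ⟨⟨Matrix.diagonal d, Matrix.diagonal fun a => (↑(u a)⁻¹ : S), ?_, ?_⟩, rfl⟩ <;>
    simp [Matrix.diagonal_mul_diagonal, ← hu]

theorem isUnit_highFactor (hj : j < m) (h : j ≠ 0 ∨ IsUnit (A m)) : IsUnit (highFactor m A j) := by
  rcases j with _ | j
  · rw [highFactor_zero A hj]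
    refine isUnit_diagonal fun a => ?_
    split_ifs
    exacts [h.resolve_left (by simp), isUnit_one]
  · obtain ⟨i, hi, hij⟩ : ∃ i, 0 < i ∧ i + j + 1 = m := ⟨m - j - 1, by omega, by omega⟩
    exact ⟨⟨_, _, highFactor_mul_lowFactor A hi hij, lowFactor_mul_highFactor A hi hij⟩, rfl⟩

/-- The tuple of the indices `m - i`, in the opposite order. If `0 < i < m` for all entries of `t`,
then `∏_{i ∈ t} M_i(-A_i)` and the product of the factors `M_{j-m}(A_{m-j})` over `mirror m t` are
inverse to each other. -/
def mirror (m : ℕ) (t : List ℕ) : List ℕ := (t.map (m - ·)).reverse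

theorem mirror_mirror {t : List ℕ} (ht : ∀ i ∈ t, i ≤ m) : mirror m (mirror m t) = t := by
  rw [mirror, mirror, List.map_reverse, List.reverse_reverse, List.map_map]
  exact (List.map_congr_left fun i hi => Nat.sub_sub_self (ht i hi)).trans t.map_id

theorem prod_highFactor_mirror_mul {t : List ℕ} (ht : ∀ i ∈ t, 0 < i ∧ i < m) :
    ((mirror m t).map (highFactor m A)).prod * (t.map (lowFactor m A)).prod = 1 := by
  induction t with
  | nil => simp [mirror]
  | cons i t ih =>
    obtain ⟨⟨hi, him⟩, ht⟩ := List.forall_mem_cons.1 ht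
    obtain ⟨j, hj⟩ : ∃ j, m - i = j + 1 := ⟨m - i - 1, by omega⟩
    have hinv := highFactor_mul_lowFactor A hi (by omega : i + j + 1 = m)
    simp only [mirror, List.map_cons, List.reverse_cons, List.map_append, List.prod_append,
      List.map_nil, List.prod_cons, List.prod_nil, mul_one, mul_assoc] at ih ⊢
    rw [hj, ← mul_assoc (highFactor m A _), hinv, one_mul, ih ht]

theorem prod_lowFactor_mul_mirror {t : List ℕ} (ht : ∀ i ∈ t, 0 < i ∧ i < m) :
    (t.map (lowFactor m A)).prod * ((mirror m t).map (highFactor m A)).prod = 1 := by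
  induction t with
  | nil => simp [mirror]
  | cons i t ih =>
    obtain ⟨⟨hi, him⟩, ht⟩ := List.forall_mem_cons.1 ht
    obtain ⟨j, hj⟩ : ∃ j, m - i = j + 1 := ⟨m - i - 1, by omega⟩
    have hinv := lowFactor_mul_highFactor A hi (by omega : i + j + 1 = m)
    simp only [mirror, List.map_cons, List.reverse_cons, List.map_append, List.prod_append,
      List.map_nil, List.prod_cons, List.prod_nil, mul_one, mul_assoc] at ih ⊢
    rw [hj, ← mul_assoc (t.map _).prod, ih ht, one_mul, hinv]

theorem pos_lt_of_mem_mirror {t : List ℕ} (ht : ∀ i ∈ t, 0 < i ∧ i < m) :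
    ∀ i ∈ mirror m t, 0 < i ∧ i < m := by
  simp only [mirror, List.mem_reverse, List.mem_map]
  rintro _ ⟨i, hi, rfl⟩
  have := ht i hi
  omega

theorem prod_highFactor_mul_mirror {t : List ℕ} (ht : ∀ i ∈ t, 0 < i ∧ i < m) :
    (t.map (highFactor m A)).prod * ((mirror m t).map (lowFactor m A)).prod = 1 := by
  have h := prod_highFactor_mirror_mul A (pos_lt_of_mem_mirror ht)
  rwa [mirror_mirror fun i hi => (ht i hi).2.le] at h

theorem prod_lowFactor_mirror_mul {t : List ℕ} (ht : ∀ i ∈ t, 0 < i ∧ i < m) :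
    ((mirror m t).map (lowFactor m A)).prod * (t.map (highFactor m A)).prod = 1 := by
  have h := prod_lowFactor_mul_mirror A (pos_lt_of_mem_mirror ht)
  rwa [mirror_mirror fun i hi => (ht i hi).2.le] at h

end Inverses

end Factors

/-! ### The block pencil and its reversal -/

section BlockPencil

variable {S : Type*} [Ring S]

/-- The leading coefficient `M_z M_{c_w} M_{c_z}`, in block form. Here `w` is the admissible tuple
of `{0:2e}` of index `0` and `z + m` is the admissible tuple of `{0:p+2s}` of index `p`. -/
def leadBlock (m e p s : ℕ) (A : ℕ → S) : Matrix (Fin m) (Fin m) S :=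
  ((admTuple p s).map (highFactor m A)).prod * ((admCompl 0 e).map (lowFactor m A)).prod *
    ((admCompl p s).map (highFactor m A)).prod

/-- The constant coefficient `M_w M_{c_w} M_{c_z}`, in block form. -/
def constBlock (m e p s : ℕ) (A : ℕ → S) : Matrix (Fin m) (Fin m) S :=
  ((admTuple 0 e).map (lowFactor m A)).prod * ((admCompl 0 e).map (lowFactor m A)).prod *
    ((admCompl p s).map (highFactor m A)).prod

/-- The position `m - i_0(w)`, counted from `0`. -/
def blockPos (m e : ℕ) : ℕ := if e = 0 then m - 1 else m - 2

section Map

variable {S' : Type*} [Ring S'] (f : S →+* S') (m e p s : ℕ) (A : ℕ → S)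

theorem list_prod_map_matrix {ι : Type*} (g : ι → Matrix (Fin m) (Fin m) S) (t : List ι) :
    (t.map g).prod.map f = (t.map fun i => (g i).map f).prod := by
  have h := map_list_prod f.mapMatrix (t.map g)
  rwa [List.map_map] at h

theorem leadBlock_map : (leadBlock m e p s A).map f = leadBlock m e p s fun i => f (A i) := by
  simp only [leadBlock, Matrix.map_mul, list_prod_map_matrix, lowFactor_map, highFactor_map]

theorem constBlock_map : (constBlock m e p s A).map f = constBlock m e p s fun i => f (A i) := by
  simp only [constBlock, Matrix.map_mul, list_prod_map_matrix, lowFactor_map, highFactor_map]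

end Map

variable {m e p s : ℕ} (A : ℕ → S)

theorem prod_pairTuple_mulVec (he : 2 * e < m) :
    ((pairTuple e).map (lowFactor m A)).prod *ᵥ basisVec m S (m - 1)
      = basisVec m S (blockPos m e) := by
  induction e with
  | zero => simp [pairTuple, blockPos]
  | succ e ih =>
    rw [pairTuple, List.map_cons, List.map_cons, List.prod_cons, List.prod_cons,
      ← Matrix.mulVec_mulVec, ← Matrix.mulVec_mulVec, ih (by omega)]
    rcases Nat.eq_zero_or_pos e with rfl | he0
    · obtain ⟨j, rfl⟩ : ∃ j, m = j + 2 := ⟨m - 2, by omega⟩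
      rw [blockPos, if_pos rfl, blockPos, if_neg (by omega),
        (supportedOn_lowFactor A (by omega)).mulVec (by omega) (by omega)]
      exact lowFactor_mulVec A (by omega) (by omega)
    · rw [blockPos, if_neg (by omega), blockPos, if_neg (by omega),
        (supportedOn_lowFactor A (by omega)).mulVec (by omega) (by omega),
        (supportedOn_lowFactor A (by omega)).mulVec (by omega) (by omega)]

theorem vecMul_prod_admCompl_zero (he : 2 * e < m) :
    basisVec m S (m - 1) ᵥ* ((admCompl 0 e).map (lowFactor m A)).prod
      = basisVec m S (blockPos m e) := by
  induction e with
  | zero => simp [admCompl, hankelTuple, blockPos]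
  | succ e ih =>
    rw [admCompl, List.map_cons, List.prod_cons, ← Matrix.vecMul_vecMul]
    rcases Nat.eq_zero_or_pos e with rfl | he0
    · obtain ⟨j, rfl⟩ : ∃ j, m = j + 2 := ⟨m - 2, by omega⟩
      rw [blockPos, if_neg (by omega), Nat.add_sub_assoc (by omega),
        vecMul_lowFactor_succ A (by omega) (by omega)]
      simp [admCompl, hankelTuple]
    · rw [(supportedOn_lowFactor A (by omega)).vecMul (by omega) (by omega), ih (by omega),
        blockPos, if_neg (by omega), blockPos, if_neg (by omega)]

theorem supportedOn_prod_admCompl (h : p + 2 * s < m) :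
    SupportedOn 0 (p + 2 * s - 1) ((admCompl p s).map (highFactor m A)).prod :=
  SupportedOn.list_prod fun i hi => by
    have := lt_of_mem_admCompl hi
    exact (supportedOn_highFactor A (by omega)).mono (by omega) (by omega)

theorem vecMul_prod_compl (hm : m = 2 * e + 1 + (p + 2 * s)) :
    basisVec m S (m - 1) ᵥ* (((admCompl 0 e).map (lowFactor m A)).prod *
      ((admCompl p s).map (highFactor m A)).prod) = basisVec m S (blockPos m e) := by
  rw [← Matrix.vecMul_vecMul, vecMul_prod_admCompl_zero A (by omega)]
  rcases Nat.eq_zero_or_pos (p + 2 * s) with h | h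
  · obtain ⟨rfl, rfl⟩ : p = 0 ∧ s = 0 := by omega
    simp [admCompl, hankelTuple]
  · refine (supportedOn_prod_admCompl A (by omega)).vecMul ?_ (Or.inr ?_) <;>
      unfold blockPos <;> split_ifs <;> omega

theorem isUnit_prod_compl (hm : m = 2 * e + 1 + (p + 2 * s)) (hA : IsUnit (A m) ∨ p = 0) :
    IsUnit (((admCompl 0 e).map (lowFactor m A)).prod *
      ((admCompl p s).map (highFactor m A)).prod) := by
  refine (List.prod_isUnit (List.forall_mem_map.2 fun i hi => ?_)).mul
    (List.prod_isUnit (List.forall_mem_map.2 fun i hi => ?_))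
  · have := lt_of_mem_admCompl hi
    exact isUnit_lowFactor A (pos_of_mem_admCompl_zero hi) (by omega)
  · have := lt_of_mem_admCompl hi
    refine isUnit_highFactor A (by omega) (hA.symm.imp_left fun hp => ?_)
    subst hp
    exact (pos_of_mem_admCompl_zero hi).ne'

theorem mirror_append_perm_range {q r : ℕ} {l w : List ℕ} (hl : l.Nodup) (hw : w.Nodup)
    (hlq : ∀ i, i ∈ l ↔ 0 < i ∧ i ≤ q) (hwr : ∀ i, i ∈ w ↔ i ≤ r) (hm : m = q + r + 1) :
    (mirror m l ++ w).Perm (List.range m) := by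
  have hmirror : ∀ i, i ∈ mirror m l ↔ r < i ∧ i < m := fun i => by
    simp only [mirror, List.mem_reverse, List.mem_map, hlq]
    exact ⟨by rintro ⟨j, hj, rfl⟩; omega, fun h => ⟨m - i, by omega, by omega⟩⟩
  have hnd : (mirror m l).Nodup := List.nodup_reverse.2 <| hl.map_on fun a ha b hb hab => by
    rw [hlq] at ha hb
    omega
  refine (List.perm_ext_iff_of_nodup (hnd.append hw fun i hi hi' => ?_) List.nodup_range).2
    fun i => ?_
  · rw [hmirror] at hi
    rw [hwr] at hi'
    omega
  · rw [List.mem_append, hmirror, hwr, List.mem_range]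
    omega

theorem nodup_map_sub_of_perm_range {v : List ℕ} (hv : v.Perm (List.range m)) :
    (v.map (m - ·)).Nodup :=
  (hv.nodup_iff.2 List.nodup_range).map_on fun a ha b hb hab => by
    have := List.mem_range.1 (hv.subset ha)
    have := List.mem_range.1 (hv.subset hb)
    omega

theorem mem_map_sub_of_perm_range {v : List ℕ} (hv : v.Perm (List.range m)) (i : ℕ) :
    i ∈ v.map (m - ·) ↔ 1 ≤ i ∧ i ≤ m := by
  simp only [List.mem_map, hv.mem_iff, List.mem_range]
  exact ⟨by rintro ⟨j, hj, rfl⟩; omega, fun h => ⟨m - i, by omega, by omega⟩⟩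

variable {R : Type*} [CommRing R] [Algebra R S]

theorem isPointedEquivalent_highFactor_pencil (x : R) (hm : 0 < m) {v : List ℕ}
    (hv : v.Perm (List.range m)) :
    IsPointedEquivalent (m - 1) (m - 1) (x • (v.map (highFactor m A)).prod - lowFactor m A 0)
      (blockElem m 0 (∑ i ∈ Finset.range (m + 1), x ^ i • A i)) := by
  obtain ⟨k, rfl⟩ : ∃ k, m = k + 1 := ⟨m - 1, by omega⟩
  have := isPointedEquivalent_fiedler x (A := A) (nodup_map_sub_of_perm_range hv)
    (mem_map_sub_of_perm_range hv)
  rwa [List.map_map] at this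

theorem isPointedEquivalent_blockPencil (x : R) (hm : m = 2 * e + 1 + (p + 2 * s))
    (hA : IsUnit (A m) ∨ p = 0) :
    IsPointedEquivalent (blockPos m e) (m - 1) (x • leadBlock m e p s A - constBlock m e p s A)
      (blockElem m 0 (∑ i ∈ Finset.range (m + 1), x ^ i • A i)) := by
  have hpair : ∀ i ∈ pairTuple e, 0 < i ∧ i < m := fun i hi => by
    have := mem_pairTuple.1 hi
    omega
  have hperm := mirror_append_perm_range (nodup_pairTuple e) (nodup_admTuple p s)
    (fun _ => mem_pairTuple) (fun _ => mem_admTuple) (by omega : m = 2 * e + (p + 2 * s) + 1)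
  have hpos := prod_pairTuple_mulVec A (by omega : 2 * e < m)
  have hpos' := vecMul_prod_compl A hm
  have hunit : IsUnit ((pairTuple e).map (lowFactor m A)).prod :=
    ⟨⟨_, _, prod_lowFactor_mul_mirror A hpair, prod_highFactor_mirror_mul A hpair⟩, rfl⟩
  have hfactor : x • leadBlock m e p s A - constBlock m e p s A
      = ((pairTuple e).map (lowFactor m A)).prod *
        (x • ((mirror m (pairTuple e) ++ admTuple p s).map (highFactor m A)).prod
          - lowFactor m A 0) *
        (((admCompl 0 e).map (lowFactor m A)).prod *
          ((admCompl p s).map (highFactor m A)).prod) := by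
    have hcancel (X : Matrix (Fin m) (Fin m) S) : ((pairTuple e).map (lowFactor m A)).prod *
        (((mirror m (pairTuple e)).map (highFactor m A)).prod * X) = X := by
      rw [← mul_assoc, prod_lowFactor_mul_mirror A hpair, one_mul]
    simp [leadBlock, constBlock, admTuple_zero_eq, mul_sub, sub_mul, mul_assoc, hcancel]
  rw [hfactor]
  exact (isPointedEquivalent_of_mul_mul hunit (isUnit_prod_compl A hm hA) hpos hpos').trans
    (isPointedEquivalent_highFactor_pencil A x (by omega) hperm)

theorem isEquivalent_submatrix_rev (M : Matrix (Fin m) (Fin m) S) :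
    IsEquivalent M (M.submatrix Fin.rev Fin.rev) := by
  set U : Matrix (Fin m) (Fin m) S := Fin.revPerm.toPEquiv.toMatrix with hU
  have hUU : U * U = 1 := by
    rw [hU, PEquiv.toMatrix_toPEquiv_mul]
    ext a b
    simp [PEquiv.toMatrix_apply, Matrix.one_apply]
  refine ⟨U, U, ⟨⟨U, U, hUU, hUU⟩, rfl⟩, ⟨⟨U, U, hUU, hUU⟩, rfl⟩, ?_⟩
  rw [hU, PEquiv.toMatrix_toPEquiv_mul, PEquiv.mul_toMatrix_toPEquiv]
  rfl

theorem list_prod_submatrix_rev {ι : Type*} (g : ι → Matrix (Fin m) (Fin m) S) (t : List ι) :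
    (t.map g).prod.submatrix Fin.rev Fin.rev
      = (t.map fun i => (g i).submatrix Fin.rev Fin.rev).prod := by
  have h := map_list_prod (Matrix.reindexAlgEquiv ℤ S (Fin.revPerm (n := m))) (t.map g)
  rwa [List.map_map] at h

theorem lowFactor_submatrix_rev {i : ℕ} (hi : i < m) :
    (lowFactor m A i).submatrix Fin.rev Fin.rev = blockElem m (-((m - i : ℕ) : ℤ)) (-A i) := by
  ext a b
  rw [Matrix.submatrix_apply, lowFactor]
  rcases Nat.eq_zero_or_pos i with rfl | hi0
  · rw [Nat.cast_zero, Nat.sub_zero, blockElem_zero_apply, blockElem_top_apply hi]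
    simp only [Fin.rev_inj, Fin.val_rev]
    grind
  · rw [blockElem_pos_apply hi0, blockElem_neg_apply (by omega) (by omega)]
    simp only [Fin.rev_inj, Fin.val_rev]
    split_ifs <;> first | rfl | omega

theorem highFactor_zero_submatrix_rev (hm : 0 < m) :
    (highFactor m A 0).submatrix Fin.rev Fin.rev = blockElem m 0 (A m) := by
  ext a b
  rw [Matrix.submatrix_apply, highFactor, Nat.sub_zero, blockElem_zero_apply,
    blockElem_top_apply hm]
  simp only [Fin.rev_inj, Fin.val_rev]
  grind

theorem IsEquivalent.neg {M N : Matrix (Fin m) (Fin m) S} (h : IsEquivalent M N) :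
    IsEquivalent (-M) (-N) := by
  obtain ⟨U, V, hU, hV, rfl⟩ := h
  exact ⟨U, V, hU, hV, by rw [mul_neg, neg_mul]⟩

theorem isEquivalent_neg_blockElem_zero (X : S) :
    IsEquivalent (-blockElem m 0 (-X)) (blockElem m 0 X) := by
  refine ⟨Matrix.diagonal fun a => if (a : ℕ) + 1 = m then 1 else -1, 1,
    isUnit_diagonal fun a => ?_, isUnit_one, ?_⟩
  · split_ifs
    exacts [isUnit_one, isUnit_one.neg]
  · ext a b
    rw [mul_one, Matrix.diagonal_mul, Matrix.neg_apply, blockElem_zero_apply, blockElem_zero_apply]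
    split_ifs <;> simp

/-- Reversing the order of the blocks exchanges the roles of the two kinds of factors, up to
sign. -/
theorem isEquivalent_reversed_lowFactor_pencil (y : R) (hm : 0 < m) {v : List ℕ}
    (hv : v.Perm (List.range m)) :
    IsEquivalent (highFactor m A 0 - y • (v.map (lowFactor m A)).prod)
      (blockElem m 0 (∑ i ∈ Finset.range (m + 1), y ^ i • A (m - i))) := by
  set g : ℕ → Matrix (Fin m) (Fin m) S := fun i => blockElem m (-(i : ℤ)) (-A (m - i))
  have hrev : (highFactor m A 0 - y • (v.map (lowFactor m A)).prod).submatrix Fin.rev Fin.rev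
      = -(y • ((v.map (m - ·)).map g).prod - blockElem m 0 (- -A m)) := by
    rw [Matrix.submatrix_sub, Matrix.submatrix_smul, Pi.sub_apply, Pi.sub_apply, Pi.smul_apply,
      Pi.smul_apply, list_prod_submatrix_rev, highFactor_zero_submatrix_rev A hm, neg_sub, neg_neg,
      List.map_map]
    congr 3
    refine List.map_congr_left fun i hi => ?_
    have him := List.mem_range.1 (hv.subset hi)
    rw [lowFactor_submatrix_rev A him, Function.comp_apply]
    simp only [g, Nat.sub_sub_self him.le]
  have hfiedler : IsEquivalent (y • ((v.map (m - ·)).map g).prod - blockElem m 0 (- -A m))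
      (blockElem m 0 (-∑ i ∈ Finset.range (m + 1), y ^ i • A (m - i))) := by
    obtain ⟨k, rfl⟩ : ∃ k, m = k + 1 := ⟨m - 1, by omega⟩
    simpa [g] using (isPointedEquivalent_fiedler y (A := fun i => -A (k + 1 - i))
      (nodup_map_sub_of_perm_range hv) (mem_map_sub_of_perm_range hv)).isEquivalent
  exact (hrev ▸ isEquivalent_submatrix_rev _).trans
    (hfiedler.neg.trans (isEquivalent_neg_blockElem_zero _))

theorem exists_admTuple_eq_append (p s : ℕ) : ∃ z₁ z₂ : List ℕ, admTuple p s = z₁ ++ 0 :: z₂ ∧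
    (z₂ ++ z₁).Nodup ∧ ∀ i, i ∈ z₂ ++ z₁ ↔ 0 < i ∧ i ≤ p + 2 * s := by
  obtain ⟨z₁, z₂, hz⟩ := List.append_of_mem (mem_admTuple.2 (Nat.zero_le (p + 2 * s)))
  have hnd := List.nodup_middle.1 (hz ▸ nodup_admTuple p s)
  refine ⟨z₁, z₂, hz, List.nodup_append_comm.1 hnd.of_cons, fun i => ?_⟩
  have hmem : i ∈ 0 :: (z₁ ++ z₂) ↔ i ≤ p + 2 * s := by
    rw [← List.perm_middle.mem_iff, ← hz, mem_admTuple]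
  have h0 : 0 ∉ z₁ ++ z₂ := (List.nodup_cons.1 hnd).1
  rw [← hmem, List.perm_append_comm.mem_iff, List.mem_cons]
  rcases Nat.eq_zero_or_pos i with rfl | hi
  · simp only [h0, lt_irrefl, false_and]
  · simp [hi, hi.ne']

theorem isEquivalent_reversed_blockPencil (y : R) (hm : m = 2 * e + 1 + (p + 2 * s))
    (hA : IsUnit (A m) ∨ p = 0) :
    IsEquivalent (leadBlock m e p s A - y • constBlock m e p s A)
      (blockElem m 0 (∑ i ∈ Finset.range (m + 1), y ^ i • A (m - i))) := by
  obtain ⟨z₁, z₂, hz, hnd, hmem⟩ := exists_admTuple_eq_append p s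
  have hlt : ∀ i ∈ z₂ ++ z₁, 0 < i ∧ i < m := fun i hi => by
    have := (hmem i).1 hi
    omega
  have hlt₁ : ∀ i ∈ z₁, 0 < i ∧ i < m := fun i hi => hlt i (List.mem_append_right _ hi)
  have hlt₂ : ∀ i ∈ z₂, 0 < i ∧ i < m := fun i hi => hlt i (List.mem_append_left _ hi)
  have hperm : (mirror m z₁ ++ (admTuple 0 e ++ mirror m z₂)).Perm (List.range m) := by
    have h := mirror_append_perm_range hnd (nodup_admTuple 0 e) hmem (fun _ => mem_admTuple)
      (by omega : m = p + 2 * s + (0 + 2 * e) + 1)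
    have hmirror : mirror m (z₂ ++ z₁) = mirror m z₁ ++ mirror m z₂ := by simp [mirror]
    rw [hmirror, List.append_assoc] at h
    exact (List.perm_append_comm.append_left _).trans h
  have hunit₁ : IsUnit (z₁.map (highFactor m A)).prod :=
    ⟨⟨_, _, prod_highFactor_mul_mirror A hlt₁, prod_lowFactor_mirror_mul A hlt₁⟩, rfl⟩
  have hunit₂ : IsUnit (z₂.map (highFactor m A)).prod :=
    ⟨⟨_, _, prod_highFactor_mul_mirror A hlt₂, prod_lowFactor_mirror_mul A hlt₂⟩, rfl⟩
  have hfactor : leadBlock m e p s A - y • constBlock m e p s A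
      = (z₁.map (highFactor m A)).prod * (highFactor m A 0 -
          y • ((mirror m z₁ ++ (admTuple 0 e ++ mirror m z₂)).map (lowFactor m A)).prod) *
        ((z₂.map (highFactor m A)).prod * (((admCompl 0 e).map (lowFactor m A)).prod *
          ((admCompl p s).map (highFactor m A)).prod)) := by
    have hcancel₁ (X : Matrix (Fin m) (Fin m) S) : (z₁.map (highFactor m A)).prod *
        (((mirror m z₁).map (lowFactor m A)).prod * X) = X := by
      rw [← mul_assoc, prod_highFactor_mul_mirror A hlt₁, one_mul]
    have hcancel₂ (X : Matrix (Fin m) (Fin m) S) : ((mirror m z₂).map (lowFactor m A)).prod *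
        ((z₂.map (highFactor m A)).prod * X) = X := by
      rw [← mul_assoc, prod_lowFactor_mirror_mul A hlt₂, one_mul]
    simp [leadBlock, constBlock, hz, mul_sub, sub_mul, mul_assoc, hcancel₁, hcancel₂]
  rw [hfactor]
  exact (isEquivalent_of_mul_mul hunit₁ (hunit₂.mul (isUnit_prod_compl A hm hA))).trans
    (isEquivalent_reversed_lowFactor_pencil A y (by omega) hperm)

end BlockPencil

/-! ### Proper rational functions -/

theorem eventually_eval_denom_ne_zero (f : RatFunc ℂ) :
    ∀ᶠ z : ℂ in Bornology.cobounded ℂ, f.denom.eval₂ (RingHom.id ℂ) z ≠ 0 := by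
  have h : (f.denom.rootSet ℂ)ᶜ ∈ Filter.cofinite (α := ℂ) :=
    (Polynomial.rootSet_finite f.denom ℂ).compl_mem_cofinite
  filter_upwards [Bornology.le_cofinite ℂ h] with z hz h0
  refine hz ((Polynomial.mem_rootSet_of_ne f.denom_ne_zero).2 ?_)
  rwa [Polynomial.aeval_def]

theorem eventually_eval_add (f g : RatFunc ℂ) : ∀ᶠ z : ℂ in Bornology.cobounded ℂ,
    (f + g).eval (RingHom.id ℂ) z = f.eval (RingHom.id ℂ) z + g.eval (RingHom.id ℂ) z := by
  filter_upwards [eventually_eval_denom_ne_zero f, eventually_eval_denom_ne_zero g] with z hf hg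
  exact RatFunc.eval_add _ _ hf hg

theorem eventually_eval_mul (f g : RatFunc ℂ) : ∀ᶠ z : ℂ in Bornology.cobounded ℂ,
    (f * g).eval (RingHom.id ℂ) z = f.eval (RingHom.id ℂ) z * g.eval (RingHom.id ℂ) z := by
  filter_upwards [eventually_eval_denom_ne_zero f, eventually_eval_denom_ne_zero g] with z hf hg
  exact RatFunc.eval_mul _ _ hf hg

/-- Convergence `f(z) → d` as `z → ∞`. -/
def HasLimitAtInfty (f : RatFunc ℂ) (d : ℂ) : Prop :=
  Tendsto (fun z : ℂ => f.eval (RingHom.id ℂ) z) (Bornology.cobounded ℂ) (𝓝 d)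

theorem HasLimitAtInfty.add {f g : RatFunc ℂ} {c d : ℂ} (hf : HasLimitAtInfty f c)
    (hg : HasLimitAtInfty g d) : HasLimitAtInfty (f + g) (c + d) :=
  (Tendsto.add hf hg).congr' ((eventually_eval_add f g).mono fun _ h => h.symm)

theorem HasLimitAtInfty.mul {f g : RatFunc ℂ} {c d : ℂ} (hf : HasLimitAtInfty f c)
    (hg : HasLimitAtInfty g d) : HasLimitAtInfty (f * g) (c * d) :=
  (Tendsto.mul hf hg).congr' ((eventually_eval_mul f g).mono fun _ h => h.symm)

theorem hasLimitAtInfty_C (c : ℂ) : HasLimitAtInfty (RatFunc.C c) c := by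
  simp [HasLimitAtInfty]

theorem HasLimitAtInfty.inv {f : RatFunc ℂ} {c : ℂ} (hf : HasLimitAtInfty f c) (hc : c ≠ 0) :
    HasLimitAtInfty f⁻¹ c⁻¹ := by
  have hf0 : f ≠ 0 := by
    rintro rfl
    refine hc (tendsto_nhds_unique hf ?_)
    simp
  refine (Tendsto.inv₀ hf hc).congr' ?_
  filter_upwards [eventually_eval_mul f f⁻¹] with z hz
  rw [mul_inv_cancel₀ hf0, RatFunc.eval_one] at hz
  exact inv_eq_of_mul_eq_one_right hz.symm

theorem hasLimitAtInfty_X_inv : HasLimitAtInfty (RatFunc.X : RatFunc ℂ)⁻¹ 0 := by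
  refine (Filter.tendsto_inv₀_cobounded (α := ℂ)).congr' ?_
  filter_upwards [eventually_eval_mul (RatFunc.X : RatFunc ℂ) RatFunc.X⁻¹] with z hz
  rw [mul_inv_cancel₀ RatFunc.X_ne_zero, RatFunc.eval_one, RatFunc.eval_X] at hz
  exact (eq_inv_of_mul_eq_one_right hz.symm).symm

/-- The ring of proper rational functions, those with a finite limit at infinity. -/
def properRing : Subring (RatFunc ℂ) where
  carrier := {f | ∃ d, HasLimitAtInfty f d}
  mul_mem' := fun ⟨_, hf⟩ ⟨_, hg⟩ => ⟨_, hf.mul hg⟩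
  one_mem' := ⟨1, by simpa using hasLimitAtInfty_C 1⟩
  add_mem' := fun ⟨_, hf⟩ ⟨_, hg⟩ => ⟨_, hf.add hg⟩
  zero_mem' := ⟨0, by simpa using hasLimitAtInfty_C 0⟩
  neg_mem' := fun {f} ⟨_, hf⟩ => ⟨_, by simpa using (hasLimitAtInfty_C (-1)).mul hf⟩

/-- The value at infinity of a proper rational function. -/
def valueAtInfty : properRing →+* ℂ where
  toFun f := f.2.choose
  map_one' := tendsto_nhds_unique (1 : properRing).2.choose_spec
    (by simpa using hasLimitAtInfty_C 1 : HasLimitAtInfty 1 1)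
  map_mul' f g := tendsto_nhds_unique (f * g).2.choose_spec
    (f.2.choose_spec.mul g.2.choose_spec)
  map_zero' := tendsto_nhds_unique (0 : properRing).2.choose_spec
    (by simpa using hasLimitAtInfty_C 0 : HasLimitAtInfty 0 0)
  map_add' f g := tendsto_nhds_unique (f + g).2.choose_spec
    (f.2.choose_spec.add g.2.choose_spec)

theorem hasLimitAtInfty_valueAtInfty (f : properRing) : HasLimitAtInfty f (valueAtInfty f) :=
  f.2.choose_spec

theorem valueAtInfty_eq {f : properRing} {d : ℂ} (h : HasLimitAtInfty f d) : valueAtInfty f = d :=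
  tendsto_nhds_unique (hasLimitAtInfty_valueAtInfty f) h

theorem isUnit_of_valueAtInfty_ne_zero {f : properRing} (h : valueAtInfty f ≠ 0) : IsUnit f := by
  have hf := hasLimitAtInfty_valueAtInfty f
  have hf0 : (f : RatFunc ℂ) ≠ 0 := by
    intro h0
    obtain rfl : f = 0 := Subtype.ext h0
    exact h (map_zero _)
  refine IsUnit.of_mul_eq_one ⟨(f : RatFunc ℂ)⁻¹, _, hf.inv h⟩ (Subtype.ext ?_)
  exact mul_inv_cancel₀ hf0

theorem isBiproper_of_isUnit {ι : Type} [Fintype ι] [DecidableEq ι] {M : Matrix ι ι properRing}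
    (h : IsUnit M) : IsBiproper (M.map properRing.subtype) := by
  refine ⟨M.map valueAtInfty, ?_, fun i j => hasLimitAtInfty_valueAtInfty (M i j)⟩
  rw [← RingHom.mapMatrix_apply, ← RingHom.map_det]
  exact ((Matrix.isUnit_iff_isUnit_det _).1 h).map valueAtInfty

/-- Constants, as proper rational functions. -/
def properConst : ℂ →+* properRing :=
  (RatFunc.C : ℂ →+* RatFunc ℂ).codRestrict properRing fun c => ⟨c, hasLimitAtInfty_C c⟩

/-- `λ⁻¹`, as a proper rational function. -/
def properInv : properRing := ⟨RatFunc.X⁻¹, 0, hasLimitAtInfty_X_inv⟩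

theorem toRat_toPoly {ι κ : Type} (M : Matrix ι κ ℂ) :
    toRat (toPoly M) = (M.map properConst).map properRing.subtype := by
  ext i j
  simp only [toRat, toPoly, Matrix.map_apply, RatFunc.algebraMap_C]
  rfl

theorem isUnit_det_one_sub_properInv_smul {σ : Type} [Fintype σ] [DecidableEq σ]
    (A : Matrix σ σ ℂ) : IsUnit (1 - properInv • A.map properConst).det := by
  have hv : valueAtInfty properInv = 0 := valueAtInfty_eq hasLimitAtInfty_X_inv
  have hone : valueAtInfty.mapMatrix (1 - properInv • A.map properConst) = 1 := by
    ext i j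
    simp [hv, Matrix.one_apply, apply_ite valueAtInfty]
  refine isUnit_of_valueAtInfty_ne_zero ?_
  rw [RingHom.map_det, hone, Matrix.det_one]
  exact one_ne_zero

theorem toRat_X_smul_one_sub_eq {σ : Type} [DecidableEq σ] (A : Matrix σ σ ℂ) :
    toRat ((Polynomial.X : ℂ[X]) • toPoly 1 - toPoly A)
      = (RatFunc.X : RatFunc ℂ) • (1 - properInv • A.map properConst).map properRing.subtype := by
  have hX : (RatFunc.X : RatFunc ℂ) * RatFunc.X⁻¹ = 1 := mul_inv_cancel₀ RatFunc.X_ne_zero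
  ext i j
  simp only [toRat, toPoly, Matrix.map_apply, Matrix.sub_apply, Matrix.smul_apply,
    smul_eq_mul, map_sub, map_mul, RatFunc.algebraMap_X, RatFunc.algebraMap_C, mul_sub]
  congr 1
  · rcases eq_or_ne i j with rfl | hij
    · simp [Matrix.one_apply_eq]
    · simp [Matrix.one_apply_ne hij]
  · simp only [properInv, properConst, Subring.subtype_apply]
    rw [← mul_assoc, hX, one_mul]
    rfl

theorem exists_proper_resolvent {σ : Type} [Fintype σ] [DecidableEq σ] (A : Matrix σ σ ℂ) :
    ∃ N : Matrix σ σ properRing,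
      (toRat ((Polynomial.X : ℂ[X]) • toPoly 1 - toPoly A))⁻¹ = N.map properRing.subtype := by
  set M : Matrix σ σ properRing := 1 - properInv • A.map properConst with hM
  refine ⟨properInv • M⁻¹, Matrix.inv_eq_right_inv ?_⟩
  have hinv : (properInv • M⁻¹).map properRing.subtype
      = (RatFunc.X : RatFunc ℂ)⁻¹ • M⁻¹.map properRing.subtype := by
    ext i j
    simp [properInv]
  rw [toRat_X_smul_one_sub_eq, ← hM, hinv, Matrix.smul_mul, Matrix.mul_smul, smul_smul,
    mul_inv_cancel₀ RatFunc.X_ne_zero, one_smul, ← Matrix.map_mul,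
    Matrix.mul_nonsing_inv _ (isUnit_det_one_sub_properInv_smul A)]
  simp

theorem exists_proper_transfer {ι κ σ : Type} [Fintype σ] [DecidableEq σ] (C : Matrix ι σ ℂ)
    (A : Matrix σ σ ℂ) (B : Matrix σ κ ℂ) : ∃ N : Matrix ι κ properRing,
      toRat (toPoly C) * (toRat ((Polynomial.X : ℂ[X]) • toPoly 1 - toPoly A))⁻¹
        * toRat (toPoly B) = N.map properRing.subtype := by
  obtain ⟨N, hN⟩ := exists_proper_resolvent A
  refine ⟨C.map properConst * N * B.map properConst, ?_⟩
  rw [hN, toRat_toPoly, toRat_toPoly, Matrix.map_mul, Matrix.map_mul]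

/-! ### From block form to matrices over the base ring -/

section Comp

variable {R : Type} [CommRing R] {m n : ℕ}

theorem comp_mul (M N : Matrix (Fin m) (Fin m) (Matrix (Fin n) (Fin n) R)) :
    Matrix.comp _ _ _ _ R (M * N) = Matrix.comp _ _ _ _ R M * Matrix.comp _ _ _ _ R N :=
  map_mul (Matrix.compRingEquiv (Fin m) (Fin n) R) M N

theorem isUnit_comp {M : Matrix (Fin m) (Fin m) (Matrix (Fin n) (Fin n) R)} (h : IsUnit M) :
    IsUnit (Matrix.comp _ _ _ _ R M) := h.map (Matrix.compRingEquiv (Fin m) (Fin n) R)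

theorem comp_list_prod {ι : Type} (g : ι → Matrix (Fin m) (Fin m) (Matrix (Fin n) (Fin n) R))
    (t : List ι) : Matrix.comp _ _ _ _ R (t.map g).prod
      = (t.map fun i => Matrix.comp _ _ _ _ R (g i)).prod := by
  have h := map_list_prod (Matrix.compRingEquiv (Fin m) (Fin n) R) (t.map g)
  rwa [List.map_map] at h

theorem idDiag_eq_comp (X : Matrix (Fin n) (Fin n) R) :
    idDiag m X = Matrix.comp _ _ _ _ R (blockElem m 0 X) := by
  rw [idDiag, blockElem, if_pos rfl]

theorem comp_mul_colBlock {σ : Type} {U : Matrix (Fin m) (Fin m) (Matrix (Fin n) (Fin n) R)}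
    {a b : ℕ} (ha : a < m) (hU : U *ᵥ basisVec m _ a = basisVec m _ b) (X : Matrix (Fin n) σ R) :
    Matrix.comp _ _ _ _ R U * colBlock m (a + 1) X = colBlock m (b + 1) X := by
  rw [mulVec_basisVec ha] at hU
  ext ⟨i, α⟩ j
  have hi := congrFun hU i
  simp only [Matrix.mul_apply, Fintype.sum_prod_type, colBlock, Matrix.of_apply, Matrix.comp_apply,
    Nat.add_right_cancel_iff]
  rw [Finset.sum_eq_single ⟨a, ha⟩]
  · simp only [if_true, hi, basisVec]
    split_ifs <;> simp [Matrix.one_apply]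
  · exact fun c _ hc => Finset.sum_eq_zero fun x _ => by
      rw [if_neg fun h => hc (Fin.ext h), mul_zero]
  · simp

theorem rowBlock_mul_comp {σ : Type} {V : Matrix (Fin m) (Fin m) (Matrix (Fin n) (Fin n) R)}
    {a b : ℕ} (ha : a < m) (hV : basisVec m _ a ᵥ* V = basisVec m _ b) (X : Matrix σ (Fin n) R) :
    rowBlock m (a + 1) X * Matrix.comp _ _ _ _ R V = rowBlock m (b + 1) X := by
  rw [basisVec_vecMul ha] at hV
  ext j ⟨i, α⟩
  have hi := congrFun hV i
  simp only [Matrix.mul_apply, Fintype.sum_prod_type, rowBlock, Matrix.of_apply, Matrix.comp_apply,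
    Nat.add_right_cancel_iff]
  rw [Finset.sum_eq_single ⟨a, ha⟩]
  · simp only [if_true, hi, basisVec]
    split_ifs <;> simp [Matrix.one_apply]
  · exact fun c _ hc => Finset.sum_eq_zero fun x _ => by
      rw [if_neg fun h => hc (Fin.ext h), zero_mul]
  · simp

end Comp

theorem fiedlerMat_natCast (m : ℕ) {n : ℕ} (P : Matrix (Fin n) (Fin n) ℂ[X]) (i : ℕ) :
    fiedlerMat m P (i : ℤ) = Matrix.comp _ _ _ _ ℂ (lowFactor m (coeffMat P) i) := by
  rw [fiedlerMat, if_pos (by omega), elemMat_eq_comp, lowFactor, Int.natAbs_natCast]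

theorem fiedlerMat_sub (m : ℕ) {n : ℕ} (P : Matrix (Fin n) (Fin n) ℂ[X]) {j : ℕ} (hj : j < m) :
    fiedlerMat m P ((j : ℤ) - (m : ℤ)) = Matrix.comp _ _ _ _ ℂ (highFactor m (coeffMat P) j) := by
  have h : (j : ℤ) - (m : ℤ) = -((m - j : ℕ) : ℤ) := by omega
  rw [fiedlerMat, if_neg (by omega), elemMat_eq_comp, highFactor, h, Int.natAbs_neg,
    Int.natAbs_natCast]

theorem fiedlerProd_natCast (m : ℕ) {n : ℕ} (P : Matrix (Fin n) (Fin n) ℂ[X]) (t : List ℕ) :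
    fiedlerProd m P (t.map fun i : ℕ => (i : ℤ))
      = Matrix.comp _ _ _ _ ℂ (t.map (lowFactor m (coeffMat P))).prod := by
  rw [fiedlerProd, comp_list_prod, List.map_map]
  exact congrArg List.prod (List.map_congr_left fun i _ => fiedlerMat_natCast m P i)

theorem fiedlerProd_sub (m : ℕ) {n : ℕ} (P : Matrix (Fin n) (Fin n) ℂ[X]) (t : List ℕ)
    (ht : ∀ j ∈ t, j < m) :
    fiedlerProd m P ((t.map fun i : ℕ => (i : ℤ)).map fun i => i - (m : ℤ))
      = Matrix.comp _ _ _ _ ℂ (t.map (highFactor m (coeffMat P))).prod := by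
  rw [fiedlerProd, comp_list_prod, List.map_map, List.map_map]
  exact congrArg List.prod (List.map_congr_left fun i hi => fiedlerMat_sub m P (ht i hi))

theorem toPoly_mul {ι κ τ : Type} [Fintype κ] (M : Matrix ι κ ℂ) (N : Matrix κ τ ℂ) :
    toPoly (M * N) = toPoly M * toPoly N := Matrix.map_mul

theorem toRat_mul {ι κ τ : Type} [Fintype κ] (M : Matrix ι κ ℂ[X]) (N : Matrix κ τ ℂ[X]) :
    toRat (M * N) = toRat M * toRat N := Matrix.map_mul

theorem toPoly_one {ι : Type} [DecidableEq ι] : toPoly (1 : Matrix ι ι ℂ) = 1 := by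
  simp [toPoly]

theorem toRat_add {ι κ : Type} (M N : Matrix ι κ ℂ[X]) : toRat (M + N) = toRat M + toRat N := by
  ext; simp [toRat]

theorem toRat_sub {ι κ : Type} (M N : Matrix ι κ ℂ[X]) : toRat (M - N) = toRat M - toRat N := by
  ext; simp [toRat]

theorem toRat_X_smul {ι κ : Type} (M : Matrix ι κ ℂ[X]) :
    toRat ((Polynomial.X : ℂ[X]) • M) = (RatFunc.X : RatFunc ℂ) • toRat M := by
  ext; simp [toRat, RatFunc.algebraMap_X]

theorem pencilL_eq {m e p s n : ℕ} (hm : m = 2 * e + 1 + (p + 2 * s))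
    (P : Matrix (Fin n) (Fin n) ℂ[X]) :
    pencilL m (2 * e) p P
      = (Polynomial.X : ℂ[X]) • toPoly (Matrix.comp _ _ _ _ ℂ (leadBlock m e p s (coeffMat P)))
        - toPoly (Matrix.comp _ _ _ _ ℂ (constBlock m e p s (coeffMat P))) := by
  have hsub : m - 2 * e - 1 = p + 2 * s := by omega
  have hmod : 2 * e % 2 = 0 := by omega
  have hw := admissibleTuple_eq 0 e
  have hcw := symmComplement_eq 0 e
  rw [Nat.zero_add] at hw hcw
  rw [pencilL, tupleZ, tupleW, tupleCW, tupleCZ, hsub, hmod, hw, hcw, admissibleTuple_eq,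
    symmComplement_eq, fiedlerProd_natCast, fiedlerProd_natCast, fiedlerProd_sub, fiedlerProd_sub,
    sub_mul, sub_mul, Matrix.smul_mul, Matrix.smul_mul, leadBlock, constBlock]
  · simp only [comp_mul, toPoly_mul]
  · exact fun j hj => by have := lt_of_mem_admCompl hj; omega
  · exact fun j hj => by have := mem_admTuple.1 hj; omega

theorem sum_coeffMat {n m : ℕ} (P : Matrix (Fin n) (Fin n) ℂ[X])
    (hP : ∀ k, m < k → coeffMat P k = 0) :
    ∑ i ∈ Finset.range (m + 1), (Polynomial.X : ℂ[X]) ^ i • toPoly (coeffMat P i) = P := by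
  refine Matrix.ext fun i j => ?_
  have hdeg : (P i j).natDegree < m + 1 := by
    rw [Nat.lt_succ_iff, Polynomial.natDegree_le_iff_coeff_eq_zero]
    exact fun N hN => congrFun₂ (hP N hN) i j
  conv_rhs => rw [(P i j).as_sum_range' (m + 1) hdeg]
  rw [Matrix.sum_apply]
  refine Finset.sum_congr rfl fun k _ => ?_
  rw [Matrix.smul_apply, smul_eq_mul, toPoly, Matrix.map_apply, coeffMat, Matrix.map_apply,
    ← Polynomial.C_mul_X_pow_eq_monomial, mul_comm]

theorem toPoly_comp {m n : ℕ} (M : Matrix (Fin m) (Fin m) (Matrix (Fin n) (Fin n) ℂ)) :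
    toPoly (Matrix.comp _ _ _ _ ℂ M)
      = Matrix.comp _ _ _ _ ℂ[X] (M.map (Polynomial.C : ℂ →+* ℂ[X]).mapMatrix) := rfl

theorem blockPos_lt {m e : ℕ} (hm : 2 * e < m) : blockPos m e < m := by
  unfold blockPos
  split_ifs <;> omega

theorem exists_equiv_pencilL {m e p s n : ℕ} (hm : m = 2 * e + 1 + (p + 2 * s))
    (P : Matrix (Fin n) (Fin n) ℂ[X]) (hP : ∀ k, m < k → coeffMat P k = 0)
    (hA : IsUnit (coeffMat P m) ∨ p = 0) :
    ∃ U V : Matrix (Fin m × Fin n) (Fin m × Fin n) ℂ[X], IsUnit U ∧ IsUnit V ∧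
      (∀ {σ : Type} (X : Matrix (Fin n) σ ℂ[X]),
        U * colBlock m (blockPos m e + 1) X = colBlock m m X) ∧
      (∀ {σ : Type} (X : Matrix σ (Fin n) ℂ[X]),
        rowBlock m (blockPos m e + 1) X * V = rowBlock m m X) ∧
      U * pencilL m (2 * e) p P * V = idDiag m P := by
  have hA' : IsUnit (toPoly (coeffMat P m)) ∨ p = 0 :=
    hA.imp_left fun h => h.map (Polynomial.C : ℂ →+* ℂ[X]).mapMatrix
  obtain ⟨U, V, hU, hV, hUpos, hVpos, hUV⟩ := isPointedEquivalent_blockPencil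
    (fun i => toPoly (coeffMat P i)) (Polynomial.X : ℂ[X]) hm hA'
  have hm1 : m - 1 + 1 = m := by omega
  have hpos : blockPos m e < m := blockPos_lt (by omega)
  refine ⟨Matrix.comp _ _ _ _ _ U, Matrix.comp _ _ _ _ _ V, isUnit_comp hU, isUnit_comp hV,
    fun X => ?_, fun X => ?_, ?_⟩
  · have hcol := comp_mul_colBlock hpos hUpos X
    rwa [hm1] at hcol
  · have hrow := rowBlock_mul_comp hpos hVpos X
    rwa [hm1] at hrow
  rw [pencilL_eq hm, toPoly_comp, toPoly_comp, leadBlock_map, constBlock_map]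
  have hcomp := congrArg (Matrix.comp _ _ _ _ ℂ[X]) hUV
  rwa [comp_mul, comp_mul, sum_coeffMat P hP, ← idDiag_eq_comp] at hcomp

theorem isUnimodular_of_isUnit {ι : Type} [Fintype ι] [DecidableEq ι] {U : Matrix ι ι ℂ[X]}
    (h : IsUnit U) : IsUnimodular U := by
  obtain ⟨c, hc, hcU⟩ := Polynomial.isUnit_iff.1 ((Matrix.isUnit_iff_isUnit_det _).1 h)
  exact ⟨c, hc.ne_zero, hcU.symm⟩

/-! ### Minimality and transformations of realizations -/

section Realizations

variable {ι κ σ : Type} [Fintype σ]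

theorem toPoly_add (M N : Matrix ι κ ℂ) : toPoly (M + N) = toPoly M + toPoly N :=
  Matrix.map_add _ (map_add _) M N

theorem X_pow_smul_toPoly_single [DecidableEq ι] [DecidableEq κ] (k : ℕ) (i : ι) (j : κ) (a : ℂ) :
    (Polynomial.X : ℂ[X]) ^ k • toPoly (Matrix.single i j a)
      = Matrix.single i j (Polynomial.monomial k a) := by
  rw [toPoly, Matrix.map_single, Matrix.smul_single, smul_eq_mul, mul_comm,
    Polynomial.C_mul_X_pow_eq_monomial]

variable [DecidableEq σ]

theorem exists_X_pow_smul_toPoly_eq_mul_pencil_add {E : Matrix σ σ ℂ} (hE : IsUnit E.det)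
    (A : Matrix σ σ ℂ) (k : ℕ) (C : Matrix ι σ ℂ) :
    ∃ (Q : Matrix ι σ ℂ[X]) (C₀ : Matrix ι σ ℂ), (Polynomial.X : ℂ[X]) ^ k • toPoly C
      = Q * ((Polynomial.X : ℂ[X]) • toPoly E - toPoly A) + toPoly C₀ := by
  induction k with
  | zero => exact ⟨0, C, by simp⟩
  | succ k ih =>
    obtain ⟨Q, C₀, hQ⟩ := ih
    refine ⟨(Polynomial.X : ℂ[X]) • Q + toPoly (C₀ * E⁻¹), C₀ * E⁻¹ * A, ?_⟩
    have hlinear : (Polynomial.X : ℂ[X]) • toPoly C₀ = toPoly (C₀ * E⁻¹)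
        * ((Polynomial.X : ℂ[X]) • toPoly E - toPoly A) + toPoly (C₀ * E⁻¹ * A) := by
      rw [Matrix.mul_sub, Matrix.mul_smul, ← toPoly_mul, ← toPoly_mul,
        Matrix.nonsing_inv_mul_cancel_right _ _ hE, sub_add_cancel]
    rw [pow_succ', mul_smul, hQ, smul_add, hlinear, Matrix.add_mul, Matrix.smul_mul, add_assoc]

theorem exists_eq_mul_pencil_add [Finite ι] {E : Matrix σ σ ℂ} (hE : IsUnit E.det)
    (A : Matrix σ σ ℂ) (M : Matrix ι σ ℂ[X]) :
    ∃ (Q : Matrix ι σ ℂ[X]) (C₀ : Matrix ι σ ℂ),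
      M = Q * ((Polynomial.X : ℂ[X]) • toPoly E - toPoly A) + toPoly C₀ := by
  classical
  have hadd : ∀ M M' : Matrix ι σ ℂ[X],
      (∃ (Q : Matrix ι σ ℂ[X]) (C₀ : Matrix ι σ ℂ),
        M = Q * ((Polynomial.X : ℂ[X]) • toPoly E - toPoly A) + toPoly C₀) →
      (∃ (Q : Matrix ι σ ℂ[X]) (C₀ : Matrix ι σ ℂ),
        M' = Q * ((Polynomial.X : ℂ[X]) • toPoly E - toPoly A) + toPoly C₀) →
      ∃ (Q : Matrix ι σ ℂ[X]) (C₀ : Matrix ι σ ℂ),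
        M + M' = Q * ((Polynomial.X : ℂ[X]) • toPoly E - toPoly A) + toPoly C₀ := by
    rintro _ _ ⟨Q, C, rfl⟩ ⟨Q', C', rfl⟩
    exact ⟨Q + Q', C + C', by rw [toPoly_add, Matrix.add_mul, add_add_add_comm]⟩
  induction M using Matrix.induction_on' with
  | h_zero => exact ⟨0, 0, by ext; simp [toPoly]⟩
  | h_add M M' hM hM' => exact hadd M M' hM hM'
  | h_std_basis i j x =>
    induction x using Polynomial.induction_on' with
    | add x y hx hy =>
      rw [Matrix.single_add]
      exact hadd _ _ hx hy
    | monomial k a =>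
      rw [← X_pow_smul_toPoly_single]
      exact exists_X_pow_smul_toPoly_eq_mul_pencil_add hE A k _

theorem exists_eq_pencil_mul_add [Finite ι] {E : Matrix σ σ ℂ} (hE : IsUnit E.det)
    (A : Matrix σ σ ℂ) (M : Matrix σ ι ℂ[X]) :
    ∃ (Q : Matrix σ ι ℂ[X]) (B₀ : Matrix σ ι ℂ),
      M = ((Polynomial.X : ℂ[X]) • toPoly E - toPoly A) * Q + toPoly B₀ := by
  obtain ⟨Q, C₀, hQ⟩ := exists_eq_mul_pencil_add (E := Eᵀ) (by rwa [Matrix.det_transpose]) Aᵀ Mᵀ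
  refine ⟨Qᵀ, C₀ᵀ, ?_⟩
  have htranspose := congrArg Matrix.transpose hQ
  rwa [Matrix.transpose_transpose, Matrix.transpose_add, Matrix.transpose_mul] at htranspose

theorem charmatrix_eq_X_smul_sub (M : Matrix σ σ ℂ) :
    Matrix.charmatrix M = (Polynomial.X : ℂ[X]) • toPoly 1 - toPoly M := by
  rw [toPoly_one, Matrix.smul_one_eq_diagonal]
  rfl

theorem det_pencil_ne_zero {E : Matrix σ σ ℂ} (hE : IsUnit E.det) (A : Matrix σ σ ℂ) :
    ((Polynomial.X : ℂ[X]) • toPoly E - toPoly A).det ≠ 0 := by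
  have hfactor : (Polynomial.X : ℂ[X]) • toPoly E - toPoly A
      = toPoly E * Matrix.charmatrix (E⁻¹ * A) := by
    rw [charmatrix_eq_X_smul_sub, mul_sub, Matrix.mul_smul, ← toPoly_mul, ← toPoly_mul, mul_one,
      Matrix.mul_nonsing_inv_cancel_left _ _ hE]
  have hdet : (toPoly E).det = Polynomial.C E.det := (RingHom.map_det Polynomial.C E).symm
  rw [hfactor, Matrix.det_mul, hdet]
  exact mul_ne_zero (Polynomial.C_ne_zero.2 hE.ne_zero) (Matrix.charpoly_monic _).ne_zero

theorem isUnit_det_toRat_pencil {E : Matrix σ σ ℂ} (hE : IsUnit E.det) (A : Matrix σ σ ℂ) :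
    IsUnit (toRat ((Polynomial.X : ℂ[X]) • toPoly E - toPoly A)).det := by
  have hdet : (toRat ((Polynomial.X : ℂ[X]) • toPoly E - toPoly A)).det
      = algebraMap ℂ[X] (RatFunc ℂ) ((Polynomial.X : ℂ[X]) • toPoly E - toPoly A).det :=
    (RingHom.map_det (algebraMap ℂ[X] (RatFunc ℂ)) _).symm
  rw [hdet]
  exact (RatFunc.algebraMap_ne_zero (det_pencil_ne_zero hE A)).isUnit

/-- Dividing `L C` and `B K` by the state pencil leaves constant remainders, and the quotients only
change the polynomial part; so the state space keeps its dimension. -/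
theorem exists_realization_mul [Finite ι] [Fintype κ] (S : SystemData κ σ)
    (L : Matrix ι κ ℂ[X]) (K : Matrix κ ι ℂ[X]) :
    ∃ S' : SystemData ι σ, S'.transfer = toRat L * S.transfer * toRat K := by
  obtain ⟨Q, C₀, hC⟩ := exists_eq_mul_pencil_add S.isUnit_det_E S.A (L * toPoly S.C)
  obtain ⟨Q', B₀, hB⟩ := exists_eq_pencil_mul_add S.isUnit_det_E S.A (toPoly S.B * K)
  have hN := isUnit_det_toRat_pencil S.isUnit_det_E S.A
  refine ⟨⟨L * S.P * K + Q * (toPoly S.B * K) + toPoly C₀ * Q', C₀, B₀, S.A, S.E,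
    S.isUnit_det_E⟩, ?_⟩
  replace hC := congrArg toRat hC
  replace hB := congrArg toRat hB
  simp only [SystemData.transfer, toRat_add, toRat_mul] at hC hB ⊢
  set N := toRat ((Polynomial.X : ℂ[X]) • toPoly S.E - toPoly S.A)
  have hstate : toRat L * (toRat (toPoly S.C) * N⁻¹ * toRat (toPoly S.B)) * toRat K
      = toRat Q * (toRat (toPoly S.B) * toRat K) + toRat (toPoly C₀) * toRat Q'
        + toRat (toPoly C₀) * N⁻¹ * toRat (toPoly B₀) := calc
    _ = toRat L * toRat (toPoly S.C) * N⁻¹ * (toRat (toPoly S.B) * toRat K) := by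
      simp only [Matrix.mul_assoc]
    _ = toRat Q * (toRat (toPoly S.B) * toRat K)
        + toRat (toPoly C₀) * N⁻¹ * (toRat (toPoly S.B) * toRat K) := by
      rw [hC, Matrix.add_mul, Matrix.add_mul, Matrix.mul_nonsing_inv_cancel_right _ _ hN]
    _ = _ := by
      rw [add_assoc]
      congr 1
      rw [hB, Matrix.mul_add, Matrix.mul_assoc, Matrix.nonsing_inv_mul_cancel_left _ _ hN]
  rw [Matrix.mul_add, Matrix.add_mul, hstate]
  abel

end Realizations

/-! ### Bordered block matrices -/

section Blocks

variable {σ : Type} {m n : ℕ}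

theorem toRat_idDiag (X : Matrix (Fin n) (Fin n) ℂ[X]) :
    toRat (idDiag m X) = idDiag m (toRat X) := by
  ext ⟨a, α⟩ ⟨b, β⟩
  simp only [toRat, idDiag, Matrix.map_apply, Matrix.comp_apply, Matrix.of_apply]
  split_ifs <;> simp [Matrix.one_apply]

theorem map_colBlock {R R' : Type} [Semiring R] [Semiring R'] (f : R →+* R') (k : ℕ)
    (X : Matrix (Fin n) σ R) : (colBlock m k X).map f = colBlock m k (X.map f) := by
  ext ⟨a, α⟩ j
  simp only [colBlock, Matrix.map_apply, Matrix.of_apply]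
  split_ifs <;> simp

theorem map_rowBlock {R R' : Type} [Semiring R] [Semiring R'] (f : R →+* R') (k : ℕ)
    (X : Matrix σ (Fin n) R) : (rowBlock m k X).map f = rowBlock m k (X.map f) := by
  ext j ⟨a, α⟩
  simp only [rowBlock, Matrix.map_apply, Matrix.of_apply]
  split_ifs <;> simp

variable [Fintype σ]

theorem colBlock_mul {τ R : Type} [Semiring R] (k : ℕ) (X : Matrix (Fin n) σ R) (N : Matrix σ τ R) :
    colBlock m k X * N = colBlock m k (X * N) := by
  ext ⟨a, α⟩ j
  simp only [colBlock, Matrix.mul_apply, Matrix.of_apply]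
  split_ifs <;> simp

theorem colBlock_mul_rowBlock {R : Type} [Semiring R] (k l : ℕ) (X : Matrix (Fin n) σ R)
    (Y : Matrix σ (Fin n) R) :
    colBlock m k X * rowBlock m l Y = Matrix.comp _ _ _ _ R (Matrix.of fun a b : Fin m =>
      if (a : ℕ) + 1 = k ∧ (b : ℕ) + 1 = l then X * Y else 0) := by
  ext ⟨a, α⟩ ⟨b, β⟩
  simp only [colBlock, rowBlock, Matrix.mul_apply, Matrix.of_apply, Matrix.comp_apply, ite_and]
  split_ifs <;> simp [Matrix.mul_apply]

theorem idDiag_add {R : Type} [Semiring R] (P : Matrix (Fin n) (Fin n) R) (X : Matrix (Fin n) σ R)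
    (Y : Matrix σ (Fin n) R) :
    idDiag m P + colBlock m m X * rowBlock m m Y = idDiag m (P + X * Y) := by
  rw [colBlock_mul_rowBlock]
  ext ⟨a, α⟩ ⟨b, β⟩
  simp only [idDiag, Matrix.add_apply, Matrix.comp_apply, Matrix.of_apply]
  rcases eq_or_ne a b with rfl | hab
  · by_cases ha : (a : ℕ) + 1 = m <;> simp [ha]
  · have hlast : ¬ ((a : ℕ) + 1 = m ∧ (b : ℕ) + 1 = m) := fun h => hab (Fin.ext (by omega))
    simp [hab, hlast]

variable [DecidableEq σ]

section Equiv

variable {S : SystemData (Fin n) σ} {T : SystemData (Fin m × Fin n) σ}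
  {U V : Matrix (Fin m × Fin n) (Fin m × Fin n) ℂ[X]}

theorem transfer_of_equiv (hP : U * T.P * V = idDiag m S.P)
    (hC : U * toPoly T.C = colBlock m m (toPoly S.C))
    (hB : toPoly T.B * V = rowBlock m m (toPoly S.B)) (hA : T.A = S.A) (hE : T.E = S.E) :
    toRat U * T.transfer * toRat V = idDiag m S.transfer := by
  replace hP : toRat U * toRat T.P * toRat V = idDiag m (toRat S.P) := by
    rw [← toRat_mul, ← toRat_mul, hP, toRat_idDiag]
  replace hC : toRat U * toRat (toPoly T.C) = colBlock m m (toRat (toPoly S.C)) := by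
    rw [← toRat_mul, hC]
    exact map_colBlock (algebraMap ℂ[X] (RatFunc ℂ)) m _
  replace hB : toRat (toPoly T.B) * toRat V = rowBlock m m (toRat (toPoly S.B)) := by
    rw [← toRat_mul, hB]
    exact map_rowBlock (algebraMap ℂ[X] (RatFunc ℂ)) m _
  rw [SystemData.transfer, SystemData.transfer, ← idDiag_add, hA, hE, Matrix.mul_add,
    Matrix.add_mul, hP, ← hB, ← colBlock_mul, ← hC]
  simp only [Matrix.mul_assoc]

theorem toMatrix_of_equiv (hP : U * T.P * V = idDiag m S.P)
    (hC : U * toPoly T.C = colBlock m m (toPoly S.C))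
    (hB : toPoly T.B * V = rowBlock m m (toPoly S.B)) (hA : T.A = S.A) (hE : T.E = S.E) :
    Matrix.fromBlocks U 0 0 (toPoly 1) * T.toMatrix * Matrix.fromBlocks V 0 0 (toPoly 1)
      = paddedSystem m S := by
  rw [toPoly_one, SystemData.toMatrix, Matrix.fromBlocks_multiply, Matrix.fromBlocks_multiply,
    paddedSystem]
  simp [hP, hC, hB, hA, hE]

theorem isMinimal_of_equiv (hm : 0 < m)
    (hUV : toRat U * T.transfer * toRat V = idDiag m S.transfer) (hS : S.IsMinimal) :
    T.IsMinimal := by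
  intro r T' hT'
  obtain ⟨k, rfl⟩ : ∃ k, m = k + 1 := ⟨m - 1, by omega⟩
  obtain ⟨S', hS'⟩ := exists_realization_mul T' (U.submatrix (fun α => (Fin.last k, α)) id)
    (V.submatrix id fun β => (Fin.last k, β))
  refine hS r S' ?_
  rw [hS', hT']
  ext α β
  have hlast := congrFun₂ hUV (Fin.last k, α) (Fin.last k, β)
  simp only [idDiag, Matrix.comp_apply, Matrix.of_apply, Fin.val_last, if_true] at hlast
  rw [← hlast]
  rfl

end Equiv

end Blocks

/-! ### The position `m - i_0(w)` -/

theorem tupleW_eq (e : ℕ) : tupleW (2 * e) = (admTuple 0 e).map fun i : ℕ => (i : ℤ) := by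
  have htuple := admissibleTuple_eq 0 e
  rw [Nat.zero_add] at htuple
  rw [tupleW, Nat.mul_mod_right, htuple]

theorem one_zero_sublist_admTuple {e : ℕ} (he : 0 < e) : [1, 0].Sublist (admTuple 0 e) := by
  induction e with
  | zero => omega
  | succ e ih =>
    rcases Nat.eq_zero_or_pos e with rfl | he0
    · decide
    · exact ((ih he0).cons _).cons _

theorem not_two_one_sublist_admTuple (e : ℕ) : ¬ [2, 1].Sublist (admTuple 0 e) := by
  induction e with
  | zero => decide
  | succ e ih =>
    rcases Nat.eq_zero_or_pos e with rfl | he0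
    · decide
    · intro h
      rw [admTuple, List.cons_sublist_cons', List.cons_sublist_cons'] at h
      rcases h with (h | h) | h
      · exact ih h
      · omega
      · omega

theorem two_one_sublist_range {k : ℕ} (hk : 2 ≤ k) :
    [2, 1].Sublist (List.range (k + 1)).reverse := by
  induction k, hk using Nat.le_induction with
  | base => decide
  | succ k _ ih =>
    rw [List.range_succ, List.reverse_append]
    exact ih.cons _

theorem range_reverse_sublist_admTuple_iff (e s : ℕ) :
    (List.range (s + 1)).reverse.Sublist (admTuple 0 e) ↔ s ≤ if e = 0 then 0 else 1 := by
  refine ⟨fun h => ?_, fun h => ?_⟩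
  · rcases Nat.lt_or_ge s 2 with hs | hs
    · split_ifs with he
      · subst he
        simpa [admTuple] using h.length_le
      · omega
    · exact absurd ((two_one_sublist_range hs).trans h) (not_two_one_sublist_admTuple e)
  · split_ifs at h with he
    · obtain rfl : s = 0 := by omega
      exact List.singleton_sublist.2 (mem_admTuple.2 (Nat.zero_le _))
    · refine List.Sublist.trans ?_ (one_zero_sublist_admTuple (Nat.pos_of_ne_zero he))
      interval_cases s <;> decide

theorem consecInv_zero_tupleW (e : ℕ) :
    consecInv 0 (tupleW (2 * e)) = if e = 0 then 0 else 1 := by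
  have hcast : ∀ s : ℕ, ((List.range (s + 1)).reverse.map (fun k : ℕ => (0 : ℤ) + (k : ℤ))).Sublist
      ((admTuple 0 e).map fun i : ℕ => (i : ℤ)) ↔ s ≤ if e = 0 then 0 else 1 := fun s => by
    simp only [zero_add]
    rw [← range_reverse_sublist_admTuple_iff]
    refine ⟨fun h => ?_, fun h => h.map _⟩
    obtain ⟨l, hl, hmap⟩ := List.sublist_map_iff.1 h
    rwa [List.map_injective_iff.2 Nat.cast_injective hmap]
  have hmem : (0 : ℤ) ∈ (admTuple 0 e).map fun i : ℕ => (i : ℤ) :=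
    List.mem_map.2 ⟨0, mem_admTuple.2 (Nat.zero_le _), rfl⟩
  rw [tupleW_eq, consecInv, if_pos hmem]
  simp only [hcast]
  have hlength : (if e = 0 then 0 else 1)
      ≤ ((admTuple 0 e).map fun i : ℕ => (i : ℤ)).length := by
    have hpos := List.length_pos_of_mem hmem
    split_ifs <;> omega
  refine (congrArg ((↑) : ℕ → ℤ) (Nat.findGreatest_eq_iff
    (P := fun s => s ≤ if e = 0 then 0 else 1).2
      ⟨hlength, fun _ => le_rfl, fun s hs _ h => hs.not_ge h⟩)).trans ?_
  split_ifs <;> rfl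

theorem position_eq {m e : ℕ} (hm : 2 * e < m) : position m (2 * e) = blockPos m e + 1 := by
  rw [position, consecInv_zero_tupleW, blockPos]
  split_ifs <;> omega

section ConstantTerm

variable {S : Type*} [Ring S] {m : ℕ}

theorem map_lowFactor_update_zero {t : List ℕ} (ht : ∀ j ∈ t, 0 < j) (A : ℕ → S) (Y : S) :
    t.map (lowFactor m (Function.update A 0 Y)) = t.map (lowFactor m A) :=
  List.map_congr_left fun j hj => by rw [lowFactor, Function.update_of_ne (ht j hj).ne', lowFactor]

theorem map_highFactor_update_zero {t : List ℕ} (ht : ∀ j ∈ t, j < m) (A : ℕ → S) (Y : S) :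
    t.map (highFactor m (Function.update A 0 Y)) = t.map (highFactor m A) :=
  List.map_congr_left fun j hj => by
    rw [highFactor, Function.update_of_ne (Nat.sub_pos_of_lt (ht j hj)).ne', highFactor]

theorem lowFactor_update_zero (hm : 0 < m) (A : ℕ → S) (Y : S) :
    lowFactor m (Function.update A 0 (A 0 + Y)) 0 = lowFactor m A 0
      - Matrix.vecMulVec (basisVec m S (m - 1)) (Y • basisVec m S (m - 1)) := by
  rw [lowFactor, Function.update_self, lowFactor]
  ext a b
  simp only [Nat.cast_zero, Matrix.sub_apply, blockElem_zero_apply, Matrix.vecMulVec_apply,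
    basisVec, Pi.smul_apply, smul_eq_mul]
  grind

variable {e p s : ℕ}

theorem leadBlock_update_zero (hm : m = 2 * e + 1 + (p + 2 * s)) (A : ℕ → S) (Y : S) :
    leadBlock m e p s (Function.update A 0 Y) = leadBlock m e p s A := by
  rw [leadBlock, leadBlock, map_lowFactor_update_zero fun j => pos_of_mem_admCompl_zero,
    map_highFactor_update_zero, map_highFactor_update_zero]
  · intro j hj
    have := lt_of_mem_admCompl hj
    omega
  · intro j hj
    have := mem_admTuple.1 hj
    omega

theorem constBlock_update_zero (hm : m = 2 * e + 1 + (p + 2 * s)) (A : ℕ → S) (Y : S) :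
    constBlock m e p s (Function.update A 0 (A 0 + Y)) = constBlock m e p s A
      - Matrix.vecMulVec (basisVec m S (blockPos m e)) (Y • basisVec m S (blockPos m e)) := by
  have hhigh : ∀ j ∈ admCompl p s, j < m := fun j hj => by
    have := lt_of_mem_admCompl hj
    omega
  have hcol := prod_pairTuple_mulVec A (m := m) (e := e) (by omega)
  have hrow := vecMul_prod_compl A hm
  rw [constBlock, constBlock, map_highFactor_update_zero hhigh,
    map_lowFactor_update_zero (t := admCompl 0 e) fun j => pos_of_mem_admCompl_zero,
    admTuple_zero_eq, List.map_append, List.map_append, List.prod_append, List.prod_append,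
    map_lowFactor_update_zero (t := pairTuple e) fun j hj => (mem_pairTuple.1 hj).1]
  simp only [List.map_cons, List.map_nil, List.prod_singleton, mul_assoc]
  rw [lowFactor_update_zero (by omega), sub_mul, mul_sub, Matrix.vecMulVec_mul,
    Matrix.mul_vecMulVec, Matrix.smul_vecMul, hcol, hrow]

end ConstantTerm

/-! ### The bordered pencil -/

section Bordered

variable {m e p s n ℓ : ℕ}

/-- The signed quasi-identity matrix `s Q`, where `s` is the `(m - i_0(w))`-th parameter of `Q`; its
block at that position is therefore `I`. -/
def signMat (m h : ℕ) (n : ℕ) (ε : Fin m → ℤˣ) : Matrix (Fin m × Fin n) (Fin m × Fin n) ℂ :=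
  parameter ε (position m h) • quasiIdentity n ε

theorem unit_cast_mul_self (u : ℤˣ) : ((u : ℤ) : ℂ) * ((u : ℤ) : ℂ) = 1 := by
  rcases Int.units_eq_one_or u with rfl | rfl <;> simp

theorem parameter_position (hm : 2 * e < m) (ε : Fin m → ℤˣ) :
    parameter ε (position m (2 * e)) = (((ε ⟨blockPos m e, blockPos_lt hm⟩ : ℤˣ) : ℤ) : ℂ) := by
  rw [position_eq hm, parameter, dif_pos (by rw [Nat.add_sub_cancel]; exact blockPos_lt hm)]
  rfl

theorem signMat_eq (hm : 2 * e < m) (ε : Fin m → ℤˣ) : signMat m (2 * e) n ε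
    = Matrix.diagonal fun a => (((ε ⟨blockPos m e, blockPos_lt hm⟩ : ℤˣ) : ℤ) : ℂ)
      * (((ε a.1 : ℤˣ) : ℤ) : ℂ) := by
  rw [signMat, parameter_position hm, quasiIdentity, ← Matrix.diagonal_smul]
  rfl

theorem signMat_mul_self (hm : 2 * e < m) (ε : Fin m → ℤˣ) :
    signMat m (2 * e) n ε * signMat m (2 * e) n ε = 1 := by
  rw [signMat_eq hm, Matrix.diagonal_mul_diagonal, ← Matrix.diagonal_one]
  congr 1
  ext a
  rw [mul_mul_mul_comm, unit_cast_mul_self, unit_cast_mul_self, one_mul]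

theorem isUnit_signMat (hm : 2 * e < m) (ε : Fin m → ℤˣ) : IsUnit (signMat m (2 * e) n ε) :=
  IsUnit.of_mul_eq_one _ (signMat_mul_self hm ε)

theorem signMat_mul_colBlock (hm : 2 * e < m) (ε : Fin m → ℤˣ) {R σ : Type} [CommRing R]
    (f : ℂ →+* R) (X : Matrix (Fin n) σ R) :
    (signMat m (2 * e) n ε).map f * colBlock m (blockPos m e + 1) X
      = colBlock m (blockPos m e + 1) X := by
  rw [signMat_eq hm, Matrix.diagonal_map (map_zero f)]
  ext ⟨a, α⟩ j
  simp only [Matrix.diagonal_mul, colBlock, Matrix.of_apply]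
  split_ifs with ha
  · obtain rfl : a = ⟨blockPos m e, blockPos_lt hm⟩ := Fin.ext (Nat.succ_injective ha)
    rw [unit_cast_mul_self, map_one, one_mul]
  · rw [mul_zero]

theorem eq_transpose_mul_J {ι : Type} {B : Matrix (Fin ℓ ⊕ Fin ℓ) ι ℂ}
    {C : Matrix ι (Fin ℓ ⊕ Fin ℓ) ℂ} (h : J ℓ * B = Cᵀ) : Bᵀ * (J ℓ)ᵀ = C := by
  rw [← Matrix.transpose_mul, h, Matrix.transpose_transpose]

theorem borderedPencil_C (hm : 2 * e < m) (ε : Fin m → ℤˣ)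
    {S : SystemData (Fin n) (Fin ℓ ⊕ Fin ℓ)} (hJ : J ℓ * S.B = S.Cᵀ) :
    (borderedPencil m (2 * e) p ε S).C = colBlock m (blockPos m e + 1) S.C := by
  rw [borderedPencil, eq_transpose_mul_J hJ, position_eq hm]

theorem borderedPencil_B (hm : 2 * e < m) (ε : Fin m → ℤˣ)
    (S : SystemData (Fin n) (Fin ℓ ⊕ Fin ℓ)) :
    (borderedPencil m (2 * e) p ε S).B = rowBlock m (blockPos m e + 1) S.B := by
  rw [borderedPencil, position_eq hm]

theorem borderedPencil_P (ε : Fin m → ℤˣ) (S : SystemData (Fin n) (Fin ℓ ⊕ Fin ℓ)) :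
    (borderedPencil m (2 * e) p ε S).P
      = toPoly (signMat m (2 * e) n ε) * pencilL m (2 * e) p S.P := rfl

theorem exists_borderedPencil_P_eq (hm : m = 2 * e + 1 + (p + 2 * s)) (ε : Fin m → ℤˣ)
    (S : SystemData (Fin n) (Fin ℓ ⊕ Fin ℓ)) :
    ∃ M N : Matrix (Fin m × Fin n) (Fin m × Fin n) ℂ, (borderedPencil m (2 * e) p ε S).P
      = toPoly M - (Polynomial.X : ℂ[X]) • toPoly N := by
  have hneg (M : Matrix (Fin m × Fin n) (Fin m × Fin n) ℂ) : toPoly (-M) = -toPoly M :=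
    Matrix.map_neg _ (map_neg _) M
  refine ⟨-(signMat m (2 * e) n ε * Matrix.comp _ _ _ _ ℂ (constBlock m e p s (coeffMat S.P))),
    -(signMat m (2 * e) n ε * Matrix.comp _ _ _ _ ℂ (leadBlock m e p s (coeffMat S.P))), ?_⟩
  rw [borderedPencil_P, pencilL_eq hm, mul_sub, Matrix.mul_smul, hneg, hneg, toPoly_mul,
    toPoly_mul, smul_neg, sub_neg_eq_add, neg_add_eq_sub]

section TransferCoeff

variable {σ : Type} [Fintype σ] [DecidableEq σ]

/-- The coefficients `G_i` of `G = ∑ λ^i G_i`, where `G_i = A_i` for `i > 0` and the strictly proper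
part of `G` is absorbed into `G_0`. The pencil of the transfer function is built from the `G_i` as
`L` is built from the `A_i`. -/
def transferCoeff (S : SystemData (Fin n) σ) : ℕ → Matrix (Fin n) (Fin n) (RatFunc ℂ) :=
  Function.update (fun i => toRat (toPoly (coeffMat S.P i))) 0
    (toRat (toPoly (coeffMat S.P 0)) + toRat (toPoly S.C)
      * (toRat ((Polynomial.X : ℂ[X]) • toPoly S.E - toPoly S.A))⁻¹ * toRat (toPoly S.B))

theorem toRat_sum_coeffMat (P : Matrix (Fin n) (Fin n) ℂ[X])
    (hP : ∀ k, m < k → coeffMat P k = 0) :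
    ∑ i ∈ Finset.range (m + 1), (RatFunc.X : RatFunc ℂ) ^ i • toRat (toPoly (coeffMat P i))
      = toRat P := by
  conv_rhs => rw [← sum_coeffMat P hP]
  have hsum := map_sum (algebraMap ℂ[X] (RatFunc ℂ)).mapMatrix
    (fun i => (Polynomial.X : ℂ[X]) ^ i • toPoly (coeffMat P i)) (Finset.range (m + 1))
  refine Eq.trans (Finset.sum_congr rfl fun i _ => ?_) hsum.symm
  ext a b
  simp [toRat, RatFunc.algebraMap_X]

theorem sum_transferCoeff (S : SystemData (Fin n) σ) (hP : ∀ k, m < k → coeffMat S.P k = 0) :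
    ∑ i ∈ Finset.range (m + 1), (RatFunc.X : RatFunc ℂ) ^ i • transferCoeff S i = S.transfer := by
  rw [SystemData.transfer, ← toRat_sum_coeffMat S.P hP, Finset.sum_range_succ',
    Finset.sum_range_succ' _ m, transferCoeff, Function.update_self, pow_zero, one_smul, one_smul,
    add_assoc]
  simp only [Function.update_of_ne (Nat.succ_ne_zero _)]

theorem exists_proper_transferCoeff (S : SystemData (Fin n) σ) (hE : S.E = 1) :
    ∃ Γ : ℕ → Matrix (Fin n) (Fin n) properRing,
      (∀ i, (Γ i).map properRing.subtype = transferCoeff S i) ∧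
        ∀ i, 0 < i → Γ i = (coeffMat S.P i).map properConst := by
  obtain ⟨Γ₀, hΓ₀⟩ := exists_proper_transfer S.C S.A S.B
  refine ⟨Function.update (fun i => (coeffMat S.P i).map properConst) 0
    ((coeffMat S.P 0).map properConst + Γ₀), fun i => ?_,
    fun i hi => Function.update_of_ne hi.ne' _ _⟩
  rcases Nat.eq_zero_or_pos i with rfl | hi
  · rw [transferCoeff, Function.update_self, Function.update_self, hE, hΓ₀, toRat_toPoly,
      Matrix.map_add _ (map_add _)]
  · rw [transferCoeff, Function.update_of_ne hi.ne', Function.update_of_ne hi.ne', toRat_toPoly]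

end TransferCoeff

theorem colBlock_mul_rowBlock_eq_vecMulVec {R σ : Type} [CommRing R] [Fintype σ] (k l : ℕ)
    (X : Matrix (Fin n) σ R) (Y : Matrix σ (Fin n) R) :
    colBlock m (k + 1) X * rowBlock m (l + 1) Y = Matrix.comp _ _ _ _ R
      (Matrix.vecMulVec (basisVec m _ k) ((X * Y) • basisVec m _ l)) := by
  rw [colBlock_mul_rowBlock]
  congr 1
  ext a b : 2
  simp only [Matrix.of_apply, Matrix.vecMulVec_apply, basisVec, Pi.smul_apply, smul_eq_mul]
  split_ifs <;> first | omega | simp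

theorem transfer_borderedPencil (hm : m = 2 * e + 1 + (p + 2 * s)) (ε : Fin m → ℤˣ)
    (S : SystemData (Fin n) (Fin ℓ ⊕ Fin ℓ)) (hE : S.E = 1) (hJ : J ℓ * S.B = S.Cᵀ) :
    (borderedPencil m (2 * e) p ε S).transfer = toRat (toPoly (signMat m (2 * e) n ε))
      * Matrix.comp _ _ _ _ (RatFunc ℂ) ((RatFunc.X : RatFunc ℂ) •
        leadBlock m e p s (transferCoeff S) - constBlock m e p s (transferCoeff S)) := by
  have hm' : 2 * e < m := by omega
  set f : ℂ →+* RatFunc ℂ := (algebraMap ℂ[X] (RatFunc ℂ)).comp Polynomial.C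
  have hcomp (M : Matrix (Fin m) (Fin m) (Matrix (Fin n) (Fin n) ℂ)) :
      toRat (toPoly (Matrix.comp _ _ _ _ ℂ M))
        = Matrix.comp _ _ _ _ (RatFunc ℂ) (M.map f.mapMatrix) := rfl
  have hB : ((borderedPencil m (2 * e) p ε S).B).map f
      = rowBlock m (blockPos m e + 1) (S.B.map f) := by
    rw [borderedPencil_B hm', map_rowBlock]
  have hC : ((borderedPencil m (2 * e) p ε S).C).map f
      = (signMat m (2 * e) n ε).map f * colBlock m (blockPos m e + 1) (S.C.map f) := by
    rw [borderedPencil_C hm' ε hJ, map_colBlock, signMat_mul_colBlock hm']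
  have hlead : leadBlock m e p s (transferCoeff S)
      = leadBlock m e p s fun i => (coeffMat S.P i).map f := leadBlock_update_zero hm _ _
  set N := (toRat ((Polynomial.X : ℂ[X]) • toPoly S.E - toPoly S.A))⁻¹ with hN
  have hconst : constBlock m e p s (transferCoeff S)
      = (constBlock m e p s fun i => (coeffMat S.P i).map f)
        - Matrix.vecMulVec (basisVec m _ (blockPos m e))
          ((S.C.map f * N * S.B.map f) • basisVec m _ (blockPos m e)) :=
    constBlock_update_zero hm (fun i => (coeffMat S.P i).map f) _
  have hpencil : toRat (pencilL m (2 * e) p S.P) = Matrix.comp _ _ _ _ (RatFunc ℂ)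
      ((RatFunc.X : RatFunc ℂ) • leadBlock m e p s (fun i => (coeffMat S.P i).map f)
        - constBlock m e p s fun i => (coeffMat S.P i).map f) := by
    rw [pencilL_eq hm, toRat_sub, toRat_X_smul, hcomp, hcomp, leadBlock_map, constBlock_map]
    rfl
  calc (borderedPencil m (2 * e) p ε S).transfer
    _ = (signMat m (2 * e) n ε).map f * toRat (pencilL m (2 * e) p S.P)
        + ((borderedPencil m (2 * e) p ε S).C).map f * N
          * ((borderedPencil m (2 * e) p ε S).B).map f := by
      rw [hN, hE, SystemData.transfer, borderedPencil_P, toRat_mul]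
      rfl
    _ = (signMat m (2 * e) n ε).map f * (toRat (pencilL m (2 * e) p S.P)
        + colBlock m (blockPos m e + 1) (S.C.map f * N)
          * rowBlock m (blockPos m e + 1) (S.B.map f)) := by
      rw [hC, hB, Matrix.mul_assoc _ _ N, colBlock_mul, Matrix.mul_assoc, Matrix.mul_add]
    _ = _ := by
      rw [hpencil, hlead, hconst, colBlock_mul_rowBlock_eq_vecMulVec, ← sub_add]
      rfl

theorem exists_proper_equiv_blockPencil (hm : m = 2 * e + 1 + (p + 2 * s))
    (Γ : ℕ → Matrix (Fin n) (Fin n) properRing) (hΓ : IsUnit (Γ m) ∨ p = 0) :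
    ∃ U V : Matrix (Fin m × Fin n) (Fin m × Fin n) properRing, IsUnit U ∧ IsUnit V ∧
      U.map properRing.subtype * Matrix.comp _ _ _ _ (RatFunc ℂ)
          (leadBlock m e p s (fun i => (Γ i).map properRing.subtype) - (RatFunc.X : RatFunc ℂ)⁻¹ •
            constBlock m e p s fun i => (Γ i).map properRing.subtype) * V.map properRing.subtype
        = idDiag m (∑ i ∈ Finset.range (m + 1),
          (RatFunc.X : RatFunc ℂ)⁻¹ ^ i • (Γ (m - i)).map properRing.subtype) := by
  obtain ⟨U, V, hU, hV, hUV⟩ := isEquivalent_reversed_blockPencil Γ properInv hm hΓ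
  refine ⟨Matrix.comp _ _ _ _ _ U, Matrix.comp _ _ _ _ _ V, isUnit_comp hU, isUnit_comp hV, ?_⟩
  set f : Matrix (Fin n) (Fin n) properRing →+* Matrix (Fin n) (Fin n) (RatFunc ℂ) :=
    properRing.subtype.mapMatrix
  have hsmul (M : Matrix (Fin m) (Fin m) (Matrix (Fin n) (Fin n) properRing)) :
      (properInv • M).map f = (RatFunc.X : RatFunc ℂ)⁻¹ • M.map f := rfl
  have hsum : f (∑ i ∈ Finset.range (m + 1), properInv ^ i • Γ (m - i))
      = ∑ i ∈ Finset.range (m + 1), (RatFunc.X : RatFunc ℂ)⁻¹ ^ i • f (Γ (m - i)) := by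
    rw [map_sum]
    rfl
  have hmap := congrArg (fun M => Matrix.comp _ _ _ _ (RatFunc ℂ) (M.map f)) hUV
  simp only [Matrix.map_mul, comp_mul, blockElem_map, ← idDiag_eq_comp, hsum,
    Matrix.map_sub f (map_sub f), hsmul, leadBlock_map, constBlock_map] at hmap
  exact hmap

theorem exists_biproper_borderedPencil (hm : m = 2 * e + 1 + (p + 2 * s)) (ε : Fin m → ℤˣ)
    (S : SystemData (Fin n) (Fin ℓ ⊕ Fin ℓ)) (hE : S.E = 1) (hJ : J ℓ * S.B = S.Cᵀ)
    (hP : ∀ k, m < k → coeffMat S.P k = 0) (hA : IsUnit (coeffMat S.P m) ∨ p = 0) :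
    ∃ Ol Or : Matrix (Fin m × Fin n) (Fin m × Fin n) (RatFunc ℂ),
      IsBiproper Ol ∧ IsBiproper Or ∧
        Ol * ((RatFunc.X : RatFunc ℂ)⁻¹ • (borderedPencil m (2 * e) p ε S).transfer) * Or
          = idDiag m (((RatFunc.X : RatFunc ℂ) ^ m)⁻¹ • S.transfer) := by
  have hm' : 2 * e < m := by omega
  obtain ⟨Γ, hΓ, hΓpos⟩ := exists_proper_transferCoeff S hE
  have hΓm : IsUnit (Γ m) ∨ p = 0 := by
    rw [hΓpos m (by omega)]
    exact hA.imp_left fun h => h.map properConst.mapMatrix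
  obtain ⟨U, V, hU, hV, hUV⟩ := exists_proper_equiv_blockPencil hm Γ hΓm
  set D := (signMat m (2 * e) n ε).map properConst with hDdef
  have hD : IsUnit D := (isUnit_signMat hm' ε).map properConst.mapMatrix
  have hDD : D.map properRing.subtype * toRat (toPoly (signMat m (2 * e) n ε)) = 1 := by
    rw [hDdef, ← toRat_toPoly, ← toRat_mul, ← toPoly_mul, signMat_mul_self hm', toPoly_one]
    simp [toRat]
  have hreflect : ∑ i ∈ Finset.range (m + 1),
      (RatFunc.X : RatFunc ℂ)⁻¹ ^ i • transferCoeff S (m - i)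
      = ((RatFunc.X : RatFunc ℂ) ^ m)⁻¹ • S.transfer := by
    rw [← sum_transferCoeff S hP, ← Finset.sum_range_reflect, Finset.smul_sum]
    refine Finset.sum_congr rfl fun i hi => ?_
    have hi : i ≤ m := Nat.lt_succ_iff.1 (Finset.mem_range.1 hi)
    rw [Nat.add_sub_cancel, Nat.sub_sub_self hi, smul_smul, inv_pow,
      pow_sub₀ _ RatFunc.X_ne_zero hi, mul_inv, inv_inv]
  refine ⟨(U * D).map properRing.subtype, V.map properRing.subtype,
    isBiproper_of_isUnit (hU.mul hD), isBiproper_of_isUnit hV, ?_⟩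
  simp only [hΓ] at hUV
  rw [← hreflect, ← hUV, transfer_borderedPencil hm ε S hE hJ, Matrix.map_mul, ← Matrix.mul_smul,
    ← mul_assoc (_ * _), mul_assoc (U.map _), hDD, mul_one]
  congr 2
  refine congrArg (Matrix.comp _ _ _ _ (RatFunc ℂ)) (?_ : (RatFunc.X : RatFunc ℂ)⁻¹ •
    ((RatFunc.X : RatFunc ℂ) • _ - _) = _)
  rw [smul_sub, inv_smul_smul₀ RatFunc.X_ne_zero]

theorem isRosenbrockStrongLinearization_borderedPencil (hm : m = 2 * e + 1 + (p + 2 * s))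
    (ε : Fin m → ℤˣ) (S : SystemData (Fin n) (Fin ℓ ⊕ Fin ℓ)) (hE : S.E = 1)
    (hJ : J ℓ * S.B = S.Cᵀ) (hP : ∀ k, m < k → coeffMat S.P k = 0)
    (hA : IsUnit (coeffMat S.P m) ∨ p = 0) (hmin : S.IsMinimal) :
    IsRosenbrockStrongLinearization S (borderedPencil m (2 * e) p ε S) := by
  have hm' : 2 * e < m := by omega
  obtain ⟨U, V, hU, hV, hUcol, hVrow, hUV⟩ := exists_equiv_pencilL hm S.P hP hA
  set T := borderedPencil m (2 * e) p ε S
  set D := toPoly (signMat m (2 * e) n ε)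
  have hDD : D * D = 1 := by rw [← toPoly_mul, signMat_mul_self hm', toPoly_one]
  have hPT : U * D * T.P * V = idDiag m S.P := by
    rw [borderedPencil_P, ← mul_assoc (U * _), mul_assoc U, hDD, mul_one, hUV]
  have hDC : D * colBlock m (blockPos m e + 1) (S.C.map Polynomial.C) =
      colBlock m (blockPos m e + 1) (S.C.map Polynomial.C) :=
    signMat_mul_colBlock hm' ε Polynomial.C _
  have hCT : U * D * toPoly T.C = colBlock m m (toPoly S.C) := by
    rw [borderedPencil_C hm' ε hJ, toPoly, map_colBlock, Matrix.mul_assoc, hDC, hUcol, toPoly]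
  have hBT : toPoly T.B * V = rowBlock m m (toPoly S.B) := by
    rw [borderedPencil_B hm', toPoly, map_rowBlock, hVrow, toPoly]
  have htransfer := transfer_of_equiv hPT hCT hBT rfl hE.symm
  refine ⟨exists_borderedPencil_P_eq hm ε S, isMinimal_of_equiv (by omega) htransfer hmin,
    ⟨U * D, V, 1, 1, isUnimodular_of_isUnit (hU.mul (IsUnit.of_mul_eq_one _ hDD)),
      isUnimodular_of_isUnit hV, by simp, by simp, toMatrix_of_equiv hPT hCT hBT rfl hE.symm⟩,
    exists_biproper_borderedPencil hm ε S hE hJ hP hA⟩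

end Bordered

/-! ### Signs of the Fiedler products -/

section Signs

variable {S : Type*} [Ring S] {m : ℕ}

/-- `diag(d) M = N diag(d')`, for diagonal matrices of signs. -/
def SignIntertwines (d d' : ℕ → ℤˣ) (M N : Matrix (Fin m) (Fin m) S) : Prop :=
  ∀ a b : Fin m, d a • M a b = d' b • N a b

theorem SignIntertwines.mul {d d' d'' : ℕ → ℤˣ} {M N M' N' : Matrix (Fin m) (Fin m) S}
    (h : SignIntertwines d d' M N) (h' : SignIntertwines d' d'' M' N') :
    SignIntertwines d d'' (M * M') (N * N') := fun a b => by
  rw [Matrix.mul_apply, Matrix.mul_apply, Finset.smul_sum, Finset.smul_sum]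
  refine Finset.sum_congr rfl fun c _ => ?_
  rw [← smul_mul_assoc, h a c, smul_mul_assoc, ← mul_smul_comm, h' c b, mul_smul_comm]

theorem signIntertwines_one {d d' : ℕ → ℤˣ} (h : ∀ j < m, d' j = d j) :
    SignIntertwines d d' (1 : Matrix (Fin m) (Fin m) S) 1 := fun a b => by
  rw [h b b.2, Matrix.one_apply]
  split_ifs with hab
  · rw [hab]
  · rw [smul_zero, smul_zero]

/-- The sequence `(-1)^i A_i`; it is the sequence of the coefficients of `P(-λ)` when `A` is that of
`P(λ)`. -/
def altCoeff (A : ℕ → S) (i : ℕ) : S := (-1 : ℤˣ) ^ i • A i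

theorem smul_eq_mul_smul_altCoeff (A : ℕ → S) (i : ℕ) (u : ℤˣ) :
    u • A i = ((-1) ^ i * u) • altCoeff A i := by
  rw [altCoeff, smul_smul, mul_right_comm, Int.units_mul_self, one_mul]

variable (A : ℕ → S) {d d' : ℕ → ℤˣ}

theorem signIntertwines_lowFactor {i j : ℕ} (hi : 0 < i) (h : i + j + 1 = m)
    (hpair : d (j + 1) = (-1) ^ i * d j)
    (hd' : ∀ k < m, d' k = if k = j ∨ k = j + 1 then (-1) ^ i * d k else d k) :
    SignIntertwines d d' (lowFactor m A i) (lowFactor m (altCoeff A) i) := fun a b => by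
  have hj : d' j = (-1) ^ i * d j := by rw [hd' j (by omega), if_pos (.inl rfl)]
  have hj' : d' (j + 1) = d j := by
    rw [hd' (j + 1) (by omega), if_pos (.inr rfl), hpair, ← mul_assoc, Int.units_mul_self, one_mul]
  rw [lowFactor, lowFactor, blockElem_pos_apply hi, blockElem_pos_apply hi,
    show m - i = j + 1 by omega]
  split_ifs with haa hab hba hbb heq
  · rw [Nat.succ.inj haa.1, Nat.succ.inj haa.2, hj, smul_neg, smul_neg, smul_eq_mul_smul_altCoeff]
  · rw [Nat.succ.inj hab.1, hab.2, hj']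
  · rw [hba.1, Nat.succ.inj hba.2, hpair, hj]
  · rw [smul_zero, smul_zero]
  · rw [heq, hd' b b.2, if_neg (by omega)]
  · rw [smul_zero, smul_zero]

theorem signIntertwines_lowFactor_zero (h : ∀ j < m, d' j = d j) :
    SignIntertwines d d' (lowFactor m A 0) (lowFactor m (altCoeff A) 0) := fun a b => by
  rw [lowFactor, lowFactor, Nat.cast_zero, blockElem_zero_apply, blockElem_zero_apply, altCoeff,
    pow_zero, one_smul, h b b.2]
  split_ifs with hab hlast
  · rw [hab]
  · rw [hab]
  · rw [smul_zero, smul_zero]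

theorem signIntertwines_highFactor {i j : ℕ} (hi : 0 < i) (h : i + j + 1 = m)
    (hpair : d (j + 1) = (-1) ^ i * d j)
    (hd' : ∀ k < m, d' k = if k = j ∨ k = j + 1 then (-1) ^ i * d k else d k) :
    SignIntertwines d d' (highFactor m A (j + 1)) (highFactor m (altCoeff A) (j + 1)) :=
  fun a b => by
  have hj : d' j = d (j + 1) := by rw [hd' j (by omega), if_pos (.inl rfl), hpair]
  have hj' : d' (j + 1) = (-1) ^ i * d (j + 1) := by
    rw [hd' (j + 1) (by omega), if_pos (.inr rfl)]
  have hswap : d' (j + 1) = d j := by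
    rw [hj', hpair, ← mul_assoc, Int.units_mul_self, one_mul]
  rw [highFactor, highFactor, show m - (j + 1) = i by omega, blockElem_neg_apply hi (by omega),
    blockElem_neg_apply hi (by omega), show m - i = j + 1 by omega]
  split_ifs with haa hab hba hbb heq
  · rw [smul_zero, smul_zero]
  · rw [Nat.succ.inj hab.1, hab.2, hswap]
  · rw [hba.1, Nat.succ.inj hba.2, hj]
  · rw [hbb.1, hbb.2, hj', smul_eq_mul_smul_altCoeff]
  · rw [heq, hd' b b.2, if_neg (by omega)]
  · rw [smul_zero, smul_zero]

theorem signIntertwines_highFactor_zero (hm : 0 < m)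
    (hd' : ∀ j < m, d' j = if j = 0 then (-1) ^ m * d j else d j) :
    SignIntertwines d d' (highFactor m A 0) (highFactor m (altCoeff A) 0) := fun a b => by
  rw [highFactor, highFactor, Nat.sub_zero, blockElem_top_apply hm, blockElem_top_apply hm,
    hd' b b.2]
  split_ifs with hab ha hb
  · rw [hab, smul_eq_mul_smul_altCoeff]
  · omega
  · omega
  · rw [hab]
  all_goals rw [smul_zero, smul_zero]

theorem signIntertwines_lowFactor_even {i j : ℕ} (hi : 0 < i) (h : i + j + 1 = m)
    (heven : i % 2 = 0) (hpair : d (j + 1) = d j) :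
    SignIntertwines d d (lowFactor m A i) (lowFactor m (altCoeff A) i) := by
  have hu : (-1 : ℤˣ) ^ i = 1 := (Nat.even_iff.2 heven).neg_one_pow
  exact signIntertwines_lowFactor A hi h (by rw [hu, one_mul, hpair]) (by simp [hu])

theorem signIntertwines_lowFactor_odd {i j : ℕ} (h : i + j + 1 = m) (hodd : i % 2 = 1)
    (hpair : d (j + 1) = -d j) (hd' : ∀ k < m, d' k = if k = j ∨ k = j + 1 then -d k else d k) :
    SignIntertwines d d' (lowFactor m A i) (lowFactor m (altCoeff A) i) := by
  have hu : (-1 : ℤˣ) ^ i = -1 := (Nat.odd_iff.2 hodd).neg_one_pow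
  exact signIntertwines_lowFactor A (by omega) h (by rw [hu, neg_one_mul, hpair])
    (by simpa only [hu, neg_one_mul] using hd')

theorem signIntertwines_highFactor_even {i j : ℕ} (hi : 0 < i) (h : i + j + 1 = m)
    (heven : i % 2 = 0) (hpair : d (j + 1) = d j) :
    SignIntertwines d d (highFactor m A (j + 1)) (highFactor m (altCoeff A) (j + 1)) := by
  have hu : (-1 : ℤˣ) ^ i = 1 := (Nat.even_iff.2 heven).neg_one_pow
  exact signIntertwines_highFactor A hi h (by rw [hu, one_mul, hpair]) (by simp [hu])

theorem signIntertwines_highFactor_odd {i j : ℕ} (h : i + j + 1 = m) (hodd : i % 2 = 1)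
    (hpair : d (j + 1) = -d j) (hd' : ∀ k < m, d' k = if k = j ∨ k = j + 1 then -d k else d k) :
    SignIntertwines d d' (highFactor m A (j + 1)) (highFactor m (altCoeff A) (j + 1)) := by
  have hu : (-1 : ℤˣ) ^ i = -1 := (Nat.odd_iff.2 hodd).neg_one_pow
  exact signIntertwines_highFactor A (by omega) h (by rw [hu, neg_one_mul, hpair])
    (by simpa only [hu, neg_one_mul] using hd')

theorem signIntertwines_range {q : ℕ} (hq : q < m) (halt : ∀ j < q, d (j + 1) = -d j)
    (hd' : ∀ j < m, d' j =
      if j < q then -d j else if j = q then (-1) ^ (m + q) * d j else d j) :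
    SignIntertwines d d' ((List.range (q + 1)).map (highFactor m A)).prod
      ((List.range (q + 1)).map (highFactor m (altCoeff A))).prod := by
  induction q generalizing d' with
  | zero =>
    simp only [zero_add, List.range_one, List.map_cons, List.map_nil, List.prod_singleton]
    exact signIntertwines_highFactor_zero A hq (by simpa using hd')
  | succ q ih =>
    have hpow : (-1 : ℤˣ) ^ (m - (q + 2) + 1) = (-1) ^ (m + (q + 1)) := by
      rw [show m + (q + 1) = m - (q + 2) + 1 + 2 * (q + 1) by omega,
        pow_add _ (_ + 1), pow_mul, neg_one_sq, one_pow, mul_one]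
    have hsucc : (-1 : ℤˣ) ^ (m + (q + 1)) * (-1) ^ (m + q) = -1 := by
      rw [← add_assoc, pow_succ, mul_neg_one, neg_mul, Int.units_mul_self]
    rw [List.range_succ (n := q + 1), List.map_append, List.prod_append, List.map_append,
      List.prod_append]
    simp only [List.map_cons, List.map_nil, List.prod_singleton]
    refine (ih (by omega) (fun j hj => halt j (by omega)) fun j _ => rfl).mul
      (signIntertwines_highFactor A (i := m - (q + 2) + 1) (by omega) (by omega) ?_ fun k hk => ?_)
    · simp only [lt_irrefl, if_false, if_true, if_neg (show ¬ q + 1 < q by omega),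
        if_neg (show ¬ q + 1 = q by omega)]
      rw [hpow, ← mul_assoc, hsucc, neg_one_mul, halt q (by omega)]
    · rw [hd' k hk, hpow]
      split_ifs <;> first | rfl | omega | rw [← mul_assoc, hsucc, neg_one_mul]

theorem signIntertwines_hankel {q : ℕ} (hq : q ≤ m) (halt : ∀ j, j + 1 < q → d (j + 1) = -d j)
    (hd' : ∀ j < m, d' j = if j < q then (-1) ^ (m + q + 1) * d j else d j) :
    SignIntertwines d d' ((hankelTuple q).map (highFactor m A)).prod
      ((hankelTuple q).map (highFactor m (altCoeff A))).prod := by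
  induction q generalizing d with
  | zero => exact signIntertwines_one fun j hj => (hd' j hj).trans (if_neg (by omega))
  | succ q ih =>
    have hpow : (-1 : ℤˣ) ^ (m + (q + 1) + 1) = (-1) ^ (m + q) := by
      rw [show m + (q + 1) + 1 = m + q + 2 by omega, pow_add, neg_one_sq, mul_one]
    rw [hpow] at hd'
    rw [hankelTuple, List.map_append, List.prod_append, List.map_append, List.prod_append]
    refine (signIntertwines_range A (by omega) (fun j hj => halt j (by omega))
      fun j _ => rfl).mul (ih (by omega) (fun j hj => ?_) fun j hj => ?_)
    · simp only [if_pos hj, if_pos (show j < q by omega), halt j (by omega)]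
    · rw [hd' j hj, pow_succ, mul_neg_one]
      split_ifs <;> first | rfl | omega | rw [neg_mul_neg]

variable {e p s : ℕ}

theorem signIntertwines_admTuple (hm : p + 2 * s < m) (hp : (m + p) % 2 = 1)
    (halt : ∀ j < p, d (j + 1) = -d j) (heven : ∀ t < s, d (p + 2 * t + 1) = d (p + 2 * t))
    (hodd : ∀ t < s, d (p + 2 * t + 2) = -d (p + 2 * t + 1))
    (hd' : ∀ j < m, d' j = if j ≤ p + 2 * s then -d j else d j) :
    SignIntertwines d d' ((admTuple p s).map (highFactor m A)).prod
      ((admTuple p s).map (highFactor m (altCoeff A))).prod := by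
  induction s generalizing d with
  | zero =>
    have hu : (-1 : ℤˣ) ^ (m + p) = -1 := (Nat.odd_iff.2 hp).neg_one_pow
    refine signIntertwines_range A hm halt fun j hj => ?_
    rw [hd' j hj, hu, neg_one_mul]
    split_ifs <;> first | rfl | omega
  | succ s ih =>
    rw [admTuple, List.map_cons, List.map_cons, List.prod_cons, List.prod_cons, List.map_cons,
      List.map_cons, List.prod_cons, List.prod_cons]
    refine (signIntertwines_highFactor_even A (i := m - (p + 2 * s + 1)) (by omega) (by omega)
      (by omega) (heven s (by omega))).mul
      ((signIntertwines_highFactor_odd A (i := m - (p + 2 * s + 2)) (by omega) (by omega)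
        (hodd s (by omega)) fun k _ => rfl).mul
      (ih (by omega) (fun j hj => ?_) (fun t ht => ?_) (fun t ht => ?_) fun j hj => ?_))
    · grind
    · grind
    · grind
    · grind

theorem signIntertwines_admCompl (hm : p + 2 * s < m) (hp : (m + p) % 2 = 1)
    (halt : ∀ j < p, d (j + 1) = -d j) (heven : ∀ t < s, d (p + 2 * t + 1) = d (p + 2 * t)) :
    SignIntertwines d d ((admCompl p s).map (highFactor m A)).prod
      ((admCompl p s).map (highFactor m (altCoeff A))).prod := by
  induction s with
  | zero =>
    have hu : (-1 : ℤˣ) ^ (m + p + 1) = 1 := (Nat.even_iff.2 (by omega)).neg_one_pow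
    exact signIntertwines_hankel A (by omega) (fun j hj => halt j (by omega)) (by simp [hu])
  | succ s ih =>
    rw [admCompl, List.map_cons, List.prod_cons, List.map_cons, List.prod_cons]
    exact (signIntertwines_highFactor_even A (i := m - (p + 2 * s + 1)) (by omega) (by omega)
      (by omega) (heven s (by omega))).mul (ih (by omega) fun t ht => heven t (by omega))

theorem signIntertwines_admCompl_low (hm : 2 * e < m)
    (hodd : ∀ t < e, ∀ j, 2 * t + 1 + j + 1 = m → d (j + 1) = -d j)
    (hd' : ∀ j < m, d' j = if j < m - 2 * e then d j else -d j) :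
    SignIntertwines d d' ((admCompl 0 e).map (lowFactor m A)).prod
      ((admCompl 0 e).map (lowFactor m (altCoeff A))).prod := by
  induction e generalizing d with
  | zero => exact signIntertwines_one fun j hj => (hd' j hj).trans (if_pos (by omega))
  | succ e ih =>
    obtain ⟨j, hj⟩ : ∃ j, 2 * e + 1 + j + 1 = m := ⟨m - 2 * e - 2, by omega⟩
    rw [admCompl, List.map_cons, List.prod_cons, List.map_cons, List.prod_cons, Nat.zero_add]
    refine (signIntertwines_lowFactor_odd A hj (by omega) (hodd e (by omega) j hj)
      fun k _ => rfl).mul (ih (by omega) (fun t ht k hk => ?_) fun k hk => ?_)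
    · have := hodd t (by omega) k hk
      grind
    · have := hd' k hk
      grind

theorem signIntertwines_admTuple_low (hm : 2 * e < m)
    (hodd : ∀ t < e, ∀ j, 2 * t + 1 + j + 1 = m → d (j + 1) = -d j)
    (heven : ∀ t < e, 0 < t → ∀ j, 2 * t + j + 1 = m → d (j + 1) = d j)
    (htop : 0 < e → ∀ j, 2 * e + j + 1 = m → d (j + 1) = -d j)
    (hd' : ∀ j < m, d' j = if j < m - 2 * e then d j else -d j) :
    SignIntertwines d d' ((admTuple 0 e).map (lowFactor m A)).prod
      ((admTuple 0 e).map (lowFactor m (altCoeff A))).prod := by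
  induction e generalizing d with
  | zero =>
    simp only [admTuple, zero_add, List.range_one, List.map_cons, List.map_nil,
      List.prod_singleton]
    exact signIntertwines_lowFactor_zero A fun j hj => (hd' j hj).trans (if_pos (by omega))
  | succ e ih =>
    obtain ⟨j, hj⟩ : ∃ j, 2 * e + 2 + j + 1 = m := ⟨m - 2 * e - 3, by omega⟩
    have hj' : 2 * e + 1 + (j + 1) + 1 = m := by omega
    rw [admTuple, List.map_cons, List.map_cons, List.prod_cons, List.prod_cons, List.map_cons,
      List.map_cons, List.prod_cons, List.prod_cons, Nat.zero_add]
    refine (signIntertwines_lowFactor_odd A hj' (by omega) (hodd e (by omega) _ hj')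
      fun k _ => rfl).mul ((signIntertwines_lowFactor_even A (i := 2 * e + 2) (by omega) hj
      (by omega) ?_).mul (ih (by omega) (fun t ht k hk => ?_) (fun t ht h0 k hk => ?_)
      (fun h0 k hk => ?_) fun k hk => ?_))
    · have : d j = -d (j + 1) := by rw [htop (by omega) j (by omega), neg_neg]
      grind
    · have := hodd t (by omega) k hk
      grind
    · have := heven t (by omega) h0 k hk
      grind
    · rw [if_neg (by omega), if_pos (by omega), neg_neg, heven e (by omega) h0 k hk]
    · have := hd' k hk
      grind

/-- The signs of the quasi-identity matrix `Q`: consecutive signs `d j`, `d (j + 1)` are equal or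
opposite according to the factors of `L(λ)` whose core block sits in the rows `j` and `j + 1`. -/
structure IsSignPattern (m e p s : ℕ) (d : ℕ → ℤˣ) : Prop where
  alternating : ∀ j < p, d (j + 1) = -d j
  even_high : ∀ t < s, d (p + 2 * t + 1) = d (p + 2 * t)
  odd_high : ∀ t < s, d (p + 2 * t + 2) = -d (p + 2 * t + 1)
  middle : 0 < e → d (p + 2 * s + 1) = -d (p + 2 * s)
  odd_low : ∀ t < e, ∀ j, 2 * t + 1 + j + 1 = m → d (j + 1) = -d j
  even_low : ∀ t < e, 0 < t → ∀ j, 2 * t + j + 1 = m → d (j + 1) = d j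

theorem exists_isSignPattern (hm : m = 2 * e + 1 + (p + 2 * s)) : ∃ d, IsSignPattern m e p s d := by
  let ρ : ℕ → ℤˣ := fun j => if j < p then -1 else if j < p + 2 * s then
    (if (j - p) % 2 = 0 then 1 else -1) else if j = p + 2 * s then -1 else
    (if (m - j) % 2 = 0 then -1 else 1)
  obtain ⟨d, hd⟩ : ∃ d : ℕ → ℤˣ, ∀ j, d (j + 1) = ρ j * d j :=
    ⟨fun j => ∏ i ∈ Finset.range j, ρ i, fun j => (Finset.prod_range_succ ρ j).trans (mul_comm _ _)⟩
  have hneg : ∀ j, ρ j = -1 → d (j + 1) = -d j := fun j hj => by rw [hd, hj, neg_one_mul]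
  have hone : ∀ j, ρ j = 1 → d (j + 1) = d j := fun j hj => by rw [hd, hj, one_mul]
  exact ⟨d, fun j hj => hneg j (by grind), fun t ht => hone _ (by grind),
    fun t ht => hneg _ (by grind), fun _ => hneg _ (by grind),
    fun t ht j hj => hneg j (by grind), fun t ht h0 j hj => hone j (by grind)⟩

theorem IsSignPattern.leadBlock (hd : IsSignPattern m e p s d)
    (hm : m = 2 * e + 1 + (p + 2 * s)) :
    SignIntertwines d (-d) (leadBlock m e p s A) (leadBlock m e p s (altCoeff A)) := by
  refine ((signIntertwines_admTuple A (by omega) (by omega) hd.alternating hd.even_high hd.odd_high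
    fun j _ => rfl).mul (signIntertwines_admCompl_low A (d' := -d) (by omega) (fun t ht j hj => ?_)
    fun j _ => ?_)).mul (signIntertwines_admCompl A (by omega) (by omega) (fun j hj => ?_)
    fun t ht => ?_)
  · rw [if_neg (by omega), if_neg (by omega)]
    exact hd.odd_low t ht j hj
  · rw [Pi.neg_apply]
    split_ifs <;> first | rfl | omega
  · rw [Pi.neg_apply, Pi.neg_apply, hd.alternating j hj]
  · rw [Pi.neg_apply, Pi.neg_apply, hd.even_high t ht]

theorem IsSignPattern.constBlock (hd : IsSignPattern m e p s d)
    (hm : m = 2 * e + 1 + (p + 2 * s)) :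
    SignIntertwines d d (constBlock m e p s A) (constBlock m e p s (altCoeff A)) := by
  refine ((signIntertwines_admTuple_low A (by omega) hd.odd_low hd.even_low (fun h0 j hj => ?_)
    fun j _ => rfl).mul (signIntertwines_admCompl_low A (d' := d) (by omega) (fun t ht j hj => ?_)
    fun j _ => ?_)).mul (signIntertwines_admCompl A (by omega) (by omega) hd.alternating
    hd.even_high)
  · obtain rfl : j = p + 2 * s := by omega
    exact hd.middle h0
  · rw [if_neg (by omega), if_neg (by omega), hd.odd_low t ht j hj]
  · split_ifs
    · rfl
    · rw [neg_neg]

end Signs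

/-! ### Transposes of Fiedler products -/

section Transpose

variable {m n : ℕ} {R : Type}

/-- The transpose of a block matrix: the blocks are transposed along with their positions. -/
def blockTranspose (M : Matrix (Fin m) (Fin m) (Matrix (Fin n) (Fin n) R)) :
    Matrix (Fin m) (Fin m) (Matrix (Fin n) (Fin n) R) := Matrix.of fun a b => (M b a)ᵀ

theorem comp_blockTranspose (M : Matrix (Fin m) (Fin m) (Matrix (Fin n) (Fin n) R)) :
    Matrix.comp _ _ _ _ R (blockTranspose M) = (Matrix.comp _ _ _ _ R M)ᵀ := rfl

variable [CommRing R]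

theorem blockTranspose_mul (M N : Matrix (Fin m) (Fin m) (Matrix (Fin n) (Fin n) R)) :
    blockTranspose (M * N) = blockTranspose N * blockTranspose M := by
  apply (Matrix.comp (Fin m) (Fin m) (Fin n) (Fin n) R).injective
  rw [comp_mul, comp_blockTranspose, comp_blockTranspose, comp_blockTranspose, comp_mul,
    Matrix.transpose_mul]

theorem blockTranspose_one :
    blockTranspose (1 : Matrix (Fin m) (Fin m) (Matrix (Fin n) (Fin n) R)) = 1 := by
  refine Matrix.ext fun a b => ?_
  rw [blockTranspose, Matrix.of_apply, Matrix.one_apply, Matrix.one_apply]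
  simp only [eq_comm (a := b)]
  split_ifs <;> simp

theorem blockTranspose_list_prod {ι : Type*}
    (g : ι → Matrix (Fin m) (Fin m) (Matrix (Fin n) (Fin n) R)) (t : List ι) :
    blockTranspose (t.map g).prod = (t.reverse.map fun i => blockTranspose (g i)).prod := by
  induction t with
  | nil => exact blockTranspose_one
  | cons i t ih =>
    rw [List.map_cons, List.prod_cons, blockTranspose_mul, ih, List.reverse_cons, List.map_append,
      List.prod_append, List.map_cons, List.map_nil, List.prod_singleton]

theorem blockTranspose_lowFactor {A : ℕ → Matrix (Fin n) (Fin n) R} {i : ℕ}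
    (hA : (A i)ᵀ = altCoeff A i) :
    blockTranspose (lowFactor m A i) = lowFactor m (altCoeff A) i := by
  refine Matrix.ext fun a b => ?_
  rw [blockTranspose, Matrix.of_apply, lowFactor, lowFactor]
  rcases Nat.eq_zero_or_pos i with rfl | hi0
  · rw [Nat.cast_zero, blockElem_zero_apply, blockElem_zero_apply, ← hA]
    split_ifs <;> first | (exfalso; omega) | simp
  · rw [blockElem_pos_apply hi0, blockElem_pos_apply hi0, ← hA]
    split_ifs <;> first | (exfalso; omega) | simp

theorem blockTranspose_highFactor {A : ℕ → Matrix (Fin n) (Fin n) R} {j : ℕ} (hj : j < m)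
    (hA : (A (m - j))ᵀ = altCoeff A (m - j)) :
    blockTranspose (highFactor m A j) = highFactor m (altCoeff A) j := by
  refine Matrix.ext fun a b => ?_
  rw [blockTranspose, Matrix.of_apply, highFactor, highFactor]
  rcases Nat.eq_zero_or_pos j with rfl | hj0
  · rw [Nat.sub_zero] at hA ⊢
    rw [blockElem_top_apply hj, blockElem_top_apply hj, ← hA]
    split_ifs <;> first | (exfalso; omega) | simp
  · rw [blockElem_neg_apply (by omega) (by omega), blockElem_neg_apply (by omega) (by omega), ← hA]
    split_ifs <;> first | (exfalso; omega) | simp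

variable {A : ℕ → Matrix (Fin n) (Fin n) R} {p s : ℕ}

theorem blockTranspose_prod_low (hA : ∀ i, (A i)ᵀ = altCoeff A i) (t : List ℕ) :
    blockTranspose (t.map (lowFactor m A)).prod
      = (t.reverse.map (lowFactor m (altCoeff A))).prod := by
  rw [blockTranspose_list_prod]
  exact congrArg List.prod (List.map_congr_left fun i _ => blockTranspose_lowFactor (hA i))

theorem blockTranspose_prod_high (hA : ∀ i, (A i)ᵀ = altCoeff A i) {t : List ℕ}
    (ht : ∀ j ∈ t, j < m) :
    blockTranspose (t.map (highFactor m A)).prod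
      = (t.reverse.map (highFactor m (altCoeff A))).prod := by
  rw [blockTranspose_list_prod]
  exact congrArg List.prod (List.map_congr_left fun j hj =>
    blockTranspose_highFactor (ht j (List.mem_reverse.1 hj)) (hA _))

theorem le_of_mem_admTuple_append {i : ℕ} (hi : i ∈ admTuple p s ++ admCompl p s) :
    i ≤ p + 2 * s :=
  (List.mem_append.1 hi).elim mem_admTuple.1 fun h => (lt_of_mem_admCompl h).le

theorem blockTranspose_prod_low_admCompl (hA : ∀ i, (A i)ᵀ = altCoeff A i) (h : p + 2 * s < m) :
    blockTranspose ((admCompl p s).map (lowFactor m A)).prod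
      = ((admCompl p s).map (lowFactor m (altCoeff A))).prod := by
  rw [blockTranspose_prod_low hA, prod_reverse_admCompl]
  exact fun i j hj => commute_lowFactor _ (by omega)

theorem blockTranspose_prod_high_admCompl (hA : ∀ i, (A i)ᵀ = altCoeff A i) (h : p + 2 * s < m) :
    blockTranspose ((admCompl p s).map (highFactor m A)).prod
      = ((admCompl p s).map (highFactor m (altCoeff A))).prod := by
  rw [blockTranspose_prod_high hA fun j hj => (lt_of_mem_admCompl hj).trans h,
    prod_reverse_admCompl]
  exact fun i j hj => commute_highFactor _ (by omega)

theorem blockTranspose_prod_low_admTuple_append (hA : ∀ i, (A i)ᵀ = altCoeff A i)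
    (h : p + 2 * s < m) :
    blockTranspose ((admTuple p s ++ admCompl p s).map (lowFactor m A)).prod
      = ((admTuple p s ++ admCompl p s).map (lowFactor m (altCoeff A))).prod := by
  rw [blockTranspose_prod_low hA, prod_reverse_admTuple_append]
  exact fun i j hj => commute_lowFactor _ (by omega)

theorem blockTranspose_prod_high_admTuple_append (hA : ∀ i, (A i)ᵀ = altCoeff A i)
    (h : p + 2 * s < m) :
    blockTranspose ((admTuple p s ++ admCompl p s).map (highFactor m A)).prod
      = ((admTuple p s ++ admCompl p s).map (highFactor m (altCoeff A))).prod := by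
  rw [blockTranspose_prod_high hA fun j hj => (le_of_mem_admTuple_append hj).trans_lt h,
    prod_reverse_admTuple_append]
  exact fun i j hj => commute_highFactor _ (by omega)

theorem commute_prod_low_high {S : Type*} [Ring S] (A : ℕ → S) {t u : List ℕ}
    (h : ∀ i ∈ t, ∀ j ∈ u, i + j + 2 ≤ m) :
    Commute (t.map (lowFactor m A)).prod (u.map (highFactor m A)).prod :=
  commute_prod_map _ fun j hj => (commute_prod_map _ fun i hi =>
    (commute_lowFactor_highFactor A (h i hi j hj)).symm).symm

variable {e : ℕ}

theorem blockTranspose_leadBlock (hm : m = 2 * e + 1 + (p + 2 * s))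
    (hA : ∀ i, (A i)ᵀ = altCoeff A i) :
    blockTranspose (leadBlock m e p s A) = leadBlock m e p s (altCoeff A) := by
  have hcomm : ∀ (B : ℕ → Matrix (Fin n) (Fin n) R) {u : List ℕ}, (∀ j ∈ u, j ≤ p + 2 * s) →
      Commute ((admCompl 0 e).map (lowFactor m B)).prod (u.map (highFactor m B)).prod :=
    fun B u hu => commute_prod_low_high B fun i hi j hj => by
      have := lt_of_mem_admCompl hi
      have := hu j hj
      omega
  have hleft : leadBlock m e p s A = ((admCompl 0 e).map (lowFactor m A)).prod *
      ((admTuple p s ++ admCompl p s).map (highFactor m A)).prod := by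
    rw [leadBlock, ← (hcomm A fun j => mem_admTuple.1).eq, mul_assoc, List.map_append,
      List.prod_append]
  have hright : leadBlock m e p s (altCoeff A) =
      ((admTuple p s ++ admCompl p s).map (highFactor m (altCoeff A))).prod *
        ((admCompl 0 e).map (lowFactor m (altCoeff A))).prod := by
    rw [leadBlock, mul_assoc, (hcomm (altCoeff A) fun j hj => (lt_of_mem_admCompl hj).le).eq,
      ← mul_assoc, List.map_append, List.prod_append]
  rw [hleft, hright, blockTranspose_mul, blockTranspose_prod_low_admCompl hA (by omega),
    blockTranspose_prod_high_admTuple_append hA (by omega)]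

theorem blockTranspose_constBlock (hm : m = 2 * e + 1 + (p + 2 * s))
    (hA : ∀ i, (A i)ᵀ = altCoeff A i) :
    blockTranspose (constBlock m e p s A) = constBlock m e p s (altCoeff A) := by
  have hconst : ∀ B : ℕ → Matrix (Fin n) (Fin n) R, constBlock m e p s B =
      ((admTuple 0 e ++ admCompl 0 e).map (lowFactor m B)).prod *
        ((admCompl p s).map (highFactor m B)).prod := fun B => by
    rw [constBlock, List.map_append, List.prod_append]
  have hcomm : Commute ((admTuple 0 e ++ admCompl 0 e).map (lowFactor m (altCoeff A))).prod
      ((admCompl p s).map (highFactor m (altCoeff A))).prod :=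
    commute_prod_low_high _ fun i hi j hj => by
      have := le_of_mem_admTuple_append hi
      have := lt_of_mem_admCompl hj
      omega
  rw [hconst, hconst, blockTranspose_mul, blockTranspose_prod_low_admTuple_append hA (by omega),
    blockTranspose_prod_high_admCompl hA (by omega), hcomm.eq]

end Transpose

/-! ### `T`-even pencils -/

section TEven

variable {ι : Type}

theorem isTEven_iff {P : Matrix ι ι ℂ[X]} :
    IsTEven P ↔ ∀ k, (coeffMat P k)ᵀ = (-1 : ℤˣ) ^ k • coeffMat P k := by
  have hcoeff : ∀ (q : ℂ[X]) k, (q.comp (-Polynomial.X)).coeff k = (-1 : ℤˣ) ^ k • q.coeff k :=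
    fun q k => by
    have h : -Polynomial.X = Polynomial.C (-1 : ℂ) * Polynomial.X := by simp
    rw [h, Polynomial.comp_C_mul_X_coeff, mul_comm, Units.smul_def, zsmul_eq_mul]
    simp
  constructor
  · intro h k
    refine Matrix.ext fun a b => ?_
    have hab := congrArg (fun q : ℂ[X] => q.coeff k) (congrFun (congrFun h a) b)
    simp only [Matrix.transpose_apply, Matrix.map_apply, hcoeff] at hab
    rw [Matrix.transpose_apply, Matrix.smul_apply, coeffMat, Matrix.map_apply, Matrix.map_apply,
      ← hab, smul_smul, Int.units_mul_self, one_smul]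
  · intro h
    refine Matrix.ext fun a b => Polynomial.ext fun k => ?_
    have hab := congrFun (congrFun (h k) a) b
    rw [Matrix.transpose_apply, Matrix.smul_apply, coeffMat, Matrix.map_apply,
      Matrix.map_apply] at hab
    rw [Matrix.transpose_apply, Matrix.map_apply, hcoeff, hab, smul_smul, Int.units_mul_self,
      one_smul]

theorem isTEven_pencil_iff {M N : Matrix ι ι ℂ} :
    IsTEven ((Polynomial.X : ℂ[X]) • toPoly M - toPoly N) ↔ Mᵀ = -M ∧ Nᵀ = N := by
  have hzero : coeffMat ((Polynomial.X : ℂ[X]) • toPoly M - toPoly N) 0 = -N := by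
    ext; simp [coeffMat, toPoly]
  have hone : coeffMat ((Polynomial.X : ℂ[X]) • toPoly M - toPoly N) 1 = M := by
    ext; simp [coeffMat, toPoly, Polynomial.coeff_C]
  have hhigher : ∀ k, coeffMat ((Polynomial.X : ℂ[X]) • toPoly M - toPoly N) (k + 2) = 0 :=
    fun k => by ext; simp [coeffMat, toPoly]
  rw [isTEven_iff]
  constructor
  · intro h
    have hN := h 0
    have hM := h 1
    rw [hzero, pow_zero, one_smul, Matrix.transpose_neg, neg_inj] at hN
    rw [hone, pow_one, Units.neg_smul, one_smul] at hM
    exact ⟨hM, hN⟩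
  · rintro ⟨hM, hN⟩ k
    rcases k with _ | _ | k
    · rw [hzero, pow_zero, one_smul, Matrix.transpose_neg, hN]
    · rw [zero_add, hone, pow_one, Units.neg_smul, one_smul, hM]
    · rw [hhigher, Matrix.transpose_zero, smul_zero]

variable {m e p s n : ℕ}

theorem transpose_quasiIdentity_mul_comp_eq_iff {ε : Fin m → ℤˣ}
    {M N : Matrix (Fin m) (Fin m) (Matrix (Fin n) (Fin n) ℂ)} :
    (quasiIdentity n ε * Matrix.comp _ _ _ _ ℂ M)ᵀ = quasiIdentity n ε * Matrix.comp _ _ _ _ ℂ N ↔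
      ∀ a b, ε a • (M a b)ᵀ = ε b • N b a := by
  have hQ : ∀ (M : Matrix (Fin m) (Fin m) (Matrix (Fin n) (Fin n) ℂ)) (a b : Fin m) (α β : Fin n),
      (quasiIdentity n ε * Matrix.comp _ _ _ _ ℂ M) (a, α) (b, β) = ε a • M a b α β :=
    fun M a b α β => by
    rw [quasiIdentity, Matrix.diagonal_mul, Units.smul_def, zsmul_eq_mul]
    rfl
  constructor
  · intro h a b
    refine Matrix.ext fun β α => ?_
    have hentry := congrFun (congrFun h (b, β)) (a, α)
    rwa [Matrix.transpose_apply, hQ, hQ] at hentry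
  · rintro h
    refine Matrix.ext fun ⟨b, β⟩ ⟨a, α⟩ => ?_
    rw [Matrix.transpose_apply, hQ, hQ]
    exact congrFun (congrFun (h a b) β) α

theorem isTEven_quasiIdentity_mul_pencilL_iff (hm : m = 2 * e + 1 + (p + 2 * s))
    (P : Matrix (Fin n) (Fin n) ℂ[X]) (ε : Fin m → ℤˣ) :
    IsTEven (toPoly (quasiIdentity n ε) * pencilL m (2 * e) p P) ↔
      (∀ a b, ε a • (leadBlock m e p s (coeffMat P) a b)ᵀ
        = -(ε b • leadBlock m e p s (coeffMat P) b a)) ∧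
      ∀ a b, ε a • (constBlock m e p s (coeffMat P) a b)ᵀ
        = ε b • constBlock m e p s (coeffMat P) b a := by
  rw [pencilL_eq hm, mul_sub, Matrix.mul_smul, ← toPoly_mul, ← toPoly_mul, isTEven_pencil_iff,
    transpose_quasiIdentity_mul_comp_eq_iff, ← mul_neg]
  simp only [← smul_neg]
  exact and_congr_left' (transpose_quasiIdentity_mul_comp_eq_iff
    (N := -leadBlock m e p s (coeffMat P)))

theorem IsSignPattern.isTEven {d : ℕ → ℤˣ} (hd : IsSignPattern m e p s d)
    (hm : m = 2 * e + 1 + (p + 2 * s)) {P : Matrix (Fin n) (Fin n) ℂ[X]} (hP : IsTEven P) :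
    IsTEven (toPoly (quasiIdentity n fun a : Fin m => d a) * pencilL m (2 * e) p P) := by
  have hA : ∀ i, (coeffMat P i)ᵀ = altCoeff (coeffMat P) i := isTEven_iff.1 hP
  rw [isTEven_quasiIdentity_mul_pencilL_iff hm]
  constructor
  · intro a b
    have h := hd.leadBlock (coeffMat P) hm b a
    rw [← blockTranspose_leadBlock hm hA, blockTranspose, Matrix.of_apply, Pi.neg_apply,
      Units.neg_smul] at h
    rw [h, neg_neg]
  · intro a b
    have h := hd.constBlock (coeffMat P) hm b a
    rw [← blockTranspose_constBlock hm hA, blockTranspose, Matrix.of_apply] at h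
    rw [h]

end TEven

/-! ### Nonzero blocks of the coefficients of `L(λ)` -/

section Rows

variable {S : Type*} [Ring S] {m : ℕ} (A : ℕ → S)

theorem supportedOn_prod_range {q : ℕ} (hq : q < m) :
    SupportedOn 0 q ((List.range (q + 1)).map (highFactor m A)).prod :=
  SupportedOn.list_prod fun i hi => by
    have := List.mem_range.1 hi
    exact (supportedOn_highFactor A (by omega)).mono (by omega) (by omega)

theorem supportedOn_prod_hankel {q : ℕ} (hq : q ≤ m) :
    SupportedOn 0 (q - 1) ((hankelTuple q).map (highFactor m A)).prod :=
  SupportedOn.list_prod fun i hi => by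
    have := lt_of_mem_hankelTuple hi
    exact (supportedOn_highFactor A (by omega)).mono (by omega) (by omega)

theorem vecMul_prod_hankel_of_le {q j : ℕ} (hq : q ≤ j) (hj : j < m) :
    basisVec m S j ᵥ* ((hankelTuple q).map (highFactor m A)).prod = basisVec m S j := by
  rcases Nat.eq_zero_or_pos q with rfl | hq0
  · simp [hankelTuple]
  · exact (supportedOn_prod_hankel A (by omega)).vecMul hj (by omega)

theorem vecMul_prod_range_zero {q : ℕ} (hq : q < m) :
    basisVec m S 0 ᵥ* ((List.range (q + 1)).map (highFactor m A)).prod = A m • basisVec m S q := by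
  induction q with
  | zero => simpa using vecMul_highFactor_zero A hq
  | succ q ih =>
    rw [List.range_succ, List.map_append, List.prod_append, ← Matrix.vecMul_vecMul, ih (by omega),
      Matrix.smul_vecMul, List.map_singleton, List.prod_singleton, vecMul_highFactor A hq]

theorem vecMul_prod_range_succ {q b : ℕ} (hq : q < m) (hb : b < q) :
    basisVec m S (b + 1) ᵥ* ((List.range (q + 1)).map (highFactor m A)).prod
      = basisVec m S b + A (m - (b + 1)) • basisVec m S q := by
  induction q with
  | zero => omega
  | succ q ih =>
    rw [List.range_succ, List.map_append, List.prod_append, ← Matrix.vecMul_vecMul,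
      List.map_singleton, List.prod_singleton]
    rcases (Nat.lt_succ_iff.1 hb).eq_or_lt with rfl | hbq
    · rw [(supportedOn_prod_range A (by omega)).vecMul hq (by omega),
        vecMul_highFactor_succ A (i := m - (b + 1)) (by omega) (by omega)]
    · rw [ih (by omega) hbq, Matrix.add_vecMul, Matrix.smul_vecMul, vecMul_highFactor A hq,
        (supportedOn_highFactor A hq).vecMul (by omega) (by omega)]

theorem vecMul_prod_hankel_apply {q b c : ℕ} (hq : q ≤ m) (hbc : b + c + 1 = q) (hc : c < m) :
    (basisVec m S b ᵥ* ((hankelTuple q).map (highFactor m A)).prod) ⟨c, hc⟩ = A m := by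
  induction q generalizing b with
  | zero => omega
  | succ q ih =>
    rw [hankelTuple, List.map_append, List.prod_append, ← Matrix.vecMul_vecMul]
    rcases b with _ | b
    · rw [vecMul_prod_range_zero A (by omega), Matrix.smul_vecMul,
        vecMul_prod_hankel_of_le A le_rfl (by omega), Pi.smul_apply, basisVec,
        if_pos (by simp only; omega), smul_eq_mul, mul_one]
    · rw [vecMul_prod_range_succ A (by omega) (by omega), Matrix.add_vecMul, Matrix.smul_vecMul,
        vecMul_prod_hankel_of_le A le_rfl (by omega), Pi.add_apply, Pi.smul_apply,
        ih (by omega) (by omega), basisVec, if_neg (by simp only; omega), smul_zero, add_zero]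

variable {p s : ℕ}

theorem vecMul_prod_admCompl_of_lt {b : ℕ} (h : p + 2 * s < m) (hb : b < p) :
    basisVec m S b ᵥ* ((admCompl p s).map (highFactor m A)).prod
      = basisVec m S b ᵥ* ((hankelTuple p).map (highFactor m A)).prod := by
  induction s with
  | zero => rfl
  | succ s ih =>
    rw [admCompl, List.map_cons, List.prod_cons, ← Matrix.vecMul_vecMul,
      (supportedOn_highFactor A (by omega)).vecMul (by omega) (by omega), ih (by omega)]

theorem vecMul_prod_admCompl_of_le {b : ℕ} (hb : p + 2 * s ≤ b) (hbm : b < m) :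
    basisVec m S b ᵥ* ((admCompl p s).map (highFactor m A)).prod = basisVec m S b := by
  induction s with
  | zero => exact vecMul_prod_hankel_of_le A hb hbm
  | succ s ih =>
    rw [admCompl, List.map_cons, List.prod_cons, ← Matrix.vecMul_vecMul,
      (supportedOn_highFactor A (by omega)).vecMul (by omega) (by omega), ih (by omega)]

theorem vecMul_prod_admCompl_even {t : ℕ} (h : p + 2 * s < m) (ht : t < s) :
    basisVec m S (p + 2 * t) ᵥ* ((admCompl p s).map (highFactor m A)).prod
      = basisVec m S (p + 2 * t + 1) := by
  induction s with
  | zero => omega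
  | succ s ih =>
    rw [admCompl, List.map_cons, List.prod_cons, ← Matrix.vecMul_vecMul]
    rcases (Nat.lt_succ_iff.1 ht).eq_or_lt with rfl | hts
    · rw [vecMul_highFactor A (by omega), vecMul_prod_admCompl_of_le A (by omega) (by omega)]
    · rw [(supportedOn_highFactor A (by omega)).vecMul (by omega) (by omega), ih (by omega) hts]

theorem vecMul_prod_admTuple_of_lt {b : ℕ} (h : p + 2 * s < m) (hb : b < p) :
    basisVec m S b ᵥ* ((admTuple p s).map (highFactor m A)).prod
      = basisVec m S b ᵥ* ((List.range (p + 1)).map (highFactor m A)).prod := by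
  induction s with
  | zero => rfl
  | succ s ih =>
    rw [admTuple, List.map_cons, List.prod_cons, List.map_cons, List.prod_cons,
      ← Matrix.vecMul_vecMul, ← Matrix.vecMul_vecMul,
      (supportedOn_highFactor A (by omega)).vecMul (by omega) (by omega),
      (supportedOn_highFactor A (by omega)).vecMul (by omega) (by omega), ih (by omega)]

theorem supportedOn_prod_admTuple (h : p + 2 * s < m) :
    SupportedOn 0 (p + 2 * s) ((admTuple p s).map (highFactor m A)).prod :=
  SupportedOn.list_prod fun i hi => by
    have := mem_admTuple.1 hi
    exact (supportedOn_highFactor A (by omega)).mono (by omega) (by omega)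

theorem vecMul_prod_admTuple_even {t : ℕ} (h : p + 2 * s < m) (ht : t < s) :
    basisVec m S (p + 2 * t) ᵥ* ((admTuple p s).map (highFactor m A)).prod
      = basisVec m S (p + 2 * t + 2) := by
  induction s with
  | zero => omega
  | succ s ih =>
    rw [admTuple, List.map_cons, List.prod_cons, List.map_cons, List.prod_cons,
      ← Matrix.vecMul_vecMul, ← Matrix.vecMul_vecMul]
    rcases (Nat.lt_succ_iff.1 ht).eq_or_lt with rfl | hts
    · rw [vecMul_highFactor A (by omega), vecMul_highFactor A (by omega),
        (supportedOn_prod_admTuple A (by omega)).vecMul (by omega) (by omega)]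
    · rw [(supportedOn_highFactor A (by omega)).vecMul (by omega) (by omega),
        (supportedOn_highFactor A (by omega)).vecMul (by omega) (by omega), ih (by omega) hts]

variable {e k : ℕ}

theorem supportedOn_prod_admCompl_low (hm : m = 2 * e + 1 + k) :
    SupportedOn (k + 1) (m - 1) ((admCompl 0 e).map (lowFactor m A)).prod :=
  SupportedOn.list_prod fun i hi => by
    have := lt_of_mem_admCompl hi
    have := pos_of_mem_admCompl_zero hi
    exact (supportedOn_lowFactor A (by omega)).mono (by omega) (by omega)

theorem supportedOn_prod_admTuple_low (hm : m = 2 * e + 1 + k) :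
    SupportedOn k m ((admTuple 0 e).map (lowFactor m A)).prod :=
  SupportedOn.list_prod fun i hi => by
    have := mem_admTuple.1 hi
    exact (supportedOn_lowFactor A (by omega)).mono (by omega) (by omega)

theorem vecMul_prod_admCompl_low {t : ℕ} (hm : m = 2 * e + 1 + k) (ht : t < e) :
    basisVec m S (k + 2 * t + 2) ᵥ* ((admCompl 0 e).map (lowFactor m A)).prod
      = basisVec m S (k + 2 * t + 1) := by
  induction e generalizing k t with
  | zero => omega
  | succ e ih =>
    rw [admCompl, List.map_cons, List.prod_cons, ← Matrix.vecMul_vecMul, Nat.zero_add]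
    rcases t with _ | t
    · rw [vecMul_lowFactor_succ A (by omega) (by omega)]
      exact (supportedOn_prod_admCompl_low A (k := k + 2) (by omega)).vecMul (by omega) (by omega)
    · rw [(supportedOn_lowFactor A (by omega)).vecMul (by omega) (by omega),
        show k + 2 * (t + 1) = k + 2 + 2 * t by ring, ih (by omega) (by omega)]

theorem vecMul_prod_admTuple_low {t : ℕ} (hm : m = 2 * e + 1 + k) (ht : t < e) :
    basisVec m S (k + 2 * t + 2) ᵥ* ((admTuple 0 e).map (lowFactor m A)).prod
      = basisVec m S (k + 2 * t) := by
  induction e generalizing k t with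
  | zero => omega
  | succ e ih =>
    rw [admTuple, List.map_cons, List.prod_cons, List.map_cons, List.prod_cons,
      ← Matrix.vecMul_vecMul, ← Matrix.vecMul_vecMul, Nat.zero_add]
    rcases t with _ | t
    · rw [vecMul_lowFactor_succ A (by omega) (by omega),
        vecMul_lowFactor_succ A (by omega) (by omega)]
      exact (supportedOn_prod_admTuple_low A (k := k + 2) (by omega)).vecMul (by omega) (by omega)
    · rw [(supportedOn_lowFactor A (by omega)).vecMul (by omega) (by omega),
        (supportedOn_lowFactor A (by omega)).vecMul (by omega) (by omega),
        show k + 2 * (t + 1) = k + 2 + 2 * t by ring, ih (by omega) (by omega)]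

theorem vecMul_leadBlock (v : Fin m → S) : v ᵥ* leadBlock m e p s A
    = v ᵥ* ((admTuple p s).map (highFactor m A)).prod
      ᵥ* ((admCompl 0 e).map (lowFactor m A)).prod
      ᵥ* ((admCompl p s).map (highFactor m A)).prod := by
  rw [leadBlock, Matrix.vecMul_vecMul, Matrix.vecMul_vecMul, mul_assoc]

theorem vecMul_constBlock (v : Fin m → S) : v ᵥ* constBlock m e p s A
    = v ᵥ* ((admTuple 0 e).map (lowFactor m A)).prod
      ᵥ* ((admCompl 0 e).map (lowFactor m A)).prod
      ᵥ* ((admCompl p s).map (highFactor m A)).prod := by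
  rw [constBlock, Matrix.vecMul_vecMul, Matrix.vecMul_vecMul, mul_assoc]

variable (hm : m = 2 * e + 1 + (p + 2 * s))
include hm

theorem vecMul_leadBlock_low {t : ℕ} (ht : t < e) :
    basisVec m S (p + 2 * s + 2 * t + 2) ᵥ* leadBlock m e p s A
      = basisVec m S (p + 2 * s + 2 * t + 1) := by
  rw [vecMul_leadBlock, (supportedOn_prod_admTuple A (by omega)).vecMul (by omega) (by omega),
    vecMul_prod_admCompl_low A hm ht, vecMul_prod_admCompl_of_le A (by omega) (by omega)]

theorem vecMul_constBlock_low_zero (he : 0 < e) :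
    basisVec m S (p + 2 * s + 2) ᵥ* constBlock m e p s A = basisVec m S (p + 2 * s) := by
  have hrow := vecMul_prod_admTuple_low A (t := 0) hm he
  rw [mul_zero, add_zero] at hrow
  rw [vecMul_constBlock, hrow,
    (supportedOn_prod_admCompl_low A hm).vecMul (by omega) (by omega),
    vecMul_prod_admCompl_of_le A le_rfl (by omega)]

theorem vecMul_constBlock_low_succ {t : ℕ} (ht : t + 1 < e) :
    basisVec m S (p + 2 * s + 2 * (t + 1) + 2) ᵥ* constBlock m e p s A
      = basisVec m S (p + 2 * s + 2 * t + 1) := by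
  rw [vecMul_constBlock, vecMul_prod_admTuple_low A hm ht,
    show p + 2 * s + 2 * (t + 1) = p + 2 * s + 2 * t + 2 by ring,
    vecMul_prod_admCompl_low A hm (by omega), vecMul_prod_admCompl_of_le A (by omega) (by omega)]

theorem vecMul_constBlock_of_lt {b : ℕ} (hb : b < p + 2 * s) :
    basisVec m S b ᵥ* constBlock m e p s A
      = basisVec m S b ᵥ* ((admCompl p s).map (highFactor m A)).prod := by
  rw [vecMul_constBlock, (supportedOn_prod_admTuple_low A hm).vecMul (by omega) (by omega),
    (supportedOn_prod_admCompl_low A hm).vecMul (by omega) (by omega)]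

theorem vecMul_leadBlock_mid {t : ℕ} (ht : t < s) :
    basisVec m S (p + 2 * t) ᵥ* leadBlock m e p s A
      = basisVec m S (p + 2 * (t + 1)) ᵥ* ((admCompl p s).map (highFactor m A)).prod := by
  rw [vecMul_leadBlock, vecMul_prod_admTuple_even A (by omega) ht,
    (supportedOn_prod_admCompl_low A hm).vecMul (by omega) (by omega),
    show p + 2 * (t + 1) = p + 2 * t + 2 by ring]

theorem vecMul_constBlock_high_apply {b c : ℕ} (hbc : b + c + 1 = p) (hc : c < m) :
    (basisVec m S b ᵥ* constBlock m e p s A) ⟨c, hc⟩ = A m := by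
  rw [vecMul_constBlock_of_lt A hm (by omega), vecMul_prod_admCompl_of_lt A (by omega) (by omega),
    vecMul_prod_hankel_apply A (by omega) hbc]

theorem vecMul_leadBlock_zero (hp : 0 < p) :
    basisVec m S 0 ᵥ* leadBlock m e p s A
      = A m • (basisVec m S p ᵥ* ((admCompl p s).map (highFactor m A)).prod) := by
  rw [vecMul_leadBlock, vecMul_prod_admTuple_of_lt A (by omega) hp,
    vecMul_prod_range_zero A (by omega), Matrix.smul_vecMul, Matrix.smul_vecMul,
    (supportedOn_prod_admCompl_low A hm).vecMul (by omega) (by omega)]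

theorem vecMul_prod_admCompl_self :
    basisVec m S p ᵥ* ((admCompl p s).map (highFactor m A)).prod
      = basisVec m S (if s = 0 then p else p + 1) := by
  split_ifs with hs
  · subst hs
    exact vecMul_prod_admCompl_of_le A le_rfl (by omega)
  · exact vecMul_prod_admCompl_even A (t := 0) (by omega) (by omega)

theorem vecMul_leadBlock_high_apply {b c : ℕ} (hbc : b + c + 1 = p) (hb : b + 1 < p) (hc : c < m) :
    (basisVec m S (b + 1) ᵥ* leadBlock m e p s A) ⟨c, hc⟩ = A m := by
  have hlow := supportedOn_prod_admCompl_low A hm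
  rw [vecMul_leadBlock, vecMul_prod_admTuple_of_lt A (by omega) hb,
    vecMul_prod_range_succ A (by omega) (by omega), Matrix.add_vecMul, Matrix.add_vecMul,
    Matrix.smul_vecMul, Matrix.smul_vecMul, hlow.vecMul (by omega) (by omega),
    hlow.vecMul (by omega) (by omega), Pi.add_apply, Pi.smul_apply,
    vecMul_prod_admCompl_of_lt A (by omega) (by omega),
    vecMul_prod_hankel_apply A (by omega) hbc, vecMul_prod_admCompl_self A hm, basisVec,
    if_neg (by simp only; split_ifs <;> omega), smul_zero, add_zero]

end Rows

section Connected

variable {S : Type*} [Ring S] {m : ℕ} {α : Type*} {f : ℕ → α}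

/-- `f` takes the same value at the row and at the column of each nonzero block of `M`: it is
constant on the connected components of the graph of the nonzero blocks. -/
def ConstantOnBlocks (f : ℕ → α) (M : Matrix (Fin m) (Fin m) S) : Prop :=
  ∀ a b : Fin m, M a b ≠ 0 → f a = f b

theorem ConstantOnBlocks.eq_of_vecMul_apply_ne_zero {M : Matrix (Fin m) (Fin m) S} {a b : ℕ}
    (h : ConstantOnBlocks f M) (ha : a < m) (hb : b < m)
    (hab : (basisVec m S a ᵥ* M) ⟨b, hb⟩ ≠ 0) : f a = f b := by
  rw [basisVec_vecMul ha] at hab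
  exact h ⟨a, ha⟩ ⟨b, hb⟩ hab

theorem ConstantOnBlocks.eq_of_vecMul_eq [Nontrivial S] {M : Matrix (Fin m) (Fin m) S} {a b : ℕ}
    (h : ConstantOnBlocks f M) (ha : a < m) (hb : b < m)
    (hab : basisVec m S a ᵥ* M = basisVec m S b) : f a = f b :=
  h.eq_of_vecMul_apply_ne_zero ha hb <| by
    rw [hab, basisVec, if_pos rfl]
    exact one_ne_zero

variable {A : ℕ → S} {e p s : ℕ} (hm : m = 2 * e + 1 + (p + 2 * s))
  (hlead : ConstantOnBlocks f (leadBlock m e p s A))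
  (hconst : ConstantOnBlocks f (constBlock m e p s A))
include hm hlead hconst

theorem eq_of_constantOnBlocks_low [Nontrivial S] {t : ℕ} (ht : t ≤ e) :
    f (p + 2 * s + 2 * t) = f (p + 2 * s) := by
  induction t with
  | zero => rfl
  | succ t ih =>
    rcases t with _ | t
    · exact hconst.eq_of_vecMul_eq (by omega) (by omega)
        (vecMul_constBlock_low_zero A hm (by omega))
    · rw [← ih (by omega)]
      exact (hconst.eq_of_vecMul_eq (by omega) (by omega)
        (vecMul_constBlock_low_succ A hm (by omega))).trans
          (hlead.eq_of_vecMul_eq (by omega) (by omega) (vecMul_leadBlock_low A hm (by omega))).symm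

omit hlead in
theorem eq_succ_of_constantOnBlocks_mid [Nontrivial S] {t : ℕ} (ht : t < s) :
    f (p + 2 * t) = f (p + 2 * t + 1) := by
  refine hconst.eq_of_vecMul_eq (by omega) (by omega) ?_
  rw [vecMul_constBlock_of_lt A hm (by omega), vecMul_prod_admCompl_even A (by omega) ht]

theorem eq_of_constantOnBlocks_mid [Nontrivial S] {t : ℕ} (ht : t ≤ s) : f (p + 2 * t) = f p := by
  induction t with
  | zero => rfl
  | succ t ih =>
    rw [← ih (by omega)]
    rcases ht.lt_or_eq with hts | rfl
    · rw [eq_succ_of_constantOnBlocks_mid hm hconst hts]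
      refine (hlead.eq_of_vecMul_eq (by omega) (by omega) ?_).symm
      rw [vecMul_leadBlock_mid A hm (by omega), vecMul_prod_admCompl_even A (by omega) hts]
    · refine (hlead.eq_of_vecMul_eq (by omega) (by omega) ?_).symm
      rw [vecMul_leadBlock_mid A hm (by omega), vecMul_prod_admCompl_of_le A le_rfl (by omega)]

theorem eq_of_constantOnBlocks_high (hA : A m ≠ 0) {b : ℕ} (hb : b < p) : f b = f p := by
  have : Nontrivial S := ⟨_, _, hA⟩
  induction b with
  | zero =>
    have hfp : f (if s = 0 then p else p + 1) = f p := by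
      split_ifs with hs
      · rfl
      · exact (eq_succ_of_constantOnBlocks_mid (t := 0) hm hconst (by omega)).symm
    rw [← hfp]
    refine hlead.eq_of_vecMul_apply_ne_zero (by omega) (by split_ifs <;> omega) ?_
    rw [vecMul_leadBlock_zero A hm hb, vecMul_prod_admCompl_self A hm, Pi.smul_apply, basisVec,
      if_pos rfl, smul_eq_mul, mul_one]
    exact hA
  | succ b ih =>
    obtain ⟨c, hbc⟩ := Nat.exists_eq_add_of_lt (Nat.lt_of_succ_lt hb)
    rw [← ih (by omega)]
    refine (hlead.eq_of_vecMul_apply_ne_zero (b := c) (by omega) (by omega) ?_).trans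
      (hconst.eq_of_vecMul_apply_ne_zero (by omega) (by omega) ?_).symm
    · rwa [vecMul_leadBlock_high_apply A hm hbc.symm hb]
    · rwa [vecMul_constBlock_high_apply A hm hbc.symm]

theorem eq_of_constantOnBlocks (hA : A m ≠ 0) {j : ℕ} (hj : j < m) : f j = f p := by
  have : Nontrivial S := ⟨_, _, hA⟩
  rcases lt_or_ge j p with hjp | hjp
  · exact eq_of_constantOnBlocks_high hm hlead hconst hA hjp
  rcases le_or_gt j (p + 2 * s) with hjk | hjk
  · rcases Nat.even_or_odd' (j - p) with ⟨t, ht | ht⟩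
    · rw [show j = p + 2 * t by omega, eq_of_constantOnBlocks_mid hm hlead hconst (by omega)]
    · rw [show j = p + 2 * t + 1 by omega, ← eq_succ_of_constantOnBlocks_mid hm hconst (by omega),
        eq_of_constantOnBlocks_mid hm hlead hconst (by omega)]
  · rw [← eq_of_constantOnBlocks_mid hm hlead hconst le_rfl]
    rcases Nat.even_or_odd' (j - (p + 2 * s)) with ⟨t, ht | ht⟩
    · rw [show j = p + 2 * s + 2 * t by omega,
        eq_of_constantOnBlocks_low hm hlead hconst (by omega)]
    · rw [show j = p + 2 * s + 2 * t + 1 by omega,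
        ← hlead.eq_of_vecMul_eq (by omega) (by omega) (vecMul_leadBlock_low A hm (by omega))]
      exact eq_of_constantOnBlocks_low (t := t + 1) hm hlead hconst (by omega)

end Connected

section Uniqueness

variable {m e p s n : ℕ}

theorem mul_eq_mul_of_smul_eq {V : Type*} [AddCommGroup V] [Module ℂ V] {u v u' v' : ℤˣ} {x y : V}
    (hx : x ≠ 0) (h : u • x = v • y) (h' : u' • x = v' • y) : u' * u = v' * v := by
  have hneg : -x ≠ x := fun hxx => by
    rw [neg_eq_iff_add_eq_zero, ← two_smul ℂ] at hxx
    exact hx ((smul_eq_zero.1 hxx).resolve_left two_ne_zero)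
  have hy : y = (v * u) • x := by rw [mul_smul, h, smul_smul, Int.units_mul_self, one_smul]
  have hcancel : ∀ w w' : ℤˣ, w • x = w' • x → w = w' := fun w w' hww => by
    rcases Int.units_eq_one_or w with rfl | rfl <;> rcases Int.units_eq_one_or w' with rfl | rfl <;>
      simp_all [eq_comm]
  rw [hy, smul_smul] at h'
  rw [hcancel _ _ h', mul_assoc, mul_assoc, Int.units_mul_self, mul_one]

theorem eq_or_eq_neg_of_isTEven (hm : m = 2 * e + 1 + (p + 2 * s)) {P : Matrix (Fin n) (Fin n) ℂ[X]}
    (hP : coeffMat P m ≠ 0) {ε ε' : Fin m → ℤˣ}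
    (h : IsTEven (toPoly (quasiIdentity n ε) * pencilL m (2 * e) p P))
    (h' : IsTEven (toPoly (quasiIdentity n ε') * pencilL m (2 * e) p P)) : ε' = ε ∨ ε' = -ε := by
  rw [isTEven_quasiIdentity_mul_pencilL_iff hm] at h h'
  let ratio : ℕ → ℤˣ := fun j => if hj : j < m then ε' ⟨j, hj⟩ * ε ⟨j, hj⟩ else 1
  have hratio : ∀ a : Fin m, ratio a = ε' a * ε a := fun a => dif_pos a.2
  have hlead : ConstantOnBlocks ratio (leadBlock m e p s (coeffMat P)) := fun a b hab => by
    rw [hratio, hratio]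
    exact mul_eq_mul_of_smul_eq (Matrix.transpose_eq_zero.not.2 hab)
      ((h.1 a b).trans (smul_neg _ _).symm) ((h'.1 a b).trans (smul_neg _ _).symm)
  have hconst : ConstantOnBlocks ratio (constBlock m e p s (coeffMat P)) := fun a b hab => by
    rw [hratio, hratio]
    exact mul_eq_mul_of_smul_eq (Matrix.transpose_eq_zero.not.2 hab) (h.2 a b) (h'.2 a b)
  have hε : ∀ a, ε' a = ratio p * ε a := fun a => by
    rw [← eq_of_constantOnBlocks hm hlead hconst hP a.2, hratio, mul_assoc, Int.units_mul_self,
      mul_one]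
  rcases Int.units_eq_one_or (ratio p) with hone | hneg
  · exact Or.inl (funext fun a => by rw [hε, hone, one_mul])
  · exact Or.inr (funext fun a => by rw [hε, hneg, neg_one_mul, Pi.neg_apply])

end Uniqueness

/-! ### Hamiltonian system matrices -/

section Hamiltonian

variable {ι κ : Type}

/-- The substitution `λ ↦ -λ` in a matrix polynomial. -/
def compNeg (P : Matrix ι κ ℂ[X]) : Matrix ι κ ℂ[X] := P.map fun p => p.comp (-Polynomial.X)

theorem negSubst_algebraMap (q : ℂ[X]) : negSubst (algebraMap ℂ[X] (RatFunc ℂ) q)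
    = algebraMap ℂ[X] (RatFunc ℂ) (q.comp (-Polynomial.X)) := by
  have h := RatFunc.map_apply_div (K := ℂ) (R := ℂ)
    (Polynomial.algEquivAevalNegX : ℂ[X] ≃ₐ[ℂ] ℂ[X])
    (nonZeroDivisors_le_comap_nonZeroDivisors_of_injective _
      (Polynomial.algEquivAevalNegX : ℂ[X] ≃ₐ[ℂ] ℂ[X]).injective) q 1
  rw [map_one, map_one, map_one, div_one, div_one] at h
  exact h

theorem map_negSubst_toRat (P : Matrix ι κ ℂ[X]) :
    (toRat P).map negSubst = toRat (compNeg P) := by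
  ext a b
  exact negSubst_algebraMap _

theorem compNeg_toPoly (M : Matrix ι κ ℂ) : compNeg (toPoly M) = toPoly M := by
  ext : 2
  simp [compNeg, toPoly]

theorem isHamiltonianRat_toRat {P : Matrix ι ι ℂ[X]} (hP : IsTEven P) :
    IsHamiltonianRat (toRat P) := by
  rw [IsHamiltonianRat, map_negSubst_toRat]
  exact congrArg toRat hP

theorem IsHamiltonianRat.add {F G : Matrix ι ι (RatFunc ℂ)} (hF : IsHamiltonianRat F)
    (hG : IsHamiltonianRat G) : IsHamiltonianRat (F + G) := by
  rw [IsHamiltonianRat, Matrix.map_add _ (map_add negSubst), Matrix.transpose_add, hF, hG]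

theorem IsHamiltonianRat.inv [Fintype ι] [DecidableEq ι] {F : Matrix ι ι (RatFunc ℂ)}
    (hF : IsHamiltonianRat F) (hdet : IsUnit F.det) : IsHamiltonianRat F⁻¹ := by
  refine (Matrix.inv_eq_right_inv ?_).symm
  have h : (F⁻¹ * F).map negSubst = 1 := by
    rw [Matrix.nonsing_inv_mul _ hdet, Matrix.map_one _ (map_zero _) (map_one _)]
  rw [Matrix.map_mul, ← Matrix.transpose_inj, Matrix.transpose_mul, hF,
    Matrix.transpose_one] at h
  exact h

theorem IsHamiltonianRat.mul_mul_transpose [Fintype κ] {F : Matrix κ κ (RatFunc ℂ)}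
    (hF : IsHamiltonianRat F) (C : Matrix ι κ ℂ) :
    IsHamiltonianRat (toRat (toPoly C) * F * toRat (toPoly Cᵀ)) := by
  have hC {ι κ : Type} (M : Matrix ι κ ℂ) :
      ((toRat (toPoly M)).map negSubst)ᵀ = toRat (toPoly Mᵀ) := by
    rw [map_negSubst_toRat, compNeg_toPoly]
    rfl
  rw [IsHamiltonianRat, Matrix.map_mul, Matrix.map_mul, Matrix.transpose_mul,
    Matrix.transpose_mul, hC, hC, hF, Matrix.transpose_transpose, Matrix.mul_assoc]

theorem isTEven_fromBlocks_iff {P : Matrix ι ι ℂ[X]} {C : Matrix ι κ ℂ} {B : Matrix κ ι ℂ}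
    {D : Matrix κ κ ℂ[X]} : IsTEven (Matrix.fromBlocks P (toPoly C) (toPoly B) D) ↔
      IsTEven P ∧ B = Cᵀ ∧ IsTEven D := by
  have hinj : Function.Injective (toPoly : Matrix κ ι ℂ → Matrix κ ι ℂ[X]) :=
    Matrix.map_injective Polynomial.C_injective
  have hT {ι κ : Type} (M : Matrix ι κ ℂ) : (compNeg (toPoly M))ᵀ = toPoly Mᵀ := by
    rw [compNeg_toPoly]
    rfl
  have hblocks : IsTEven (Matrix.fromBlocks P (toPoly C) (toPoly B) D) ↔
      Matrix.fromBlocks (compNeg P)ᵀ (compNeg (toPoly B))ᵀ (compNeg (toPoly C))ᵀ (compNeg D)ᵀ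
        = Matrix.fromBlocks P (toPoly C) (toPoly B) D := by
    rw [IsTEven, Matrix.fromBlocks_map, Matrix.fromBlocks_transpose]
    rfl
  rw [hblocks, Matrix.fromBlocks_inj, hT, hT]
  constructor
  · rintro ⟨hP, -, hB, hD⟩
    exact ⟨hP, (hinj hB).symm, hD⟩
  · rintro ⟨hP, rfl, hD⟩
    exact ⟨hP, by rw [Matrix.transpose_transpose], rfl, hD⟩

variable {ℓ : ℕ}

theorem transpose_J : (J ℓ)ᵀ = -J ℓ := by
  simp [J, Matrix.fromBlocks_transpose, Matrix.fromBlocks_neg]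

theorem transpose_J_mul_J : (J ℓ)ᵀ * J ℓ = 1 := by
  simp [J, Matrix.fromBlocks_transpose, Matrix.fromBlocks_multiply]

theorem J_mul_pencil (A : Matrix (Fin ℓ ⊕ Fin ℓ) (Fin ℓ ⊕ Fin ℓ) ℂ) :
    toPoly (J ℓ) * ((Polynomial.X : ℂ[X]) • toPoly 1 - toPoly A)
      = (Polynomial.X : ℂ[X]) • toPoly (J ℓ) - toPoly (J ℓ * A) := by
  rw [mul_sub, Matrix.mul_smul, ← toPoly_mul, ← toPoly_mul, mul_one]

theorem isTEven_J_mul_pencil_iff {A : Matrix (Fin ℓ ⊕ Fin ℓ) (Fin ℓ ⊕ Fin ℓ) ℂ} :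
    IsTEven (toPoly (J ℓ) * ((Polynomial.X : ℂ[X]) • toPoly 1 - toPoly A))
      ↔ (J ℓ * A)ᵀ = J ℓ * A := by
  rw [J_mul_pencil, isTEven_pencil_iff]
  exact and_iff_right transpose_J

theorem isTEven_neg_iff {P : Matrix ι ι ℂ[X]} : IsTEven (-P) ↔ IsTEven P := by
  have h : compNeg (-P) = -compNeg P := by
    ext : 2
    simp [compNeg]
  change (compNeg (-P))ᵀ = -P ↔ (compNeg P)ᵀ = P
  rw [h, Matrix.transpose_neg, neg_inj]

theorem isHamiltonianSystem_iff [Fintype ι] [DecidableEq ι] {S : SystemData ι (Fin ℓ ⊕ Fin ℓ)} :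
    IsHamiltonianSystem S ↔
      S.E = 1 ∧ IsTEven S.P ∧ J ℓ * S.B = S.Cᵀ ∧ (J ℓ * S.A)ᵀ = J ℓ * S.A := by
  refine and_congr_right fun hE => ?_
  have h : Matrix.fromBlocks 1 0 0 (toPoly (J ℓ)) * S.toMatrix
      = Matrix.fromBlocks S.P (toPoly S.C) (toPoly (J ℓ * S.B))
        (-(toPoly (J ℓ) * ((Polynomial.X : ℂ[X]) • toPoly 1 - toPoly S.A))) := by
    rw [SystemData.toMatrix, Matrix.fromBlocks_multiply, hE, toPoly_mul, ← mul_neg, neg_sub]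
    simp
  rw [h, isTEven_fromBlocks_iff, isTEven_neg_iff, isTEven_J_mul_pencil_iff]

/-- Since `JᵀJ = I` and `JB = Cᵀ`, the transfer function is `P + C (J(λI - A))⁻¹ Cᵀ`. -/
theorem IsHamiltonianSystem.isHamiltonianRat_transfer [Fintype ι] [DecidableEq ι]
    {S : SystemData ι (Fin ℓ ⊕ Fin ℓ)} (hS : IsHamiltonianSystem S) :
    IsHamiltonianRat S.transfer := by
  obtain ⟨hE, hP, hB, hA⟩ := isHamiltonianSystem_iff.1 hS
  set j := toRat (toPoly (J ℓ))
  set M := toRat ((Polynomial.X : ℂ[X]) • toPoly 1 - toPoly S.A)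
  have hM : IsUnit M.det := isUnit_det_toRat_pencil (by simp) S.A
  have hj : toRat (toPoly (J ℓ)ᵀ) * j = 1 := by
    rw [← toRat_mul, ← toPoly_mul, transpose_J_mul_J, toPoly_one]
    exact Matrix.map_one _ (map_zero _) (map_one _)
  have hjdet : IsUnit j.det :=
    (Matrix.isUnit_iff_isUnit_det _).1 (IsUnit.of_mul_eq_one_right _ hj)
  have hjM : IsHamiltonianRat (j * M) := by
    rw [← toRat_mul]
    exact isHamiltonianRat_toRat (isTEven_J_mul_pencil_iff.2 hA)
  have htransfer : S.transfer
      = toRat S.P + toRat (toPoly S.C) * (j * M)⁻¹ * toRat (toPoly S.Cᵀ) := by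
    rw [← hB, toPoly_mul, toRat_mul, ← Matrix.mul_assoc, Matrix.mul_inv_rev,
      Matrix.mul_assoc _ _ j, Matrix.nonsing_inv_mul_cancel_right _ _ hjdet, SystemData.transfer,
      hE]
  rw [htransfer]
  refine (isHamiltonianRat_toRat hP).add ((hjM.inv ?_).mul_mul_transpose S.C)
  rw [Matrix.det_mul]
  exact hjdet.mul hM

theorem isTEven_C_smul {P : Matrix ι ι ℂ[X]} (hP : IsTEven P) (c : ℂ) :
    IsTEven (Polynomial.C c • P) := by
  have h : compNeg (Polynomial.C c • P) = Polynomial.C c • compNeg P := by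
    ext : 2
    simp [compNeg]
  change (compNeg (Polynomial.C c • P))ᵀ = _
  rw [h, Matrix.transpose_smul]
  exact congrArg _ hP

theorem isHamiltonianSystem_borderedPencil {m h p n : ℕ} (ε : Fin m → ℤˣ)
    {S : SystemData (Fin n) (Fin ℓ ⊕ Fin ℓ)} (hA : (J ℓ * S.A)ᵀ = J ℓ * S.A)
    (hT : IsTEven (toPoly (quasiIdentity n ε) * pencilL m h p S.P)) :
    IsHamiltonianSystem (borderedPencil m h p ε S) := by
  refine isHamiltonianSystem_iff.2 ⟨rfl, ?_, ?_, hA⟩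
  · have hP : (borderedPencil m h p ε S).P
        = Polynomial.C (parameter ε (position m h))
          • (toPoly (quasiIdentity n ε) * pencilL m h p S.P) := by
      rw [← Matrix.smul_mul]
      refine congrArg (· * _) ?_
      ext : 2
      simp [toPoly]
    rw [hP]
    exact isTEven_C_smul hT _
  · ext i x
    change (J ℓ * rowBlock m (position m h) S.B) i x
      = if (x.1 : ℕ) + 1 = position m h then (S.Bᵀ * (J ℓ)ᵀ) x.2 i else 0
    rw [← Matrix.transpose_mul, Matrix.transpose_apply, Matrix.mul_apply, Matrix.mul_apply]
    simp only [rowBlock, Matrix.of_apply]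
    split_ifs <;> simp

end Hamiltonian

end HamLin

end

theorem theorem4p16 (m n ℓ h p : ℕ)
    -- `0 ≤ h ≤ m - 1` is even, and `p = Ind(z + m)` is the index of an admissible tuple
    -- `z + m` of `{0:m-h-1}`
    (hm : h < m) (hh : Even h) (hp : p ≤ m - h - 1) (hp' : Even (m - h - 1 - p))
    -- `G(λ)` is Hamiltonian and `S` is a minimal Hamiltonian realization of it
    (G : Matrix (Fin n) (Fin n) (RatFunc ℂ)) (hG : HamLin.IsHamiltonianRat G)
    (S : HamLin.SystemData (Fin n) (Fin ℓ ⊕ Fin ℓ))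
    (hS : HamLin.IsHamiltonianRealization G S) (hmin : S.IsMinimal)
    (hdeg : HamLin.HasDegree S.P m)
    -- `Ind(z + m) = 0` when the leading coefficient of `P(λ)` is singular
    (hsing : ¬ IsUnit (HamLin.coeffMat S.P m).det → p = 0) :
    -- there is a quasi-identity matrix `Q` that makes `Q L(λ)` a `T`-even pencil for all `T`-even
    -- matrix polynomials of degree `m`,
    (∃ ε : Fin m → ℤˣ, ∀ (k : ℕ) (P : Matrix (Fin k) (Fin k) (Polynomial ℂ)),
      HamLin.HasDegree P m → HamLin.IsTEven P →
        HamLin.IsTEven (HamLin.toPoly (HamLin.quasiIdentity k ε) * HamLin.pencilL m h p P)) ∧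
    -- `Q` is unique up to the sign,
    (∀ ε ε' : Fin m → ℤˣ,
      HamLin.IsTEven (HamLin.toPoly (HamLin.quasiIdentity n ε) * HamLin.pencilL m h p S.P) →
      HamLin.IsTEven (HamLin.toPoly (HamLin.quasiIdentity n ε') * HamLin.pencilL m h p S.P) →
        ε' = ε ∨ ε' = -ε) ∧
    -- and, for this `Q`, the pencil `𝕋(λ)` is a Hamiltonian Rosenbrock strong linearization of
    -- `G(λ)` with Hamiltonian transfer function
    ∀ ε : Fin m → ℤˣ,
      HamLin.IsTEven (HamLin.toPoly (HamLin.quasiIdentity n ε) * HamLin.pencilL m h p S.P) →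
        HamLin.IsHamiltonianSystem (HamLin.borderedPencil m h p ε S) ∧
        HamLin.IsRosenbrockStrongLinearization S (HamLin.borderedPencil m h p ε S) ∧
        HamLin.IsHamiltonianRat (HamLin.borderedPencil m h p ε S).transfer := by
  obtain ⟨e, rfl⟩ := even_iff_exists_two_mul.1 hh
  obtain ⟨s, hs⟩ := even_iff_exists_two_mul.1 hp'
  have hm' : m = 2 * e + 1 + (p + 2 * s) := by omega
  have hA : IsUnit (HamLin.coeffMat S.P m) ∨ p = 0 := by
    rw [Matrix.isUnit_iff_isUnit_det]
    exact or_iff_not_imp_left.2 hsing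
  obtain ⟨d, hd⟩ := HamLin.exists_isSignPattern hm'
  refine ⟨⟨fun a => d a, fun k P _ hP => hd.isTEven hm' hP⟩,
    fun ε ε' => HamLin.eq_or_eq_neg_of_isTEven hm' hdeg.1, fun ε hε => ?_⟩
  have hH := HamLin.isHamiltonianSystem_borderedPencil ε hS.hamiltonian_A hε
  exact ⟨hH, HamLin.isRosenbrockStrongLinearization_borderedPencil hm' ε S hS.E_eq_one hS.J_mul_B
    hdeg.2 hA hmin, hH.isHamiltonianRat_transfer⟩
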